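/- **Conventions.** Let $\Bbbk\in\{\mathbb R,\mathbb C\}$. *Spaces.* An *sc-chain* $\mathbb E$ is a sequence of Banach spaces $E_k$ ($k\in\mathbb N_0$) over $\Bbbk$ with injective compact linear maps $\iota_k:E_{k+1}\to E_k$ of norm $\le 1$ with dense image; $E_\infty=\bigcap_kE_k$ carries the initial topology, and $\iota^n_m:E_n\to E_m$ ($m\le n\le\infty$) are the inclusions. For a strictly monotone $\mathbf k=(k_j)$ let $\mathbb E^{\mathbf k}=(E_{k_j})_j$. A linear homeomorphism $J:E_\infty\to E'_\infty$ is an *equivalence* if both $J$ and $J^{-1}$ are, for suitable strictly monotone sequences $\mathbf k,\mathbf l$, induced by injective continuous linear maps from the $k_j$-th to the $l_j$-th level commuting with the inclusions. An *$\overline{\mathrm{sc}}$-Fréchet space* is a topological vector space $E$ with an equivalence class of *$\overline{\mathrm{sc}}$-structures* (pairs of an sc-chain $\mathbb E$ and a linear homeomorphism $E_\infty\cong E$; equivalent if the transition map is an equivalence); members of the class are called *compatible*. Direct sums are formed levelwise. *Maps.* An *envelope* of a subset $A\subseteq E_\infty$ consists of open $U_k\subseteq E_k$ with $\iota_k(U_{k+1})\subseteq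 U_k$ and $A=\bigcap_k(\iota^\infty_k)^{-1}(U_k)$; an envelope of a map $f:A\to E'_\infty$ consists in addition of continuous $f_k:U_k\to E'_k$ that are compatible with $f$ and with the inclusions. A map $f:U\to E'$ on an open subset $U$ of an $\overline{\mathrm{sc}}$-Fréchet space $E$ is *$\overline{\mathrm{sc}}^0$* if every point has a neighbourhood on which $f$ has an envelope with respect to some compatible structures on $E$ and $E'$. A continuous linear $L:E\to E'$ is the *weak Fréchet derivative* $Df(x)$ if on $V\times[0,1]$, for some neighbourhood $V$ of $0$ in $E$, the map $(u,t)\mapsto t^{-1}(f(x+tu)-f(x))-Lu$ ($t>0$), $(u,0)\mapsto0$, is continuous. $f$ is *$\overline{\mathrm{sc}}^1$* if it is continuous, $Df(x)$ exists for all $x\in U$, and $f$ and $Df:U\times E\to E'$ are $\overline{\mathrm{sc}}^0$. *Fredholm families and maps.* A *family of morphisms* is an $\overline{\mathrm{sc}}^0$ map $\phi:U\times E^1\to E^2$, with $U\subseteq E$ open, linear in the second variable; $\phi(x)=\phi(x,\cdot)$. A family $\kappa$ is *strongly smoothing* if each point of $U$ has a neighbourhood $V\subseteq U$ such that $\kappa|_{V\times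 E^1}$ has, with respect to some compatible structures, an envelope $(\kappa_k:U_k\times E^1_k\to E^2_k)_k$ such that for every strictly monotone $\mathbf k$ there is an envelope $(g_j:U_{k_j}\times E^1_j\to E^2_{k_j})_j$ of $\kappa|_{V\times E^1}$ with $\kappa_j(\iota^{k_j}_jx,u)=\iota^{k_j}_j g_j(x,u)$. The family $\phi$ is *Fredholm* if each $x_0\in U$ has a neighbourhood $V\subseteq U$ with families of morphisms $\psi:V\times E^2\to E^1$, $\kappa:V\times E^1\to E^1$, $\kappa':V\times E^2\to E^2$ with $\kappa,\kappa'$ strongly smoothing and $\psi(x)\phi(x)=\mathrm{id}+\kappa(x)$, $\phi(x)\psi(x)=\mathrm{id}+\kappa'(x)$ for $x\in V$. Put $\operatorname{corank}\phi(x)=\dim\operatorname{coker}\phi(x)$ and $\operatorname{ind}\phi(x)=\dim\ker\phi(x)-\operatorname{corank}\phi(x)$. An $\overline{\mathrm{sc}}^1$ map $f:U\to E'$ is *Fredholm* if $Df$ is a Fredholm family; $\operatorname{ind}f(x)=\operatorname{ind}Df(x)$ and $\operatorname{corank}f(x)=\operatorname{corank}Df(x)$. *Tame versions.* $\mathbf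 k$ is *tame* if it is strictly monotone and $k_j\le j+c$ for some $c$. An equivalence $J$ is *tame* if both $J$ and $J^{-1}$ are induced by continuous linear maps $E_{k_j}\to E'_j$, respectively $E'_{k_j}\to E_j$, commuting with the inclusions, for tame sequences $\mathbf k$; a *pre-tame* $\overline{\mathrm{sc}}$-Fréchet space carries a tame equivalence class of structures (the *tamely compatible* ones). An $\overline{\mathrm{sc}}^0$ map between pre-tame spaces is *tame* if locally it has an envelope, with respect to tamely compatible structures, with constants $C_k$ such that $\|f_k(x)\|\le C_k(1+\|x\|)$ on $U_k$. A *tame strongly smoothing* family is a tame family which satisfies the definition of strongly smoothing with tamely compatible structures and with $\mathbf k$ ranging over the tame sequences, where for all $j$ and $R$ there is $C$ with $\|g_j(x,u)\|\le C(1+\|x\|+\|u\|)$ for all $x\in U_{k_j}$ and all $u\in E^1_j$ with $\|\iota^j_0u\|\le R$, and likewise for the $\kappa_k$. A *tame Fredholm family* is defined as a Fredholm family, with all families tame and $\kappa,\kappa'$ tame strongly smoothing. An $\overline{\mathrm{sc}}^1$ map $f$ is *tame Fredholm* if $f$ is tame and $Df$ is a tame Fredholm family. **Statement.** Let $E,E',E''$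 be $\overline{\mathrm{sc}}$-Fréchet spaces and let $U\subseteq E$ and $U'\subseteq E'$ be open. (A) Let $\phi:U\times E'\to E''$ be a Fredholm family of morphisms. Then $\ker\phi(x)$ and $\operatorname{coker}\phi(x)$ are finite dimensional for every $x\in U$, the functions $\dim\ker\phi,\ \operatorname{corank}\phi:U\to\mathbb N_0$ are upper semicontinuous, and $\operatorname{ind}\phi:U\to\mathbb Z$ is continuous (i.e. locally constant). (B) 1. If $f:U\to E'$ is an $\overline{\mathrm{sc}}^1$ Fredholm map, then $Df(x)$ has finite dimensional kernel and cokernel for every $x\in U$, $\operatorname{ind}f:U\to\mathbb Z$ is continuous, and $\operatorname{corank}f:U\to\mathbb N_0$ is upper semicontinuous. 2. If $f:U\to E'$ and $f':U'\to E''$ are $\overline{\mathrm{sc}}^1$ Fredholm maps with $f(U)\subseteq U'$, then $f'\circ f:U\to E''$ is an $\overline{\mathrm{sc}}^1$ Fredholm map, and $\operatorname{ind}(f'\circ f)(x)=\operatorname{ind}f(x)+\operatorname{ind}f'(f(x))$ for all $x\in U$. (C) If $E,E',E''$ are pre-tame $\overline{\mathrm{sc}}$-Fréchet spaces, then (B)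 also holds with "Fredholm" replaced by "tame Fredholm" throughout. -/

import Mathlib

open Set Filter Topology

universe u v w

/-! ### sc-chains -/

/-- An sc-chain over `𝕜`: a sequence of Banach spaces together with injective compact linear maps
with dense image and operator norm at most one, `ι k : E_{k+1} → E_k`. -/
structure ScChain (𝕜 : Type*) [RCLike 𝕜] where
  level : ℕ → Type u
  [normed : ∀ k, NormedAddCommGroup (level k)]
  [space : ∀ k, NormedSpace 𝕜 (level k)]
  [complete : ∀ k, CompleteSpace (level k)]
  ι : ∀ k, level (k + 1) →L[𝕜] level k
  ι_injective : ∀ k, Function.Injective (ι k)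
  ι_denseRange : ∀ k, DenseRange (ι k)
  ι_norm_le : ∀ k, ‖ι k‖ ≤ 1
  ι_compact : ∀ k, IsCompactOperator (ι k)

attribute [instance] ScChain.normed ScChain.space ScChain.complete

namespace ScChain

variable {𝕜 : Type*} [RCLike 𝕜]

/-- The composite inclusion `ι^n_m : E_n → E_m` for `m ≤ n`. -/
def incl (C : ScChain.{u} 𝕜) {m n : ℕ} (h : m ≤ n) : C.level n →L[𝕜] C.level m :=
  Nat.leRec (motive := fun n _ => C.level n →L[𝕜] C.level m)
    (ContinuousLinearMap.id 𝕜 (C.level m)) (fun k _ T => T.comp (C.ι k)) h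

/-- The space `E_∞`, the intersection of all the `E_k` (i.e. their projective limit), with the
initial topology. The map `ι^∞_k : E_∞ → E_k` is `x ↦ x.1 k`. -/
def infty (C : ScChain.{u} 𝕜) : Submodule 𝕜 (∀ k, C.level k) where
  carrier := {x | ∀ k, C.ι k (x (k + 1)) = x k}
  add_mem' := by
    intro x y hx hy k
    simp [hx k, hy k]
  zero_mem' := by
    intro k
    simp
  smul_mem' := by
    intro c x hx k
    simp [hx k]

/-- A linear map `T : E_∞ → E'_∞` is a weak embedding: after passing to strictly monotone
rescalings `k` and `l` it extends to injective continuous linear maps `E_{k_j} → E'_{l_j}`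
that commute with the inclusions. -/
def IsWeakEmbedding (C C' : ScChain.{u} 𝕜) (T : C.infty →L[𝕜] C'.infty) : Prop :=
  ∃ (k l : ℕ → ℕ) (hk : StrictMono k) (hl : StrictMono l)
    (S : ∀ j, C.level (k j) →L[𝕜] C'.level (l j)),
    (∀ j, Function.Injective (S j)) ∧
    (∀ j x, S j (C.incl (hk.monotone j.le_succ) x) =
      C'.incl (hl.monotone j.le_succ) (S (j + 1) x)) ∧
    ∀ (x : C.infty) j, (T x).1 (l j) = S j (x.1 (k j))

end ScChain

/-- A sequence `k` of natural numbers is a tame rescaling: it is strictly monotone and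
`k_j ≤ j + c` for some `c`. -/
def IsTameSeq (k : ℕ → ℕ) : Prop := StrictMono k ∧ ∃ c, ∀ j, k j ≤ j + c

namespace ScChain

variable {𝕜 : Type*} [RCLike 𝕜]

/-- A linear map `T : E_∞ → E'_∞` is tame: it extends to continuous linear maps
`E_{k_j} → E'_j` that commute with the inclusions, for some tame rescaling `k`. -/
def IsTameMorphism (C C' : ScChain.{u} 𝕜) (T : C.infty →L[𝕜] C'.infty) : Prop :=
  ∃ (k : ℕ → ℕ) (hk : IsTameSeq k) (S : ∀ j, C.level (k j) →L[𝕜] C'.level j),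
    (∀ j x, S j (C.incl (hk.1.monotone j.le_succ) x) = C'.ι j (S (j + 1) x)) ∧
    ∀ (x : C.infty) j, (T x).1 j = S j (x.1 (k j))

/-- The direct sum of two sc-chains; the level spaces carry the maximum norm, which is equivalent
to the sum norm. -/
def prod (C : ScChain.{u} 𝕜) (D : ScChain.{v} 𝕜) : ScChain.{max u v} 𝕜 where
  level k := C.level k × D.level k
  ι k := (C.ι k).prodMap (D.ι k)
  ι_injective k := (C.ι_injective k).prodMap (D.ι_injective k)
  ι_denseRange k := (C.ι_denseRange k).prodMap (D.ι_denseRange k)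
  ι_norm_le k := by
    refine ContinuousLinearMap.opNorm_le_bound _ zero_le_one fun x => ?_
    have h1 : ‖C.ι k x.1‖ ≤ 1 * ‖x.1‖ := (C.ι k).le_of_opNorm_le (C.ι_norm_le k) _
    have h2 : ‖D.ι k x.2‖ ≤ 1 * ‖x.2‖ := (D.ι k).le_of_opNorm_le (D.ι_norm_le k) _
    rw [one_mul] at h1 h2 ⊢
    exact max_le_max h1 h2
  ι_compact k := by
    obtain ⟨K, hK, hK'⟩ := C.ι_compact k
    obtain ⟨L, hL, hL'⟩ := D.ι_compact k
    exact ⟨K ×ˢ L, hK.prod hL, prod_mem_nhds hK' hL'⟩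

/-- `(E ⊕ E')_∞ = E_∞ × E'_∞`. -/
def prodInfty (C : ScChain.{u} 𝕜) (D : ScChain.{v} 𝕜) :
    (C.prod D).infty ≃L[𝕜] (C.infty × D.infty) where
  toFun x := (⟨fun k => (x.1 k).1, fun k => congrArg Prod.fst (x.2 k)⟩,
    ⟨fun k => (x.1 k).2, fun k => congrArg Prod.snd (x.2 k)⟩)
  invFun y := ⟨fun k => (y.1.1 k, y.2.1 k), fun k => Prod.ext (y.1.2 k) (y.2.2 k)⟩
  map_add' _ _ := rfl
  map_smul' _ _ := rfl
  left_inv _ := rfl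
  right_inv _ := rfl
  continuous_toFun := by
    refine Continuous.prodMk (Continuous.subtype_mk ?_ _) (Continuous.subtype_mk ?_ _)
    · exact continuous_pi fun k =>
        continuous_fst.comp ((continuous_apply k).comp continuous_subtype_val)
    · exact continuous_pi fun k =>
        continuous_snd.comp ((continuous_apply k).comp continuous_subtype_val)
  continuous_invFun := by
    refine Continuous.subtype_mk (continuous_pi fun k => Continuous.prodMk ?_ ?_) _
    · exact (continuous_apply k).comp (continuous_subtype_val.comp continuous_fst)
    · exact (continuous_apply k).comp (continuous_subtype_val.comp continuous_snd)

end ScChain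

/-! ### sc-Fréchet spaces -/

/-- An sc-structure on a topological vector space `E`: an sc-chain together with a linear
homeomorphism `φ : E_∞ ≃ E`. -/
structure ScStructure (𝕜 : Type*) [RCLike 𝕜] (E : Type u) [AddCommGroup E] [Module 𝕜 E]
    [TopologicalSpace E] where
  chain : ScChain.{u} 𝕜
  φ : chain.infty ≃L[𝕜] E

namespace ScStructure

variable {𝕜 : Type*} [RCLike 𝕜] {E : Type u} [AddCommGroup E] [Module 𝕜 E] [TopologicalSpace E]

/-- The transition map from one sc-structure to another. -/
def trans (S T : ScStructure 𝕜 E) : S.chain.infty →L[𝕜] T.chain.infty :=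
  (S.φ.trans T.φ.symm : S.chain.infty ≃L[𝕜] T.chain.infty)

/-- Two sc-structures are equivalent if the transition map is an equivalence of sc-chains: a weak
embedding whose inverse is a weak embedding. -/
def Equivalent (S T : ScStructure 𝕜 E) : Prop :=
  S.chain.IsWeakEmbedding T.chain (S.trans T) ∧ T.chain.IsWeakEmbedding S.chain (T.trans S)

/-- Two sc-structures are tamely equivalent if the transition map is an equivalence that is tame
and has a tame inverse. -/
def TameEquivalent (S T : ScStructure 𝕜 E) : Prop :=
  S.Equivalent T ∧
    S.chain.IsTameMorphism T.chain (S.trans T) ∧ T.chain.IsTameMorphism S.chain (T.trans S)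

/-- The direct sum of two sc-structures. -/
def prod {E' : Type v} [AddCommGroup E'] [Module 𝕜 E'] [TopologicalSpace E']
    (S : ScStructure 𝕜 E) (T : ScStructure 𝕜 E') : ScStructure 𝕜 (E × E') where
  chain := S.chain.prod T.chain
  φ := (S.chain.prodInfty T.chain).trans (S.φ.prodCongr T.φ)

end ScStructure

/-- An sc-Fréchet space: a topological vector space with an equivalence class of sc-structures,
given by a member `str` of it. The equivalence class of `str` makes `E` an sc-Fréchet space, and
the (finer) tame equivalence class of `str` makes it a pre-tame sc-Fréchet space. -/
class ScFrechet (𝕜 : Type*) [RCLike 𝕜] (E : Type u) [AddCommGroup E] [Module 𝕜 E]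
    [TopologicalSpace E] where
  str : ScStructure 𝕜 E

/-- The direct sum of two (pre-tame) sc-Fréchet spaces. -/
instance ScFrechet.instProd {𝕜 : Type*} [RCLike 𝕜]
    {E : Type u} [AddCommGroup E] [Module 𝕜 E] [TopologicalSpace E] [ScFrechet 𝕜 E]
    {E' : Type v} [AddCommGroup E'] [Module 𝕜 E'] [TopologicalSpace E'] [ScFrechet 𝕜 E'] :
    ScFrechet 𝕜 (E × E') where
  str := (ScFrechet.str (𝕜 := 𝕜) (E := E)).prod (ScFrechet.str (𝕜 := 𝕜) (E := E'))

namespace ScStructure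

variable {𝕜 : Type*} [RCLike 𝕜] {E : Type u} [AddCommGroup E] [Module 𝕜 E] [TopologicalSpace E]
  [ScFrechet 𝕜 E]

/-- `S` belongs to the equivalence class of sc-structures of the sc-Fréchet space `E`. -/
def Compatible (S : ScStructure 𝕜 E) : Prop := (ScFrechet.str (𝕜 := 𝕜) (E := E)).Equivalent S

/-- `S` belongs to the tame equivalence class of the pre-tame sc-Fréchet space `E`. -/
def TamelyCompatible (S : ScStructure 𝕜 E) : Prop :=
  (ScFrechet.str (𝕜 := 𝕜) (E := E)).TameEquivalent S

end ScStructure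

/-! ### Envelopes -/

namespace ScChain

variable {𝕜 : Type*} [RCLike 𝕜]

/-- `(U_k)` is an envelope of the subset `A` of `E_∞`: the `U_k ⊆ E_k` are open with
`ι_k (U_{k+1}) ⊆ U_k`, and `A` is the intersection of the preimages of the `U_k`. -/
def IsSetEnvelope (C : ScChain.{u} 𝕜) (U : ∀ k, Set (C.level k)) (A : Set C.infty) : Prop :=
  (∀ k, IsOpen (U k)) ∧ (∀ k, MapsTo (C.ι k) (U (k + 1)) (U k)) ∧
    ∀ x : C.infty, x ∈ A ↔ ∀ k, x.1 k ∈ U k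

/-- `(g_k : U_k → E'_k)` is an envelope of the map `f : A → E'_∞`. -/
def IsMapEnvelope (C : ScChain.{u} 𝕜) (C' : ScChain.{v} 𝕜) (U : ∀ k, Set (C.level k))
    (A : Set C.infty) (g : ∀ k, C.level k → C'.level k) (f : C.infty → C'.infty) : Prop :=
  C.IsSetEnvelope U A ∧ (∀ k, ContinuousOn (g k) (U k)) ∧
    (∀ k, ∀ x ∈ U (k + 1), g k (C.ι k x) = C'.ι k (g (k + 1) x)) ∧
    ∀ x ∈ A, ∀ k, g k (x.1 k) = (f x).1 k

/-- For a strictly monotone rescaling `k`, the maps `g_j : U_{k_j} × E¹_j → E²_{k_j}` form an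
envelope of the map `κ : A × E¹_∞ → E²_∞` between the rescaled chain `E^k`, plus `E¹`, and the
rescaled chain `(E²)^k`. For `k = id` this is an envelope in product form of `κ`. -/
def IsFamilyEnvelope (C : ScChain.{u} 𝕜) (C₁ : ScChain.{v} 𝕜) (C₂ : ScChain.{w} 𝕜)
    (U : ∀ k, Set (C.level k)) (A : Set C.infty) (k : ℕ → ℕ) (hk : StrictMono k)
    (g : ∀ j, C.level (k j) → C₁.level j → C₂.level (k j))
    (κ : C.infty → C₁.infty → C₂.infty) : Prop :=
  C.IsSetEnvelope U A ∧
    (∀ j, ContinuousOn (fun p : C.level (k j) × C₁.level j => g j p.1 p.2) (U (k j) ×ˢ univ)) ∧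
    (∀ j, ∀ x ∈ U (k (j + 1)), ∀ u : C₁.level (j + 1),
      g j (C.incl (hk.monotone j.le_succ) x) (C₁.ι j u) =
        C₂.incl (hk.monotone j.le_succ) (g (j + 1) x u)) ∧
    ∀ x ∈ A, ∀ (u : C₁.infty) (j : ℕ), g j (x.1 (k j)) (u.1 j) = (κ x u).1 (k j)

/-- The tame estimates for an envelope of a family of linear maps: on bounded subsets of the fibre
(bounded with respect to the norm of the level zero), the map `g_j` grows at most linearly in the
norms of `E_{k_j}` and `E¹_j`. -/
def FamilyTameEstimate (C : ScChain.{u} 𝕜) (C₁ : ScChain.{v} 𝕜) (C₂ : ScChain.{w} 𝕜)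
    (U : ∀ k, Set (C.level k)) (k : ℕ → ℕ)
    (g : ∀ j, C.level (k j) → C₁.level j → C₂.level (k j)) : Prop :=
  ∀ (j : ℕ) (R : ℝ), ∃ c : ℝ, ∀ x ∈ U (k j), ∀ u : C₁.level j,
    ‖C₁.incl (Nat.zero_le j) u‖ ≤ R → ‖g j x u‖ ≤ c * (1 + ‖x‖ + ‖u‖)

/-- The product envelope `(κ_k : U_k × E¹_k → E²_k)` of `κ` is strongly smoothing: for every
strictly monotone `k` there is an envelope `g_j : U_{k_j} × E¹_j → E²_{k_j}` of `κ` lifting it. -/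
def IsStronglySmoothingEnvelope (C : ScChain.{u} 𝕜) (C₁ : ScChain.{v} 𝕜) (C₂ : ScChain.{w} 𝕜)
    (U : ∀ k, Set (C.level k)) (A : Set C.infty)
    (K : ∀ k, C.level k → C₁.level k → C₂.level k) (κ : C.infty → C₁.infty → C₂.infty) : Prop :=
  C.IsFamilyEnvelope C₁ C₂ U A id strictMono_id K κ ∧
    ∀ (k : ℕ → ℕ) (hk : StrictMono k),
      ∃ g : ∀ j, C.level (k j) → C₁.level j → C₂.level (k j),
        C.IsFamilyEnvelope C₁ C₂ U A k hk g κ ∧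
        ∀ j, ∀ x ∈ U (k j), ∀ u : C₁.level j,
          K j (C.incl (hk.le_apply) x) u = C₂.incl (hk.le_apply) (g j x u)

/-- The tame version of a strongly smoothing envelope: only tame rescalings are considered and
all the envelopes are tame. -/
def IsTameStronglySmoothingEnvelope (C : ScChain.{u} 𝕜) (C₁ : ScChain.{v} 𝕜)
    (C₂ : ScChain.{w} 𝕜) (U : ∀ k, Set (C.level k)) (A : Set C.infty)
    (K : ∀ k, C.level k → C₁.level k → C₂.level k) (κ : C.infty → C₁.infty → C₂.infty) : Prop :=
  C.IsFamilyEnvelope C₁ C₂ U A id strictMono_id K κ ∧ C.FamilyTameEstimate C₁ C₂ U id K ∧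
    ∀ (k : ℕ → ℕ) (hk : IsTameSeq k),
      ∃ g : ∀ j, C.level (k j) → C₁.level j → C₂.level (k j),
        C.IsFamilyEnvelope C₁ C₂ U A k hk.1 g κ ∧ C.FamilyTameEstimate C₁ C₂ U k g ∧
        ∀ j, ∀ x ∈ U (k j), ∀ u : C₁.level j,
          K j (C.incl (hk.1.le_apply) x) u = C₂.incl (hk.1.le_apply) (g j x u)

end ScChain

/-! ### Maps between sc-Fréchet spaces

A map defined on an open subset `U` is represented by a function on the whole space, of which only
the values on `U` matter. -/

section Maps

variable (𝕜 : Type*) [RCLike 𝕜]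
variable {E : Type u} [AddCommGroup E] [Module 𝕜 E] [TopologicalSpace E] [ScFrechet 𝕜 E]
variable {E' : Type v} [AddCommGroup E'] [Module 𝕜 E'] [TopologicalSpace E'] [ScFrechet 𝕜 E']

/-- `f` restricted to `A` has an envelope with respect to compatible sc-structures. -/
def HasEnvelope (f : E → E') (A : Set E) : Prop :=
  ∃ (S : ScStructure 𝕜 E) (S' : ScStructure 𝕜 E'), S.Compatible ∧ S'.Compatible ∧
    ∃ U g, S.chain.IsMapEnvelope S'.chain U (S.φ ⁻¹' A) g (fun x => S'.φ.symm (f (S.φ x)))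

/-- `f` restricted to `A` has a tame envelope: an envelope with respect to tamely compatible
sc-structures such that every `g_k : U_k → E'_k` satisfies a tame estimate. -/
def HasTameEnvelope (f : E → E') (A : Set E) : Prop :=
  ∃ (S : ScStructure 𝕜 E) (S' : ScStructure 𝕜 E'), S.TamelyCompatible ∧ S'.TamelyCompatible ∧
    ∃ U g, S.chain.IsMapEnvelope S'.chain U (S.φ ⁻¹' A) g (fun x => S'.φ.symm (f (S.φ x))) ∧
      ∀ k, ∃ c : ℝ, ∀ x ∈ U k, ‖g k x‖ ≤ c * (1 + ‖x‖)

/-- `f` is of class sc⁰ on `U`: locally it has an envelope. -/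
def Sc0On (f : E → E') (U : Set E) : Prop :=
  ∀ x ∈ U, ∃ V, IsOpen V ∧ x ∈ V ∧ V ⊆ U ∧ HasEnvelope 𝕜 f V

/-- `f` is of class sc⁰ and tame on `U`: locally it has a tame envelope. -/
def TameOn (f : E → E') (U : Set E) : Prop :=
  ∀ x ∈ U, ∃ V, IsOpen V ∧ x ∈ V ∧ V ⊆ U ∧ HasTameEnvelope 𝕜 f V

open Classical in
/-- The remainder term `r(u,t) = (f(x + tu) - f(x)) / t - L u`, with `r(u,0) = 0`. -/
noncomputable def weakRemainder (f : E → E') (L : E →L[𝕜] E') (x : E) (p : E × ℝ) : E' :=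
  if p.2 = 0 then 0 else ((p.2 : 𝕜)⁻¹ • (f (x + (p.2 : 𝕜) • p.1) - f x)) - L p.1

/-- `L` is a weak Fréchet derivative of `f` at `x`: the remainder term is continuous on
`V × [0,1]` for some neighbourhood `V` of `0`. (As `V` may be shrunk and the spaces are locally
convex, `V` may be taken convex, balanced, and with `x + V` inside a given neighbourhood
of `x`.) -/
def HasWeakFDerivAt (f : E → E') (L : E →L[𝕜] E') (x : E) : Prop :=
  ∃ V ∈ 𝓝 (0 : E), ContinuousOn (weakRemainder 𝕜 f L x) (V ×ˢ Icc (0 : ℝ) 1)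

open Classical in
/-- The weak Fréchet derivative `Df(x)` (which is unique); zero if there is none. -/
noncomputable def weakDeriv (f : E → E') (x : E) : E →L[𝕜] E' :=
  if h : ∃ L : E →L[𝕜] E', HasWeakFDerivAt 𝕜 f L x then h.choose else 0

/-- `f` is of class sc¹ on the open set `U`: it is continuous and weakly Fréchet differentiable at
every point of `U`, and both `f` on `U` and `Df` on `U × E` are of class sc⁰. -/
def Sc1On (f : E → E') (U : Set E) : Prop :=
  ContinuousOn f U ∧ (∀ x ∈ U, ∃ L : E →L[𝕜] E', HasWeakFDerivAt 𝕜 f L x) ∧ Sc0On 𝕜 f U ∧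
    Sc0On 𝕜 (fun p : E × E => weakDeriv 𝕜 f p.1 p.2) (U ×ˢ univ)

/-- The differential of `f` as a family of linear maps. -/
noncomputable def diffFamily (f : E → E') (x : E) : E →ₗ[𝕜] E' := (weakDeriv 𝕜 f x).toLinearMap

end Maps

/-! ### Families of morphisms -/

section Families

variable {𝕜 : Type*} [RCLike 𝕜]
variable {E : Type u} [AddCommGroup E] [Module 𝕜 E] [TopologicalSpace E] [ScFrechet 𝕜 E]
variable {E₁ : Type v} [AddCommGroup E₁] [Module 𝕜 E₁] [TopologicalSpace E₁] [ScFrechet 𝕜 E₁]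
variable {E₂ : Type w} [AddCommGroup E₂] [Module 𝕜 E₂] [TopologicalSpace E₂] [ScFrechet 𝕜 E₂]

/-- `φ : U × E₁ → E₂` is a family of morphisms: of class sc⁰ and linear in the second variable. -/
def IsFamily (φ : E → E₁ →ₗ[𝕜] E₂) (U : Set E) : Prop :=
  Sc0On 𝕜 (fun p : E × E₁ => φ p.1 p.2) (U ×ˢ univ)

/-- `φ : U × E₁ → E₂` is a tame family of morphisms. -/
def IsTameFamily (φ : E → E₁ →ₗ[𝕜] E₂) (U : Set E) : Prop :=
  TameOn 𝕜 (fun p : E × E₁ => φ p.1 p.2) (U ×ˢ univ)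

/-- The family of morphisms `κ : U × E₁ → E₂` is strongly smoothing: locally in `U` it has a
strongly smoothing envelope. -/
def IsStronglySmoothing (κ : E → E₁ →ₗ[𝕜] E₂) (U : Set E) : Prop :=
  IsFamily κ U ∧ ∀ x ∈ U, ∃ V, IsOpen V ∧ x ∈ V ∧ V ⊆ U ∧
    ∃ (S : ScStructure 𝕜 E) (S₁ : ScStructure 𝕜 E₁) (S₂ : ScStructure 𝕜 E₂),
      S.Compatible ∧ S₁.Compatible ∧ S₂.Compatible ∧
      ∃ W K, S.chain.IsStronglySmoothingEnvelope S₁.chain S₂.chain W (S.φ ⁻¹' V) K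
        (fun y u => S₂.φ.symm (κ (S.φ y) (S₁.φ u)))

/-- The tame version of a strongly smoothing family. -/
def IsTameStronglySmoothing (κ : E → E₁ →ₗ[𝕜] E₂) (U : Set E) : Prop :=
  IsTameFamily κ U ∧ ∀ x ∈ U, ∃ V, IsOpen V ∧ x ∈ V ∧ V ⊆ U ∧
    ∃ (S : ScStructure 𝕜 E) (S₁ : ScStructure 𝕜 E₁) (S₂ : ScStructure 𝕜 E₂),
      S.TamelyCompatible ∧ S₁.TamelyCompatible ∧ S₂.TamelyCompatible ∧
      ∃ W K, S.chain.IsTameStronglySmoothingEnvelope S₁.chain S₂.chain W (S.φ ⁻¹' V) K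
        (fun y u => S₂.φ.symm (κ (S.φ y) (S₁.φ u)))

/-- A Fredholm family of morphisms: locally invertible modulo strongly smoothing families. -/
def IsFredholmFamily (φ : E → E₁ →ₗ[𝕜] E₂) (U : Set E) : Prop :=
  IsFamily φ U ∧ ∀ x₀ ∈ U, ∃ V, IsOpen V ∧ x₀ ∈ V ∧ V ⊆ U ∧
    ∃ (ψ : E → E₂ →ₗ[𝕜] E₁) (κ : E → E₁ →ₗ[𝕜] E₁) (κ' : E → E₂ →ₗ[𝕜] E₂),
      IsFamily ψ V ∧ IsStronglySmoothing κ V ∧ IsStronglySmoothing κ' V ∧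
      (∀ x ∈ V, ∀ u, ψ x (φ x u) = u + κ x u) ∧ ∀ x ∈ V, ∀ u, φ x (ψ x u) = u + κ' x u

/-- A tame Fredholm family of morphisms: a tame family, locally invertible by tame families modulo
tame strongly smoothing families. -/
def IsTameFredholmFamily (φ : E → E₁ →ₗ[𝕜] E₂) (U : Set E) : Prop :=
  IsTameFamily φ U ∧ ∀ x₀ ∈ U, ∃ V, IsOpen V ∧ x₀ ∈ V ∧ V ⊆ U ∧
    ∃ (ψ : E → E₂ →ₗ[𝕜] E₁) (κ : E → E₁ →ₗ[𝕜] E₁) (κ' : E → E₂ →ₗ[𝕜] E₂),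
      IsTameFamily ψ V ∧ IsTameStronglySmoothing κ V ∧ IsTameStronglySmoothing κ' V ∧
      (∀ x ∈ V, ∀ u, ψ x (φ x u) = u + κ x u) ∧ ∀ x ∈ V, ∀ u, φ x (ψ x u) = u + κ' x u

end Families

section Index

variable {𝕜 : Type*} [Field 𝕜] {F : Type*} [AddCommGroup F] [Module 𝕜 F]
  {G : Type*} [AddCommGroup G] [Module 𝕜 G]

/-- The kernel and the cokernel of `T` are finite dimensional. -/
def FiniteKerCoker (T : F →ₗ[𝕜] G) : Prop :=
  FiniteDimensional 𝕜 (LinearMap.ker T) ∧ FiniteDimensional 𝕜 (G ⧸ LinearMap.range T)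

/-- The dimension of the kernel. -/
noncomputable def dimKer (T : F →ₗ[𝕜] G) : ℕ := Module.finrank 𝕜 (LinearMap.ker T)

/-- The dimension of the cokernel. -/
noncomputable def corank (T : F →ₗ[𝕜] G) : ℕ := Module.finrank 𝕜 (G ⧸ LinearMap.range T)

/-- The Fredholm index. -/
noncomputable def fredholmIndex (T : F →ₗ[𝕜] G) : ℤ := (dimKer T : ℤ) - (corank T : ℤ)

end Index

section FredholmMaps

variable (𝕜 : Type*) [RCLike 𝕜]
variable {E : Type u} [AddCommGroup E] [Module 𝕜 E] [TopologicalSpace E] [ScFrechet 𝕜 E]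
variable {E' : Type v} [AddCommGroup E'] [Module 𝕜 E'] [TopologicalSpace E'] [ScFrechet 𝕜 E']

/-- The sc¹ map `f : U → E'` is Fredholm: its differential is a Fredholm family. -/
def IsFredholmMap (f : E → E') (U : Set E) : Prop :=
  Sc1On 𝕜 f U ∧ IsFredholmFamily (diffFamily 𝕜 f) U

/-- The sc¹ map `f : U → E'` is tame Fredholm: it is tame and its differential is a tame Fredholm
family. -/
def IsTameFredholmMap (f : E → E') (U : Set E) : Prop :=
  Sc1On 𝕜 f U ∧ TameOn 𝕜 f U ∧ IsTameFredholmFamily (diffFamily 𝕜 f) U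

end FredholmMaps

/-! ### Index of linear maps with finite dimensional kernel and cokernel -/

section IndexAlgebra

variable {𝕜 : Type*} [Field 𝕜] {F : Type*} [AddCommGroup F] [Module 𝕜 F]
  {G : Type*} [AddCommGroup G] [Module 𝕜 G] {H : Type*} [AddCommGroup H] [Module 𝕜 H]

/-! The definitions quantify over compatible structures and over whole sequences of maps on levels.
Everything is first reduced to a condition on germs in the distinguished structure. `Sc0At` says
that on a ball of one fixed level the `j`-th component of a map factors through a continuous map on
an open subset of some level `n`. Tameness adds `n ≤ j + c` and linear growth. The proposition `t`
switches these extra demands on, so one argument with `t = False` or `t = True` treats both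
theories. Strong smoothing becomes `SmoothingAt`: the same condition with all levels of the fibre
replaced by a single one. Since `E` is dense in every level, identities and estimates known on `E`
pass to the extensions, and this turns germs back into envelopes.

Pointwise Fredholm theory: a smoothing `κ x` factors through a Banach level as `B ∘ π_l`. Swapping
the factors identifies kernel and cokernel of `1 + B ∘ π_l` with those of `1 + π_l ∘ B` on level
`l`. The map `π_l ∘ B` passes through level `l + 1`, so it is compact, and Riesz theory gives finite
dimensions and index zero (`ScStructure.finiteKerCoker_id_add`). Hence a family `φ` with parametrix
`ψ` has finite dimensional kernels and cokernels, and `ind φ + ind ψ = 0`.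

Semicontinuity: `φ x` need not depend on `x` continuously in any operator norm, so stability is
obtained by compactness. Choose `ℓ` injective on `ker (φ x₀)` and `J` mapping isomorphically onto a
complement of the range. The map `(u, a) ↦ φ x u + J a` on `ker ℓ × L` is injective at `x₀`. Suppose
that this fails for a sequence `x i → x₀`. Normalised null vectors subconverge in a low level of the
fibre, and then in all levels because `u = -ψ (J a) - κ u`, where `κ` sees only that low level. The
limit contradicts injectivity at `x₀` (`eventually_injective`). So near `x₀` the kernel dimension
and the index of `φ` do not exceed their values at `x₀`. The same bound for the index of `ψ`, which
is `-ind φ`, makes the index locally constant, and the corank is then controlled by the kernel.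

Compositions: the weak derivative satisfies a chain rule, smoothing families are stable under
composition with families on both sides, and parametrices compose (`IsFredholmFamilyOf.comp`). The
index is additive by linear algebra. -/

theorem finrank_map_add_finrank_inf_ker (f : F →ₗ[𝕜] G) (p : Submodule 𝕜 F)
    [FiniteDimensional 𝕜 p] :
    Module.finrank 𝕜 (p.map f) + Module.finrank 𝕜 (p ⊓ LinearMap.ker f : Submodule 𝕜 F) =
      Module.finrank 𝕜 p := by
  have h := LinearMap.finrank_range_add_finrank_ker (f.domRestrict p)
  have h1 : LinearMap.range (f.domRestrict p) = p.map f := LinearMap.range_domRestrict p f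
  have h2 : LinearMap.ker (f.domRestrict p) = (p ⊓ LinearMap.ker f).comap p.subtype := by
    ext x; simp
  rw [h1, h2] at h
  rw [← h, (Submodule.comapSubtypeEquivOfLe (inf_le_left : p ⊓ LinearMap.ker f ≤ p)).finrank_eq]

/-- `T` maps `ker (S ∘ T)` onto `range T ∩ ker S` with kernel `ker T`. `S` induces `Sb` from `coker
T` to `coker (S ∘ T)`, whose kernel is the image of `ker S` and whose cokernel is `coker S`.
Counting dimensions in these maps gives four linear relations, from which additivity follows. -/
theorem finiteKerCoker_comp_and_index {T : F →ₗ[𝕜] G} {S : G →ₗ[𝕜] H} (hT : FiniteKerCoker T)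
    (hS : FiniteKerCoker S) :
    FiniteKerCoker (S ∘ₗ T) ∧ fredholmIndex (S ∘ₗ T) = fredholmIndex T + fredholmIndex S := by
  obtain ⟨hT1, hT2⟩ := hT
  obtain ⟨hS1, hS2⟩ := hS
  set R := LinearMap.range T with hR
  set Q := LinearMap.range (S ∘ₗ T) with hQ
  have hmap : (LinearMap.ker (S ∘ₗ T)).map T = R ⊓ LinearMap.ker S := by
    rw [LinearMap.ker_comp, Submodule.map_comap_eq]
  have hinf : LinearMap.ker (S ∘ₗ T) ⊓ LinearMap.ker T = LinearMap.ker T :=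
    inf_eq_right.2 (LinearMap.ker_le_ker_comp T S)
  have hfk : FiniteDimensional 𝕜 (LinearMap.ker (S ∘ₗ T)) := by
    refine Module.Finite.iff_fg.2 (Submodule.fg_of_fg_map_of_fg_inf_ker T ?_ ?_)
    · rw [hmap]
      exact Module.Finite.iff_fg.1 (Submodule.finiteDimensional_of_le
        (inf_le_right : R ⊓ LinearMap.ker S ≤ LinearMap.ker S))
    · rw [hinf]
      exact Module.Finite.iff_fg.1 hT1
  have hle : R ≤ Q.comap S := by
    rintro _ ⟨x, rfl⟩
    exact ⟨x, rfl⟩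
  let Sb := R.mapQ Q S hle
  have hker : LinearMap.ker Sb = (LinearMap.ker S).map R.mkQ := by
    rw [Submodule.ker_mapQ, hQ, LinearMap.range_comp, Submodule.comap_map_eq, Submodule.map_sup]
    rw [hR, Submodule.mkQ_map_self, bot_sup_eq]
  have hrange : LinearMap.range Sb = (LinearMap.range S).map Q.mkQ := Submodule.range_mapQ _ _ _ _
  have hQS : Q ≤ LinearMap.range S := LinearMap.range_comp_le_range T S
  let e : ((H ⧸ Q) ⧸ LinearMap.range Sb) ≃ₗ[𝕜] H ⧸ LinearMap.range S :=
    (Submodule.quotEquivOfEq _ _ hrange).trans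
      (Submodule.quotientQuotientEquivQuotient Q (LinearMap.range S) hQS)
  have hfin : FiniteDimensional 𝕜 ((H ⧸ Q) ⧸ LinearMap.range Sb) :=
    Module.Finite.equiv e.symm
  have hfr : FiniteDimensional 𝕜 (LinearMap.range Sb) := inferInstance
  have hfc : FiniteDimensional 𝕜 (H ⧸ Q) := Module.Finite.of_submodule_quotient (LinearMap.range Sb)
  refine ⟨⟨hfk, hfc⟩, ?_⟩
  have h1 := finrank_map_add_finrank_inf_ker T (LinearMap.ker (S ∘ₗ T))
  rw [hmap, hinf] at h1
  have h2 := finrank_map_add_finrank_inf_ker R.mkQ (LinearMap.ker S)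
  rw [Submodule.ker_mkQ, inf_comm] at h2
  have h3 := LinearMap.finrank_range_add_finrank_ker Sb
  rw [hker] at h3
  have h4 := (LinearMap.range Sb).finrank_quotient_add_finrank
  rw [e.finrank_eq] at h4
  simp only [fredholmIndex, dimKer, corank]
  rw [← hR, ← hQ]
  omega

theorem FiniteKerCoker.of_comp {φ : F →ₗ[𝕜] G} {ψ ψ' : G →ₗ[𝕜] F} (h : FiniteKerCoker (ψ ∘ₗ φ))
    (h' : FiniteKerCoker (φ ∘ₗ ψ')) : FiniteKerCoker φ := by
  have := h.1
  have := h'.2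
  refine ⟨Submodule.finiteDimensional_of_le (LinearMap.ker_le_ker_comp φ ψ), ?_⟩
  exact Module.Finite.of_surjective
    (Submodule.factor (LinearMap.range_comp_le_range ψ' φ)) (Submodule.factor_surjective _)

/-- The kernels of `1 + AB` and `1 + BA` are isomorphic. -/
def kerOneAddCompEquiv (A : G →ₗ[𝕜] F) (B : F →ₗ[𝕜] G) :
    LinearMap.ker (LinearMap.id + A ∘ₗ B) ≃ₗ[𝕜] LinearMap.ker (LinearMap.id + B ∘ₗ A) where
  -- On the kernel `x = -A (B x)`, so `-A` inverts `B`.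
  toFun x := ⟨B x.1, by
    have h : x.1 + A (B x.1) = 0 := x.2
    simp [← map_add, h]⟩
  invFun y := ⟨-A y.1, by
    have h : y.1 + B (A y.1) = 0 := y.2
    have h2 := congrArg A h
    simp only [map_add, map_zero] at h2
    simp [← h2]⟩
  map_add' x y := by ext; simp
  map_smul' c x := by ext; simp
  left_inv x := by
    have h : x.1 + A (B x.1) = 0 := x.2
    ext
    simp [← eq_neg_of_add_eq_zero_left h]
  right_inv y := by
    have h : y.1 + B (A y.1) = 0 := y.2
    ext
    simp [← eq_neg_of_add_eq_zero_left h]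

/-- The cokernels of `1 + AB` and `1 + BA` are isomorphic. -/
noncomputable def cokerOneAddCompEquiv (A : G →ₗ[𝕜] F) (B : F →ₗ[𝕜] G) :
    (F ⧸ LinearMap.range (LinearMap.id + A ∘ₗ B)) ≃ₗ[𝕜]
      G ⧸ LinearMap.range (LinearMap.id + B ∘ₗ A) :=
  LinearEquiv.ofLinearMap
    (Submodule.mapQ _ _ B (by
      rintro _ ⟨x, rfl⟩
      exact ⟨B x, by simp⟩))
    (Submodule.mapQ _ _ (-A) (by
      rintro _ ⟨x, rfl⟩
      exact ⟨-A x, by simp [add_comm]⟩))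
    (by
      ext y
      simp only [LinearMap.coe_comp, Function.comp_apply, Submodule.mkQ_apply, Submodule.mapQ_apply,
        LinearMap.id_coe, id_eq]
      rw [Submodule.Quotient.eq]
      exact ⟨-y, by simp; abel⟩)
    (by
      ext y
      simp only [LinearMap.coe_comp, Function.comp_apply, Submodule.mkQ_apply, Submodule.mapQ_apply,
        LinearMap.id_coe, id_eq]
      rw [Submodule.Quotient.eq]
      exact ⟨-y, by simp; abel⟩)

theorem FiniteKerCoker.one_add_comp_comm {A : G →ₗ[𝕜] F} {B : F →ₗ[𝕜] G}
    (h : FiniteKerCoker (LinearMap.id + B ∘ₗ A)) : FiniteKerCoker (LinearMap.id + A ∘ₗ B) := by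
  have := h.1
  have := h.2
  exact ⟨Module.Finite.equiv (kerOneAddCompEquiv A B).symm,
    Module.Finite.equiv (cokerOneAddCompEquiv A B).symm⟩

theorem fredholmIndex_one_add_comp_comm (A : G →ₗ[𝕜] F) (B : F →ₗ[𝕜] G) :
    fredholmIndex (LinearMap.id + A ∘ₗ B) = fredholmIndex (LinearMap.id + B ∘ₗ A) := by
  rw [fredholmIndex, fredholmIndex, dimKer, dimKer, corank, corank,
    (kerOneAddCompEquiv A B).finrank_eq, (cokerOneAddCompEquiv A B).finrank_eq]

variable {N : Type*} [AddCommGroup N] [Module 𝕜 N] [FiniteDimensional 𝕜 N]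
  {L : Type*} [AddCommGroup L] [Module 𝕜 L]

/-- If `(x, a) ↦ T x + J a` is injective on `ker ℓ × L`, then the dimension of the kernel of `T`
and the index of `T` are bounded by the dimensions of `N` and `L`. -/
theorem dimKer_le_and_index_le {T : F →ₗ[𝕜] G} (hT : FiniteKerCoker T) (ℓ : F →ₗ[𝕜] N)
    (J : L →ₗ[𝕜] G) (h : ∀ x a, ℓ x = 0 → T x + J a = 0 → x = 0 ∧ a = 0) :
    dimKer T ≤ Module.finrank 𝕜 N ∧
      fredholmIndex T ≤ (Module.finrank 𝕜 N : ℤ) - Module.finrank 𝕜 L := by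
  constructor
  · refine LinearMap.finrank_le_finrank_of_injective (f := ℓ ∘ₗ (LinearMap.ker T).subtype) ?_
    rw [← LinearMap.ker_eq_bot, LinearMap.ker_eq_bot']
    intro x hx
    have := (h x.1 0 hx (by simp)).1
    exact Subtype.ext this
  -- Restrict `T` to `M = ker ℓ`. The restriction is injective and `L` embeds in its cokernel, so
  -- its index is at most `-dim L`. The inclusion of `M` has index at least `-dim N`, and additivity
  -- gives the bound for `T`.
  · set M := LinearMap.ker ℓ with hM
    let e : (F ⧸ LinearMap.range M.subtype) ≃ₗ[𝕜] LinearMap.range ℓ :=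
      (Submodule.quotEquivOfEq _ _ (Submodule.range_subtype M)).trans ℓ.quotKerEquivRange
    have hker0 : LinearMap.ker M.subtype = ⊥ := Submodule.ker_subtype M
    have hι : FiniteKerCoker M.subtype := by
      refine ⟨?_, Module.Finite.equiv e.symm⟩
      rw [hker0]
      infer_instance
    have hle : corank M.subtype ≤ Module.finrank 𝕜 N := by
      rw [corank, e.finrank_eq]
      exact Submodule.finrank_le _
    have hιker : dimKer M.subtype = 0 := by
      rw [dimKer, hker0]
      exact finrank_bot 𝕜 M
    obtain ⟨hc, hi⟩ := finiteKerCoker_comp_and_index hι hT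
    have hTk : dimKer (T ∘ₗ M.subtype) = 0 := by
      have hb : LinearMap.ker (T ∘ₗ M.subtype) = ⊥ := by
        rw [LinearMap.ker_eq_bot']
        intro x hx
        exact Subtype.ext (h x.1 0 x.2 (by simpa using hx)).1
      rw [dimKer, hb]
      exact finrank_bot 𝕜 M
    have hco : Module.finrank 𝕜 L ≤ corank (T ∘ₗ M.subtype) := by
      have := hc.2
      refine LinearMap.finrank_le_finrank_of_injective
        (f := (LinearMap.range (T ∘ₗ M.subtype)).mkQ ∘ₗ J) ?_
      rw [← LinearMap.ker_eq_bot, LinearMap.ker_eq_bot']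
      intro a ha
      rw [LinearMap.comp_apply, Submodule.mkQ_apply, Submodule.Quotient.mk_eq_zero] at ha
      obtain ⟨x, hx⟩ := ha
      refine (h (-x.1) a ?_ ?_).2
      · rw [map_neg, show ℓ x.1 = 0 from x.2, neg_zero]
      · rw [← hx]; simp
    simp only [fredholmIndex] at hi ⊢
    omega

end IndexAlgebra

/-! ### Riesz theory for compact perturbations of the identity -/

section Riesz

variable {𝕜 : Type*} [RCLike 𝕜] {X : Type*} [NormedAddCommGroup X] [NormedSpace 𝕜 X]
  [CompleteSpace X] {K : X →L[𝕜] X}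

/-- The Fredholm alternative at `-1`: an eigenvector would contradict injectivity, so `-1` lies in
the resolvent set. -/
theorem IsCompactOperator.bijective_one_add (hK : IsCompactOperator K)
    (h : Function.Injective (1 + K : X →L[𝕜] X)) : Function.Bijective (1 + K : X →L[𝕜] X) := by
  rcases hK.hasEigenvalue_or_mem_resolventSet (μ := (-1 : 𝕜)) (by simp) with h1 | h1
  · obtain ⟨x, hx⟩ := h1.exists_hasEigenvector
    refine absurd (h (a₁ := x) (a₂ := 0) ?_) hx.2
    have : K x = (-1 : 𝕜) • x := hx.apply_eq_smul
    simp [this]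
  · rw [spectrum.mem_resolventSet_iff, ← IsUnit.neg_iff,
      ContinuousLinearMap.isUnit_iff_bijective] at h1
    convert h1 using 2
    ext x
    simp [add_comm]

/-- On the kernel `K` is `-id`, so the identity of the kernel is a compact operator. -/
theorem IsCompactOperator.finiteDimensional_ker_one_add (hK : IsCompactOperator K) :
    FiniteDimensional 𝕜 (LinearMap.ker ((1 + K : X →L[𝕜] X) : X →ₗ[𝕜] X)) := by
  set N := LinearMap.ker ((1 + K : X →L[𝕜] X) : X →ₗ[𝕜] X)
  have hN : ∀ x ∈ N, K x = -x := fun x hx =>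
    eq_neg_of_add_eq_zero_right (show x + K x = 0 from hx)
  have h1 : IsCompactOperator ((K : X →ₗ[𝕜] X).restrict
      (show ∀ x ∈ N, K x ∈ N from fun x hx => by rw [hN x hx]; exact N.neg_mem hx)) :=
    IsCompactOperator.restrict' (f := (K : X →ₗ[𝕜] X)) hK _
  refine FiniteDimensional.of_isCompactOperator_id (𝕜 := 𝕜) ?_
  refine (congrArg IsCompactOperator (funext fun x => ?_)).mp h1.neg
  apply Subtype.ext
  simp [LinearMap.restrict_apply, hN x.1 x.2]

/-- The kernel has a closed complement, which `1 + K` maps bijectively onto `X`. The inverse gives a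
continuous right inverse `Q = 1 - K Q`. This is an injective compact perturbation of the identity,
hence bijective, so `1 + K` is its inverse. -/
theorem IsCompactOperator.injective_one_add_of_surjective (hK : IsCompactOperator K)
    (h : Function.Surjective (1 + K : X →L[𝕜] X)) : Function.Injective (1 + K : X →L[𝕜] X) := by
  have := hK.finiteDimensional_ker_one_add
  set S : X →L[𝕜] X := 1 + K with hS
  set N := LinearMap.ker (S : X →ₗ[𝕜] X) with hN
  obtain ⟨P, hP⟩ := Submodule.ClosedComplemented.of_finiteDimensional N
  set M := LinearMap.ker (P : X →ₗ[𝕜] N) with hM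
  have hMc : IsClosed (M : Set X) := P.isClosed_ker
  have : CompleteSpace M := hMc.completeSpace_coe
  let SM : M →L[𝕜] X := S.comp M.subtypeL
  have hSMi : LinearMap.ker (SM : M →ₗ[𝕜] X) = ⊥ := by
    rw [LinearMap.ker_eq_bot']
    intro x hx
    have hx1 : x.1 ∈ N := hx
    have h1 : P x.1 = 0 := x.2
    rw [hP ⟨x.1, hx1⟩] at h1
    exact Subtype.ext (congrArg (Subtype.val : N → X) h1)
  have hSMs : LinearMap.range (SM : M →ₗ[𝕜] X) = ⊤ := by
    rw [LinearMap.range_eq_top]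
    intro y
    obtain ⟨x, hx⟩ := h y
    have h0 : S (P x : X) = 0 := (P x).2
    refine ⟨⟨x - P x, ?_⟩, ?_⟩
    · rw [hM, LinearMap.mem_ker]
      simp [hP]
    · simpa [SM, h0] using hx
  let e := ContinuousLinearEquiv.ofBijective SM hSMi hSMs
  let Q : X →L[𝕜] X := M.subtypeL.comp (e.symm : X →L[𝕜] M)
  have hSQ : ∀ y, S (Q y) = y := fun y => e.apply_symm_apply y
  have hQ : Q = 1 + -(K.comp Q) := by
    ext y
    have := hSQ y
    rw [hS] at this
    simp only [add_apply, one_apply_eq_self] at this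
    simp only [add_apply, one_apply_eq_self,
      neg_apply, ContinuousLinearMap.comp_apply]
    exact eq_add_neg_of_add_eq this
  have hQi : Function.Injective Q := fun a b hab => by rw [← hSQ a, hab, hSQ]
  have hQc : IsCompactOperator (-(K.comp Q) : X →L[𝕜] X) := (hK.comp_clm Q).neg
  have hQb : Function.Bijective Q := by
    rw [hQ] at hQi ⊢
    exact hQc.bijective_one_add hQi
  intro a b hab
  obtain ⟨a, rfl⟩ := hQb.2 a
  obtain ⟨b, rfl⟩ := hQb.2 b
  rw [hSQ, hSQ] at hab
  rw [hab]

/-- Let `P` project onto the kernel `N`, and perturb `1 + K` by `J ∘ P` with `J : N → X`. If the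
perturbed operator is bijective, `J` induces an isomorphism from `N` to the cokernel, which is the
whole claim. Such a `J` is found by comparing ranks, without knowing beforehand that the range is
closed or of finite codimension. -/
theorem IsCompactOperator.finiteKerCoker_one_add (hK : IsCompactOperator K) :
    FiniteKerCoker (LinearMap.id + (K : X →ₗ[𝕜] X)) ∧
      fredholmIndex (LinearMap.id + (K : X →ₗ[𝕜] X)) = 0 := by
  have hfin := hK.finiteDimensional_ker_one_add
  change FiniteKerCoker ((1 + K : X →L[𝕜] X) : X →ₗ[𝕜] X) ∧
    fredholmIndex ((1 + K : X →L[𝕜] X) : X →ₗ[𝕜] X) = 0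
  set T : X →L[𝕜] X := 1 + K with hT
  set N := LinearMap.ker (T : X →ₗ[𝕜] X) with hN
  set R := LinearMap.range (T : X →ₗ[𝕜] X) with hR
  have : ProperSpace N := FiniteDimensional.proper 𝕜 N
  have hTN : ∀ a : N, T a.1 = 0 := fun a => a.2
  obtain ⟨P, hP⟩ := Submodule.ClosedComplemented.of_finiteDimensional N
  have hpert : ∀ J : N →L[𝕜] X, IsCompactOperator (K + J.comp P : X →L[𝕜] X) := fun J =>
    hK.add ((isCompactOperator_of_locallyCompactSpace_rng J).comp_clm P)
  have hsum : ∀ (J : N →L[𝕜] X) x, (1 + (K + J.comp P) : X →L[𝕜] X) x = T x + J (P x) := by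
    intro J x
    simp [hT, add_assoc]
  -- The `N`-component of `x` can be replaced by any `a` without changing `T x`.
  have hshift : ∀ x (a : N), T (x - P x + a) = T x ∧ P (x - P x + a) = a := by
    intro x a
    simp [hTN, hP]
  have key : ∀ J : N →L[𝕜] X, Function.Bijective (1 + (K + J.comp P) : X →L[𝕜] X) →
      Function.Bijective (R.mkQ ∘ₗ (J : N →ₗ[𝕜] X)) := by
    intro J hJ
    constructor
    · rw [← LinearMap.ker_eq_bot, LinearMap.ker_eq_bot']
      intro a ha
      rw [LinearMap.comp_apply, Submodule.mkQ_apply, Submodule.Quotient.mk_eq_zero] at ha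
      obtain ⟨x, hx⟩ := ha
      have h0 : x - P x + (-a : N) = 0 := by
        apply hJ.1
        rw [hsum, (hshift x (-a)).1, (hshift x (-a)).2, map_zero, map_neg]
        exact add_neg_eq_zero.2 hx
      have h1 := (hshift x (-a)).2
      rw [h0, map_zero] at h1
      exact neg_eq_zero.1 h1.symm
    · intro y
      obtain ⟨y, rfl⟩ := R.mkQ_surjective y
      obtain ⟨x, hx⟩ := hJ.2 y
      refine ⟨P x, ?_⟩
      rw [hsum] at hx
      rw [LinearMap.comp_apply, Submodule.mkQ_apply, Submodule.mkQ_apply, Submodule.Quotient.eq]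
      exact ⟨-x, by simp [← hx]⟩
  obtain ⟨J, hJ⟩ : ∃ J : N →L[𝕜] X, Function.Bijective (R.mkQ ∘ₗ (J : N →ₗ[𝕜] X)) := by
    obtain ⟨s, hs⟩ := R.mkQ.exists_rightInverse_of_surjective R.range_mkQ
    -- If `N` embeds in the cokernel, `J` makes the perturbed operator injective. If the cokernel
    -- embeds in `N`, a left inverse of the embedding makes it surjective. Either property implies
    -- bijectivity for a compact perturbation of the identity.
    rcases le_total (Module.rank 𝕜 N) (Module.rank 𝕜 (X ⧸ R)) with hle | hle
    · obtain ⟨i, hi⟩ := rank_le_iff_exists_linearMap.1 hle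
      refine ⟨(s ∘ₗ i).toContinuousLinearMap, key _ ((hpert _).bijective_one_add ?_)⟩
      rw [injective_iff_map_eq_zero]
      intro x hx
      rw [hsum] at hx
      have h1 : i (P x) = 0 := by
        have h2 := congrArg R.mkQ hx
        have h3 : R.mkQ (T x) = 0 := (Submodule.Quotient.mk_eq_zero R).2 ⟨x, rfl⟩
        rw [map_add, h3, zero_add, map_zero] at h2
        exact (LinearMap.congr_fun hs (i (P x))).symm.trans h2
      have h2 : P x = 0 := hi (h1.trans (map_zero i).symm)
      rw [h2, map_zero, add_zero] at hx
      rw [hP ⟨x, hx⟩] at h2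
      exact congrArg Subtype.val h2
    · obtain ⟨i, hi⟩ := rank_le_iff_exists_linearMap.1 hle
      obtain ⟨q, hq⟩ := i.exists_leftInverse_of_injective (LinearMap.ker_eq_bot.2 hi)
      have hsurj : Function.Surjective
          (1 + (K + (s ∘ₗ q).toContinuousLinearMap.comp P) : X →L[𝕜] X) := by
        intro y
        have h1 : y - s (q (i (R.mkQ y))) ∈ R := by
          rw [show q (i (R.mkQ y)) = R.mkQ y from LinearMap.congr_fun hq _]
          exact (Submodule.Quotient.eq R).1 (LinearMap.congr_fun hs (R.mkQ y)).symm
        obtain ⟨x, hx⟩ := h1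
        refine ⟨x - P x + i (R.mkQ y), ?_⟩
        rw [hsum, (hshift x _).1, (hshift x _).2]
        rw [show T x = _ from hx]
        simp
      exact ⟨_, key _ ⟨(hpert _).injective_one_add_of_surjective hsurj, hsurj⟩⟩
  let e := LinearEquiv.ofBijective _ hJ
  refine ⟨⟨hfin, Module.Finite.equiv e⟩, ?_⟩
  rw [fredholmIndex, dimKer, corank, ← e.finrank_eq, sub_self]

end Riesz

/-! ### Towers of normed spaces -/

/-- A tower of normed spaces under a vector space `X`: normed spaces `level n` with compatible maps
`level n → level m` for `m ≤ n` of norm at most one and linear maps `X → level n` with dense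
range. -/
structure Tower (𝕜 : Type*) [RCLike 𝕜] (X : Type*) [AddCommGroup X] [Module 𝕜 X] where
  level : ℕ → Type*
  [normed : ∀ k, NormedAddCommGroup (level k)]
  [space : ∀ k, NormedSpace 𝕜 (level k)]
  incl : ∀ {m n : ℕ}, m ≤ n → level n →L[𝕜] level m
  incl_norm_le : ∀ {m n : ℕ} (h : m ≤ n), ‖incl h‖ ≤ 1
  π : ∀ n, X →ₗ[𝕜] level n
  incl_π : ∀ {m n : ℕ} (h : m ≤ n) x, incl h (π n x) = π m x
  denseRange_π : ∀ n, DenseRange (π n)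

attribute [instance] Tower.normed Tower.space

namespace Tower

variable {𝕜 : Type*} [RCLike 𝕜] {X : Type*} [AddCommGroup X] [Module 𝕜 X]
  {Y : Type*} [AddCommGroup Y] [Module 𝕜 Y] {Z : Type*} [AddCommGroup Z] [Module 𝕜 Z]

theorem norm_π_mono (T : Tower 𝕜 X) {m n : ℕ} (h : m ≤ n) (x : X) : ‖T.π m x‖ ≤ ‖T.π n x‖ := by
  rw [← T.incl_π h]
  simpa using (T.incl h).le_of_opNorm_le (T.incl_norm_le h) (T.π n x)

/-- The levelwise direct sum of two towers. -/
def prod (T : Tower 𝕜 X) (T' : Tower 𝕜 Y) : Tower 𝕜 (X × Y) where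
  level k := T.level k × T'.level k
  incl h := (T.incl h).prodMap (T'.incl h)
  incl_norm_le h := by
    refine ContinuousLinearMap.opNorm_le_bound _ zero_le_one fun x => ?_
    have h1 := (T.incl h).le_of_opNorm_le (T.incl_norm_le h) x.1
    have h2 := (T'.incl h).le_of_opNorm_le (T'.incl_norm_le h) x.2
    rw [one_mul] at h1 h2 ⊢
    exact max_le_max h1 h2
  π n := (T.π n).prodMap (T'.π n)
  incl_π h x := Prod.ext (T.incl_π h x.1) (T'.incl_π h x.2)
  denseRange_π n := (T.denseRange_π n).prodMap (T'.denseRange_π n)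

/-- The constant tower at level `m` of a tower. -/
def const (T : Tower 𝕜 X) (m : ℕ) : Tower 𝕜 X where
  level _ := T.level m
  incl _ := ContinuousLinearMap.id 𝕜 _
  incl_norm_le _ := ContinuousLinearMap.norm_id_le
  π _ := T.π m
  incl_π _ _ := rfl
  denseRange_π _ := T.denseRange_π m

/-- On the `ε`-ball of level `m` around `x₀`, the `j`-th component of `f` extends continuously to an
open subset of level `n`; if `t` holds, it also satisfies a tame estimate there. -/
def HasExt (t : Prop) (T : Tower 𝕜 X) (T' : Tower 𝕜 Y) (f : X → Y) (x₀ : X) (m : ℕ) (ε : ℝ)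
    (j n : ℕ) : Prop :=
  (∃ (U : Set (T.level n)) (g : T.level n → T'.level j), IsOpen U ∧ ContinuousOn g U ∧
    ∀ y, ‖T.π m (y - x₀)‖ < ε → T.π n y ∈ U ∧ g (T.π n y) = T'.π j (f y)) ∧
  (t → ∃ B, ∀ y, ‖T.π m (y - x₀)‖ < ε → ‖T'.π j (f y)‖ ≤ B * (1 + ‖T.π n y‖))

/-- `f` is of class sc⁰ near `x₀` (and tame, if `t` holds). -/
def Sc0At (t : Prop) (T : Tower 𝕜 X) (T' : Tower 𝕜 Y) (f : X → Y) (x₀ : X) : Prop :=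
  ∃ m, ∃ ε > 0, ∃ c, ∀ j, ∃ n, m ≤ n ∧ (t → n ≤ j + c) ∧ HasExt t T T' f x₀ m ε j n

variable {t : Prop} {T : Tower 𝕜 X} {T' : Tower 𝕜 Y} {T'' : Tower 𝕜 Z} {f : X → Y} {x₀ : X}

theorem HasExt.mono {m m' n n' j : ℕ} {ε ε' : ℝ} (h : HasExt t T T' f x₀ m ε j n) (hm : m ≤ m')
    (hn : n ≤ n') (hε : ε' ≤ ε) : HasExt t T T' f x₀ m' ε' j n' := by
  obtain ⟨⟨U, g, hU, hg, hgf⟩, hB⟩ := h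
  have key : ∀ y, ‖T.π m' (y - x₀)‖ < ε' → ‖T.π m (y - x₀)‖ < ε := fun y hy =>
    (T.norm_π_mono hm _).trans_lt (hy.trans_le hε)
  refine ⟨⟨T.incl hn ⁻¹' U, g ∘ T.incl hn, hU.preimage (T.incl hn).continuous,
    hg.comp (T.incl hn).continuous.continuousOn (mapsTo_preimage _ _), fun y hy => ?_⟩,
    fun ht => ?_⟩
  · rw [mem_preimage, Function.comp_apply, T.incl_π]
    exact hgf y (key y hy)
  · obtain ⟨B, hB⟩ := hB ht
    -- The constant may be negative; its absolute value makes the bound monotone in the norm of the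
    -- higher level.
    refine ⟨|B|, fun y hy => (hB y (key y hy)).trans ?_⟩
    have := T.norm_π_mono hn y
    have h1 := norm_nonneg (T.π n y)
    gcongr
    exact le_abs_self B

theorem HasExt.congr {m n j : ℕ} {ε : ℝ} {f' : X → Y} (h : HasExt t T T' f x₀ m ε j n)
    (hf : ∀ y, ‖T.π m (y - x₀)‖ < ε → f y = f' y) : HasExt t T T' f' x₀ m ε j n := by
  obtain ⟨⟨U, g, hU, hg, hgf⟩, hB⟩ := h
  refine ⟨⟨U, g, hU, hg, fun y hy => ?_⟩, fun ht => ?_⟩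
  · rw [← hf y hy]
    exact hgf y hy
  · obtain ⟨B, hB⟩ := hB ht
    refine ⟨B, fun y hy => ?_⟩
    rw [← hf y hy]
    exact hB y hy

/-- The requirement `m ≤ n` costs nothing: every `n` may be raised by `m`, which only enlarges the
tame constant to `c + m`. -/
theorem Sc0At.of_hasExt {m : ℕ} {ε : ℝ} (hε : 0 < ε) (c : ℕ)
    (h : ∀ j, ∃ n, (t → n ≤ j + c) ∧ HasExt t T T' f x₀ m ε j n) : Sc0At t T T' f x₀ := by
  refine ⟨m, ε, hε, c + m, fun j => ?_⟩
  obtain ⟨n, hn, he⟩ := h j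
  refine ⟨n + m, by omega, fun ht => ?_, he.mono le_rfl (by omega) le_rfl⟩
  have := hn ht
  omega

theorem Sc0At.mono {t' : Prop} (h : Sc0At t T T' f x₀) (ht : t' → t) : Sc0At t' T T' f x₀ := by
  obtain ⟨m, ε, hε, c, h⟩ := h
  refine ⟨m, ε, hε, c, fun j => ?_⟩
  obtain ⟨n, hmn, hn, h1, h2⟩ := h j
  exact ⟨n, hmn, fun h => hn (ht h), h1, fun h => h2 (ht h)⟩

/-- The ball on which `f` extends may be shrunk. -/
theorem Sc0At.shrink (h : Sc0At t T T' f x₀) (m₁ : ℕ) {ε₁ : ℝ} (hε₁ : 0 < ε₁) :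
    ∃ m, ∃ ε > 0, m₁ ≤ m ∧ ε ≤ ε₁ ∧ ∃ c, ∀ j, ∃ n, m ≤ n ∧ (t → n ≤ j + c) ∧
      HasExt t T T' f x₀ m ε j n := by
  obtain ⟨m, ε, hε, c, h⟩ := h
  refine ⟨m + m₁, min ε ε₁, lt_min hε hε₁, by omega, min_le_right _ _, c + m₁, fun j => ?_⟩
  obtain ⟨n, hmn, hn, he⟩ := h j
  refine ⟨n + m₁, by omega, fun ht => ?_, he.mono (by omega) (by omega) (min_le_left _ _)⟩
  have := hn ht
  omega

theorem Sc0At.congr {f' : X → Y} (h : Sc0At t T T' f x₀) {m₁ : ℕ} {ε₁ : ℝ} (hε₁ : 0 < ε₁)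
    (hf : ∀ y, ‖T.π m₁ (y - x₀)‖ < ε₁ → f y = f' y) : Sc0At t T T' f' x₀ := by
  obtain ⟨m, ε, hε, hm, hle, c, h⟩ := h.shrink m₁ hε₁
  refine ⟨m, ε, hε, c, fun j => ?_⟩
  obtain ⟨n, hmn, hn, he⟩ := h j
  exact ⟨n, hmn, hn, he.congr fun y hy =>
    hf y ((T.norm_π_mono hm _).trans_lt (hy.trans_le hle))⟩

/-- Components of maps of class sc⁰ are continuous at the base point. -/
theorem HasExt.exists_ball {m n j : ℕ} {ε : ℝ} (h : HasExt t T T' f x₀ m ε j n) (hε : 0 < ε)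
    {η : ℝ} (hη : 0 < η) :
    ∃ δ > 0, ∀ y, ‖T.π m (y - x₀)‖ < ε → ‖T.π n (y - x₀)‖ < δ → ‖T'.π j (f y - f x₀)‖ < η := by
  obtain ⟨⟨U, g, hU, hg, hgf⟩, -⟩ := h
  obtain ⟨h0, h0'⟩ := hgf x₀ (by simpa using hε)
  have hc : ContinuousAt g (T.π n x₀) := hg.continuousAt (hU.mem_nhds h0)
  obtain ⟨δ, hδ, hδ'⟩ := Metric.continuousAt_iff.1 hc η hη
  refine ⟨δ, hδ, fun y hy hy' => ?_⟩
  have := hδ' (x := T.π n y) (by rwa [dist_eq_norm, ← map_sub])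
  rwa [(hgf y hy).2, h0', dist_eq_norm, ← map_sub] at this

theorem Sc0At.exists_ball (h : Sc0At t T T' f x₀) (j : ℕ) {η : ℝ} (hη : 0 < η) :
    ∃ m, ∃ δ > 0, ∀ y, ‖T.π m (y - x₀)‖ < δ → ‖T'.π j (f y - f x₀)‖ < η := by
  obtain ⟨m, ε, hε, c, h⟩ := h
  obtain ⟨n, hmn, -, he⟩ := h j
  obtain ⟨δ, hδ, H⟩ := he.exists_ball hε hη
  refine ⟨n, min ε δ, lt_min hε hδ, fun y hy => H y ?_ (hy.trans_le (min_le_right _ _))⟩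
  exact (T.norm_π_mono hmn _).trans_lt (hy.trans_le (min_le_left _ _))

/-- Continuity of `f` at `x₀` lets the source ball be shrunk until `f` maps it into the ball on
which `g` extends. Then the extensions compose, the shifts of levels add up, and linear growth is
preserved under composition. -/
theorem Sc0At.comp {g : Y → Z} (hg : Sc0At t T' T'' g (f x₀)) (hf : Sc0At t T T' f x₀) :
    Sc0At t T T'' (fun x => g (f x)) x₀ := by
  obtain ⟨m', ε', hε', c', hg⟩ := hg
  obtain ⟨m₁, δ, hδ, hb⟩ := hf.exists_ball m' hε'
  obtain ⟨m, ε, hε, hm, hle, c, hf⟩ := hf.shrink m₁ hδ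
  refine Sc0At.of_hasExt (m := m) hε (c' + c) fun j => ?_
  obtain ⟨k, -, hk, ⟨U', g', hU', hg', hgf'⟩, hB'⟩ := hg j
  obtain ⟨n, -, hn, ⟨U, g₁, hU, hg₁, hgf₁⟩, hB⟩ := hf k
  have hball : ∀ y, ‖T.π m (y - x₀)‖ < ε → ‖T'.π m' (f y - f x₀)‖ < ε' := fun y hy =>
    hb y ((T.norm_π_mono hm _).trans_lt (hy.trans_le hle))
  refine ⟨n, fun ht => ?_, ⟨U ∩ g₁ ⁻¹' U', g' ∘ g₁, hg₁.isOpen_inter_preimage hU hU',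
    hg'.comp (hg₁.mono inter_subset_left) fun x hx => hx.2, fun y hy => ?_⟩, fun ht => ?_⟩
  · have := hk ht
    have := hn ht
    omega
  · obtain ⟨h1, h2⟩ := hgf₁ y hy
    obtain ⟨h3, h4⟩ := hgf' (f y) (hball y hy)
    refine ⟨⟨h1, ?_⟩, ?_⟩
    · rwa [mem_preimage, h2]
    · rw [Function.comp_apply, h2, h4]
  · obtain ⟨B', hB'⟩ := hB' ht
    obtain ⟨B, hB⟩ := hB ht
    refine ⟨|B'| * (1 + |B|), fun y hy => (hB' _ (hball y hy)).trans ?_⟩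
    have h1 := hB y hy
    have h2 := norm_nonneg (T'.π k (f y))
    have h3 := norm_nonneg (T.π n y)
    have h4 : ‖T'.π k (f y)‖ ≤ |B| * (1 + ‖T.π n y‖) :=
      h1.trans (mul_le_mul_of_nonneg_right (le_abs_self B) (by positivity))
    calc B' * (1 + ‖T'.π k (f y)‖) ≤ |B'| * (1 + ‖T'.π k (f y)‖) :=
          mul_le_mul_of_nonneg_right (le_abs_self B') (by positivity)
      _ ≤ |B'| * ((1 + |B|) * (1 + ‖T.π n y‖)) := by
          gcongr
          nlinarith
      _ = _ := by ring

theorem Sc0At.prodMk {g : X → Z} (hf : Sc0At t T T' f x₀) (hg : Sc0At t T T'' g x₀) :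
    Sc0At t T (T'.prod T'') (fun x => (f x, g x)) x₀ := by
  obtain ⟨m', ε', hε', c', hg⟩ := hg
  obtain ⟨m, ε, hε, hm, hle, c, hf⟩ := hf.shrink m' hε'
  refine Sc0At.of_hasExt (m := m) hε (c' + c) fun j => ?_
  obtain ⟨k, -, hk, hg⟩ := hg j
  obtain ⟨n, -, hn, hf⟩ := hf j
  refine ⟨max k n, fun ht => ?_, ?_⟩
  · have := hk ht
    have := hn ht
    omega
  obtain ⟨⟨U', g', hU', hg', hgf'⟩, hB'⟩ := hg.mono hm (le_max_left k n) hle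
  obtain ⟨⟨U, g₁, hU, hg₁, hgf₁⟩, hB⟩ := hf.mono le_rfl (le_max_right k n) le_rfl
  refine ⟨⟨U ∩ U', fun x => (g₁ x, g' x), hU.inter hU', ?_, fun y hy => ?_⟩, fun ht => ?_⟩
  · exact ContinuousOn.prodMk (hg₁.mono inter_subset_left) (hg'.mono inter_subset_right)
  · exact ⟨⟨(hgf₁ y hy).1, (hgf' y hy).1⟩, Prod.ext (hgf₁ y hy).2 (hgf' y hy).2⟩
  · obtain ⟨B', hB'⟩ := hB' ht
    obtain ⟨B, hB⟩ := hB ht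
    refine ⟨max B B', fun y hy => max_le ?_ ?_⟩
    · exact (hB y hy).trans (mul_le_mul_of_nonneg_right (le_max_left _ _) (by positivity))
    · exact (hB' y hy).trans (mul_le_mul_of_nonneg_right (le_max_right _ _) (by positivity))

/-- Maps induced by continuous linear maps between the levels are of class sc⁰. -/
theorem Sc0At.of_clm (c : ℕ) (h : ∀ j, ∃ n, (t → n ≤ j + c) ∧
    ∃ A : T.level n →L[𝕜] T'.level j, ∀ y, A (T.π n y) = T'.π j (f y)) : Sc0At t T T' f x₀ := by
  refine Sc0At.of_hasExt (m := 0) one_pos c fun j => ?_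
  obtain ⟨n, hn, A, hA⟩ := h j
  refine ⟨n, hn, ⟨univ, A, isOpen_univ, A.continuous.continuousOn, fun y _ => ⟨mem_univ _, hA y⟩⟩,
    fun _ => ⟨‖A‖, fun y _ => ?_⟩⟩
  rw [← hA]
  refine (A.le_opNorm _).trans ?_
  gcongr
  linarith

theorem Sc0At.fst {p : X × Y} : Sc0At t (T.prod T') T Prod.fst p :=
  Sc0At.of_clm 0 fun j => ⟨j, fun _ => le_rfl, ContinuousLinearMap.fst 𝕜 _ _, fun _ => rfl⟩

theorem Sc0At.snd {p : X × Y} : Sc0At t (T.prod T') T' Prod.snd p :=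
  Sc0At.of_clm 0 fun j => ⟨j, fun _ => le_rfl, ContinuousLinearMap.snd 𝕜 _ _, fun _ => rfl⟩

theorem Sc0At.add {g : X → Y} (hf : Sc0At t T T' f x₀) (hg : Sc0At t T T' g x₀) :
    Sc0At t T T' (fun x => f x + g x) x₀ := by
  refine Sc0At.comp (g := fun p : Y × Y => p.1 + p.2) (T' := T'.prod T') ?_ (hf.prodMk hg)
  refine Sc0At.of_clm 0 fun j => ⟨j, fun _ => le_rfl,
    ContinuousLinearMap.fst 𝕜 _ _ + ContinuousLinearMap.snd 𝕜 _ _, fun y => ?_⟩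
  exact (map_add (T'.π j) y.1 y.2).symm

/-- The projection from a product to a constant tower factors through a constant tower. -/
theorem Sc0At.toConst {g : X × Y → Z} {p : X × Y} (hg : Sc0At t (T.prod T') T'' g p) (k : ℕ) :
    ∃ l, ∀ l', l ≤ l' → Sc0At t (T.prod (T'.const l')) (T''.const k) g p := by
  obtain ⟨m, ε, hε, c, hg⟩ := hg
  obtain ⟨n, hmn, -, ⟨U, g₁, hU, hg₁, hgf⟩, hB⟩ := hg k
  -- The target tower is constant, so one `n` serves every `j`, and `n ≤ j + n` makes the tame bound
  -- automatic.
  refine ⟨n, fun l' hl' => Sc0At.of_hasExt (m := m) hε n fun j => ⟨n, fun _ => by omega, ?_⟩⟩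
  let A : T.level n × T'.level l' →L[𝕜] T.level n × T'.level n :=
    (ContinuousLinearMap.id 𝕜 _).prodMap (T'.incl hl')
  have hA : ∀ y : X × Y, A (T.π n y.1, T'.π l' y.2) = (T.π n y.1, T'.π n y.2) := fun y =>
    Prod.ext rfl (T'.incl_π hl' _)
  have hball : ∀ y : X × Y, ‖(T.prod (T'.const l')).π m (y - p)‖ < ε →
      ‖(T.prod T').π m (y - p)‖ < ε := by
    intro y hy
    refine lt_of_le_of_lt ?_ hy
    exact max_le_max le_rfl (T'.norm_π_mono (hmn.trans hl') _)
  refine ⟨⟨A ⁻¹' U, g₁ ∘ A, hU.preimage A.continuous,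
    hg₁.comp A.continuous.continuousOn (mapsTo_preimage _ _), fun y hy => ?_⟩, fun ht => ?_⟩
  · obtain ⟨h1, h2⟩ := hgf y (hball y hy)
    constructor
    · exact (congrArg (fun z => z ∈ U) (hA y)).mpr h1
    · exact (congrArg g₁ (hA y)).trans h2
  · obtain ⟨B, hB⟩ := hB ht
    refine ⟨|B|, fun y hy => (hB y (hball y hy)).trans ?_⟩
    have h1 : ‖(T.prod T').π n y‖ ≤ ‖(T.prod (T'.const l')).π n y‖ :=
      max_le_max le_rfl (T'.norm_π_mono hl' _)
    have h2 := norm_nonneg ((T.prod T').π n y)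
    refine mul_le_mul (le_abs_self B) (by linarith) (by linarith) (abs_nonneg _)

/-- The level of a constant tower in the source may be raised. -/
theorem Sc0At.prodConst_mono {l l' : ℕ} (h : l ≤ l') {p : X × Y} :
    Sc0At t (T.prod (T'.const l')) (T.prod (T'.const l)) id p :=
  Sc0At.of_clm 0 fun j => ⟨j, fun _ => le_rfl,
    (ContinuousLinearMap.id 𝕜 _).prodMap (T'.incl h),
    fun _ => Prod.ext rfl (T'.incl_π h _)⟩

/-- An open `O` meets the dense range of `π` in a dense subset of `O`. This transfers identities
from the limit space to the levels. -/
theorem eqOn_of_denseRange {P L M : Type*} [TopologicalSpace L] [TopologicalSpace M] [T2Space M]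
    {π : P → L} (hπ : DenseRange π) {O : Set L} (hO : IsOpen O) {f g : L → M}
    (hf : ContinuousOn f O) (hg : ContinuousOn g O) (h : ∀ y, π y ∈ O → f (π y) = g (π y)) :
    EqOn f g O := by
  refine EqOn.of_subset_closure (s := O ∩ range π) ?_ hf hg inter_subset_left
    (Dense.open_subset_closure_inter hπ hO)
  rintro _ ⟨hx, y, rfl⟩
  exact h y hx

/-- The inequality is the equality `min f g = f`, so tame estimates also pass to the levels by
density. -/
theorem le_of_denseRange {P L : Type*} [TopologicalSpace L]
    {π : P → L} (hπ : DenseRange π) {O : Set L} (hO : IsOpen O) {f g : L → ℝ}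
    (hf : ContinuousOn f O) (hg : ContinuousOn g O) (h : ∀ y, π y ∈ O → f (π y) ≤ g (π y)) :
    ∀ x ∈ O, f x ≤ g x := fun _ hx =>
  min_eq_left_iff.1 (eqOn_of_denseRange hπ hO (f := fun x => min (f x) (g x)) (hf.inf hg) hf
    (fun y hy => min_eq_left (h y hy)) hx)

end Tower

/-! ### Inclusions and density in sc-chains -/

namespace ScChain

variable {𝕜 : Type*} [RCLike 𝕜] (C : ScChain.{u} 𝕜)

theorem incl_self (m : ℕ) (x : C.level m) : C.incl le_rfl x = x := by
  simp [incl, Nat.leRec_self]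

theorem incl_succ {m n : ℕ} (h : m ≤ n) (x : C.level (n + 1)) :
    C.incl (h.trans n.le_succ) x = C.incl h (C.ι n x) := by
  simp only [incl]
  rw [Nat.leRec_succ _ _ h]
  rfl

theorem incl_le_succ (n : ℕ) (x : C.level (n + 1)) : C.incl n.le_succ x = C.ι n x := by
  rw [← C.incl_self n (C.ι n x), ← C.incl_succ]

theorem incl_incl {m n k : ℕ} (h : m ≤ n) (h' : n ≤ k) (x : C.level k) :
    C.incl h (C.incl h' x) = C.incl (h.trans h') x := by
  induction k, h' using Nat.le_induction with
  | base => rw [C.incl_self]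
  | succ k hk ih => rw [C.incl_succ hk, ih, ← C.incl_succ (h.trans hk)]

theorem ι_incl {m n : ℕ} (h : m + 1 ≤ n) (x : C.level n) :
    C.ι m (C.incl h x) = C.incl (m.le_succ.trans h) x := by
  rw [← C.incl_le_succ, C.incl_incl]

theorem incl_infty {m n : ℕ} (h : m ≤ n) (x : C.infty) : C.incl h (x.1 n) = x.1 m := by
  induction n, h using Nat.le_induction with
  | base => rw [C.incl_self]
  | succ n hn ih => rw [C.incl_succ hn, x.2 n, ih]

theorem norm_incl_le {m n : ℕ} (h : m ≤ n) : ‖C.incl h‖ ≤ 1 := by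
  refine ContinuousLinearMap.opNorm_le_bound _ zero_le_one fun x => ?_
  rw [one_mul]
  induction n, h using Nat.le_induction with
  | base => rw [C.incl_self]
  | succ n hn ih =>
    rw [C.incl_succ hn]
    refine (ih _).trans ?_
    simpa using (C.ι n).le_of_opNorm_le (C.ι_norm_le n) x

theorem incl_injective {m n : ℕ} (h : m ≤ n) : Function.Injective (C.incl h) := by
  intro x y hxy
  induction n, h using Nat.le_induction with
  | base => rwa [C.incl_self, C.incl_self] at hxy
  | succ n hn ih =>
    rw [C.incl_succ hn, C.incl_succ hn] at hxy
    exact C.ι_injective n (ih hxy)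

theorem isCompactOperator_incl {m n : ℕ} (h : m < n) : IsCompactOperator (C.incl h.le) := by
  obtain ⟨k, rfl⟩ : ∃ k, n = k + 1 := ⟨n - 1, by omega⟩
  have hk : m ≤ k := by omega
  have h1 : ⇑(C.incl h.le) = C.incl hk ∘ C.ι k := funext fun x => C.incl_succ hk x
  rw [h1]
  exact (C.ι_compact k).clm_comp _

/-- A Mittag-Leffler argument. Starting from `x₀`, choose points of successively higher levels, each
approximating its predecessor with a geometrically small error. Inclusions are contractions, so the
images in every fixed level form a Cauchy sequence, and the limits are compatible with the
inclusions. -/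
theorem exists_infty_norm_sub_le (n : ℕ) (x₀ : C.level n) {ε : ℝ} (hε : 0 < ε) :
    ∃ y : C.infty, ‖y.1 n - x₀‖ ≤ ε := by
  have hstep : ∀ i (x : C.level (n + i)), ∃ y : C.level (n + i + 1),
      ‖C.ι (n + i) y - x‖ < ε * (1 / 2) ^ (i + 1) := by
    intro i x
    obtain ⟨y, hy⟩ := Metric.denseRange_iff.1 (C.ι_denseRange (n + i)) x
      (ε * (1 / 2) ^ (i + 1)) (by positivity)
    exact ⟨y, by rwa [dist_comm, dist_eq_norm] at hy⟩
  choose s hs using hstep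
  let z : ∀ i, C.level (n + i) := fun i => Nat.rec (motive := fun i => C.level (n + i)) x₀ s i
  have hz : ∀ i, ‖C.ι (n + i) (z (i + 1)) - z i‖ < ε * (1 / 2) ^ (i + 1) := fun i => hs i (z i)
  have hlip : ∀ {m k : ℕ} (h : m ≤ k) (x : C.level k), ‖C.incl h x‖ ≤ ‖x‖ := fun h x => by
    simpa using (C.incl h).le_of_opNorm_le (C.norm_incl_le h) x
  -- `b k i` is the image in level `k` of the `i`-th approximation, defined once its level `n + i`
  -- has reached `k`.
  let b : ∀ k i, k ≤ n + i → C.level k := fun k i h => C.incl h (z i)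
  have hb : ∀ k i (h : k ≤ n + i),
      ‖b k (i + 1) (h.trans (Nat.le_succ _)) - b k i h‖ ≤ ε * (1 / 2) ^ (i + 1) := by
    intro k i h
    have h1 : b k (i + 1) (h.trans (Nat.le_succ _)) = C.incl h (C.ι (n + i) (z (i + 1))) :=
      C.incl_succ h _
    rw [h1, ← map_sub]
    exact (hlip h _).trans (hz i).le
  have hbcongr : ∀ k i i' h h', i = i' → b k i h = b k i' h' := by
    rintro k i _ h h' rfl
    rfl
  have hcauchy : ∀ k, CauchySeq fun i => b k (k + i) (by omega) := by
    intro k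
    refine cauchySeq_of_le_geometric (1 / 2) ε (by norm_num) fun i => ?_
    rw [dist_comm, dist_eq_norm]
    refine (hb k (k + i) (by omega)).trans ?_
    exact mul_le_mul_of_nonneg_left
      (pow_le_pow_of_le_one (by norm_num) (by norm_num) (by omega)) hε.le
  choose y hy using fun k => cauchySeq_tendsto_of_complete (hcauchy k)
  refine ⟨⟨y, fun k => ?_⟩, ?_⟩
  · have h1 := ((C.ι k).continuous.tendsto _).comp (hy (k + 1))
    have h2 := (hy k).comp (tendsto_add_atTop_nat 1)
    refine tendsto_nhds_unique h1 (h2.congr fun i => ?_)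
    have h3 : C.ι k (b (k + 1) (k + 1 + i) (by omega)) = b k (k + 1 + i) (by omega) :=
      C.ι_incl _ _
    simp only [Function.comp_apply]
    rw [h3]
    exact hbcongr _ _ _ _ _ (by omega)
  -- Telescoping the errors `ε / 2 ^ (i + 1)` gives the partial sum `ε (1 - 2 ^ (-i))`, which stays
  -- below `ε`.
  · have h0 : ∀ i, ‖b n i (by omega) - x₀‖ ≤ ε * (1 - (1 / 2) ^ i) := by
      intro i
      induction i with
      | zero =>
        have : b n 0 (by omega) = x₀ := C.incl_self n _
        simp [this]
      | succ i ih =>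
        have h1 := hb n i (by omega)
        have h2 := norm_sub_le_norm_sub_add_norm_sub (b n (i + 1) (by omega)) (b n i (by omega)) x₀
        have h3 : (1 / 2 : ℝ) ^ i = 2 * (1 / 2) ^ (i + 1) := by rw [pow_succ]; ring
        rw [h3] at ih
        linarith
    refine le_of_tendsto ((hy n).sub_const x₀).norm (Eventually.of_forall fun i => ?_)
    refine (h0 (n + i)).trans ?_
    have : (0 : ℝ) < (1 / 2) ^ (n + i) := by positivity
    nlinarith

theorem denseRange_infty (n : ℕ) : DenseRange fun x : C.infty => x.1 n := by
  rw [Metric.denseRange_iff]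
  intro x r hr
  obtain ⟨y, hy⟩ := C.exists_infty_norm_sub_le n x (half_pos hr)
  refine ⟨y, ?_⟩
  rw [dist_comm, dist_eq_norm]
  linarith

theorem continuous_infty_apply (n : ℕ) : Continuous fun x : C.infty => x.1 n :=
  (continuous_apply n).comp continuous_subtype_val

/-- The rescaled sc-chain `E^k`. -/
def rescale (k : ℕ → ℕ) (hk : StrictMono k) : ScChain.{u} 𝕜 where
  level j := C.level (k j)
  ι j := C.incl (hk.monotone j.le_succ)
  ι_injective j := C.incl_injective _
  ι_denseRange j := by
    refine (C.denseRange_infty (k j)).mono ?_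
    rintro _ ⟨x, rfl⟩
    exact ⟨x.1 (k (j + 1)), C.incl_infty _ x⟩
  ι_norm_le j := C.norm_incl_le _
  ι_compact j := C.isCompactOperator_incl (hk j.lt_succ_self)

variable {k : ℕ → ℕ} (hk : StrictMono k)

theorem rescale_incl {m n : ℕ} (h : m ≤ n) (x : C.level (k n)) :
    (C.rescale k hk).incl h x = C.incl (hk.monotone h) x := by
  induction n, h using Nat.le_induction with
  | base =>
    rw [C.incl_self]
    exact (C.rescale k hk).incl_self m x
  | succ n hn ih =>
    exact ((C.rescale k hk).incl_succ hn x).trans ((ih _).trans (C.incl_incl _ _ _))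

/-- `(E^k)_∞ = E_∞`. -/
def rescaleInfty : (C.rescale k hk).infty ≃L[𝕜] C.infty where
  toFun y := ⟨fun j => C.incl hk.le_apply (y.1 j), fun j => by
    refine (C.ι_incl _ _).trans (Eq.trans ?_ (congrArg (C.incl hk.le_apply) (y.2 j)))
    exact (C.incl_incl _ _ _).symm⟩
  invFun x := ⟨fun j => x.1 (k j), fun j => C.incl_infty _ x⟩
  map_add' _ _ := Subtype.ext (funext fun _ => map_add _ _ _)
  map_smul' _ _ := Subtype.ext (funext fun _ => map_smul _ _ _)
  left_inv y := Subtype.ext (funext fun j => by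
    have h1 : y.1 j = C.incl (hk.monotone hk.le_apply) (y.1 (k j)) :=
      ((C.rescale k hk).incl_infty hk.le_apply y).symm.trans (C.rescale_incl hk _ _)
    exact h1.symm)
  right_inv x := Subtype.ext (funext fun j => C.incl_infty _ x)
  continuous_toFun := Continuous.subtype_mk (continuous_pi fun j =>
    (C.incl hk.le_apply).continuous.comp ((C.rescale k hk).continuous_infty_apply j)) _
  continuous_invFun := Continuous.subtype_mk (continuous_pi fun j =>
    C.continuous_infty_apply (k j)) _

end ScChain

/-! ### The tower of an sc-structure -/

namespace ScStructure

variable {𝕜 : Type*} [RCLike 𝕜] {E : Type u} [AddCommGroup E] [Module 𝕜 E] [TopologicalSpace E]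
  (S : ScStructure 𝕜 E)

/-- The tower of levels of an sc-structure. -/
def tower : Tower 𝕜 E where
  level := S.chain.level
  incl := S.chain.incl
  incl_norm_le := S.chain.norm_incl_le
  π n := (LinearMap.proj n ∘ₗ S.chain.infty.subtype) ∘ₗ (S.φ.symm : E →ₗ[𝕜] S.chain.infty)
  incl_π h _ := S.chain.incl_infty h _
  denseRange_π n := (S.chain.denseRange_infty n).comp S.φ.symm.surjective.denseRange
    (S.chain.continuous_infty_apply n)

theorem tower_π (n : ℕ) (x : E) : S.tower.π n x = (S.φ.symm x).1 n := rfl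

theorem tower_π_φ (n : ℕ) (x : S.chain.infty) : S.tower.π n (S.φ x) = x.1 n := by
  rw [tower_π, S.φ.symm_apply_apply]

theorem continuous_π (n : ℕ) : Continuous (S.tower.π n) :=
  (S.chain.continuous_infty_apply n).comp S.φ.symm.continuous

theorem isTopologicalAddGroup (S : ScStructure 𝕜 E) : IsTopologicalAddGroup E :=
  S.φ.symm.toHomeomorph.isInducing.topologicalAddGroup S.φ.symm

theorem continuousSMul (S : ScStructure 𝕜 E) : ContinuousSMul 𝕜 E :=
  S.φ.symm.toHomeomorph.isInducing.continuousSMul continuous_id (by intros; simp)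

theorem t2Space (S : ScStructure 𝕜 E) : T2Space E := S.φ.symm.toHomeomorph.isEmbedding.t2Space

theorem firstCountableTopology (S : ScStructure 𝕜 E) : FirstCountableTopology E :=
  have : FirstCountableTopology S.chain.infty := IsInducing.subtypeVal.firstCountableTopology
  S.φ.symm.toHomeomorph.isInducing.firstCountableTopology

theorem tendsto_iff {α : Type*} {l : Filter α} {f : α → E} {x : E} :
    Tendsto f l (𝓝 x) ↔ ∀ n, Tendsto (fun a => S.tower.π n (f a)) l (𝓝 (S.tower.π n x)) := by
  rw [S.φ.symm.toHomeomorph.isInducing.tendsto_nhds_iff, IsInducing.subtypeVal.tendsto_nhds_iff,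
    tendsto_pi_nhds]
  rfl

/-- A basic neighbourhood in the projective limit restricts finitely many levels. As the norms
increase with the level, one ball at an upper bound of these levels lies inside it. -/
theorem mem_nhds_iff {x : E} {V : Set E} :
    V ∈ 𝓝 x ↔ ∃ m, ∃ ε > 0, ∀ y, ‖S.tower.π m (y - x)‖ < ε → y ∈ V := by
  constructor
  · intro hV
    rw [S.φ.symm.toHomeomorph.isInducing.nhds_eq_comap, IsInducing.subtypeVal.nhds_eq_comap,
      nhds_pi, comap_comap, mem_comap] at hV
    obtain ⟨W, hW, hWV⟩ := hV
    obtain ⟨I, hI, s, hs, hsW⟩ := Filter.mem_pi.1 hW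
    choose r hr hrs using fun i => Metric.mem_nhds_iff.1 (hs i)
    obtain ⟨m, hm⟩ := hI.bddAbove
    have hev : ∀ᶠ ε in 𝓝[>] (0 : ℝ), ∀ i ∈ I, ε < r i :=
      (eventually_all_finite hI).2 fun i _ =>
        (eventually_lt_nhds (hr i)).filter_mono nhdsWithin_le_nhds
    obtain ⟨ε, hε, hε0⟩ := (hev.and self_mem_nhdsWithin).exists
    refine ⟨m, ε, hε0, fun y hy => hWV (hsW fun i hi => hrs i ?_)⟩
    rw [Metric.mem_ball, dist_eq_norm]
    refine lt_of_le_of_lt ?_ (hy.trans (hε i hi))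
    refine le_trans (le_of_eq ?_) (S.tower.norm_π_mono (hm hi) (y - x))
    rw [map_sub]
    rfl
  · rintro ⟨m, ε, hε, h⟩
    have h1 := (S.continuous_π m).continuousAt.preimage_mem_nhds
      (Metric.ball_mem_nhds (S.tower.π m x) hε)
    refine mem_of_superset h1 fun y hy => h y ?_
    rwa [mem_preimage, Metric.mem_ball, dist_eq_norm, ← map_sub] at hy

theorem isOpen_ball (m : ℕ) (x : E) (ε : ℝ) : IsOpen {y | ‖S.tower.π m (y - x)‖ < ε} := by
  simp only [map_sub]
  exact isOpen_lt ((S.continuous_π m).sub continuous_const).norm continuous_const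

/-- The rescaled sc-structure. -/
def rescale (k : ℕ → ℕ) (hk : StrictMono k) : ScStructure 𝕜 E where
  chain := S.chain.rescale k hk
  φ := (S.chain.rescaleInfty hk).trans S.φ

theorem rescale_π (k : ℕ → ℕ) (hk : StrictMono k) (j : ℕ) (x : E) :
    (S.rescale k hk).tower.π j x = S.tower.π (k j) x := rfl

theorem equivalent_rescale (k : ℕ → ℕ) (hk : StrictMono k) : S.Equivalent (S.rescale k hk) := by
  constructor
  · refine ⟨k, id, hk, strictMono_id, fun _ => ContinuousLinearMap.id 𝕜 _, fun _ => Function.injective_id,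
      fun j x => ?_, fun x j => ?_⟩
    · exact ((S.chain.rescale_incl hk j.le_succ x)).symm
    · change S.tower.π (k j) (S.φ x) = _
      rw [tower_π_φ]
      rfl
  · refine ⟨id, k, strictMono_id, hk, fun _ => ContinuousLinearMap.id 𝕜 _, fun _ => Function.injective_id,
      fun j x => ?_, fun x j => ?_⟩
    · exact (S.chain.rescale_incl hk j.le_succ x)
    · change S.tower.π (k j) ((S.rescale k hk).φ x) = _
      rw [← S.rescale_π k hk, tower_π_φ]
      rfl

theorem isTameMorphism_trans_rescale (k : ℕ → ℕ) (hk : IsTameSeq k) :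
    S.chain.IsTameMorphism (S.rescale k hk.1).chain (S.trans (S.rescale k hk.1)) ∧
      (S.rescale k hk.1).chain.IsTameMorphism S.chain ((S.rescale k hk.1).trans S) := by
  constructor
  · refine ⟨k, hk, fun _ => ContinuousLinearMap.id 𝕜 _, fun j x => rfl, fun x j => ?_⟩
    change S.tower.π (k j) (S.φ x) = _
    rw [tower_π_φ]
    rfl
  · refine ⟨id, ⟨strictMono_id, 0, fun j => le_rfl⟩, fun j => S.chain.incl hk.1.le_apply,
      fun j x => ?_, fun x j => ?_⟩
    · have h1 := S.chain.rescale_incl hk.1 j.le_succ x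
      refine (congrArg (S.chain.incl hk.1.le_apply) h1).trans ?_
      exact (S.chain.incl_incl _ _ _).trans (S.chain.ι_incl _ _).symm
    · change S.tower.π j ((S.rescale k hk.1).φ x) = _
      change S.tower.π j (S.φ (S.chain.rescaleInfty hk.1 x)) = _
      rw [tower_π_φ]
      rfl

theorem tameEquivalent_rescale (k : ℕ → ℕ) (hk : IsTameSeq k) :
    S.TameEquivalent (S.rescale k hk.1) :=
  ⟨S.equivalent_rescale k hk.1, S.isTameMorphism_trans_rescale k hk⟩

/-- Compatibility, or tame compatibility if `t` holds. -/
def CompatibleOf [ScFrechet 𝕜 E] (t : Prop) : Prop := S.Compatible ∧ (t → S.TamelyCompatible)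

/-- Passing between two sc-structures whose transition map is a weak embedding (and tame, if `t`
holds) is of class sc⁰. -/
theorem sc0At_id {t : Prop} {S T : ScStructure 𝕜 E}
    (h : S.chain.IsWeakEmbedding T.chain (S.trans T))
    (h' : t → S.chain.IsTameMorphism T.chain (S.trans T)) :
    ∃ c, ∀ j, ∃ n, (t → n ≤ j + c) ∧
      ∃ A : S.tower.level n →L[𝕜] T.tower.level j, ∀ y, A (S.tower.π n y) = T.tower.π j y := by
  have hT : ∀ y, S.trans T (S.φ.symm y) = T.φ.symm y := fun y => by simp [trans]
  by_cases ht : t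
  · obtain ⟨k, ⟨hk, c, hc⟩, A, -, hA⟩ := h' ht
    refine ⟨c, fun j => ⟨k j, fun _ => hc j, A j, fun y => ?_⟩⟩
    exact (hA (S.φ.symm y) j).symm.trans (congrArg (fun z => z.1 j) (hT y))
  -- The weak embedding lands in level `l j`, and `j ≤ l j` allows a further inclusion into level
  -- `j`. The constant `0` is irrelevant because `t` fails here.
  · obtain ⟨k, l, hk, hl, A, -, -, hA⟩ := h
    refine ⟨0, fun j => ⟨k j, fun h => absurd h ht, (T.chain.incl hl.le_apply).comp (A j),
      fun y => ?_⟩⟩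
    refine (congrArg (T.chain.incl hl.le_apply) ((hA (S.φ.symm y) j).symm.trans
      (congrArg (fun z => z.1 (l j)) (hT y)))).trans ?_
    exact T.chain.incl_infty _ _

end ScStructure

/-! ### Building envelopes from extensions that agree with the map on a dense subspace -/

open Tower

/-- The levels provided by `Sc0At` need not increase with `j`, but a rescaling must. Partial sums
dominate any sequence; in the tame case `j + c` does so and keeps the linear bound. -/
theorem exists_strictMono_ge {t : Prop} (n : ℕ → ℕ) (c : ℕ) (h : t → ∀ j, n j ≤ j + c) :
    ∃ N : ℕ → ℕ, StrictMono N ∧ (∀ j, n j ≤ N j) ∧ (t → ∀ j, N j ≤ j + c) := by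
  by_cases ht : t
  · exact ⟨fun j => j + c, fun i j hij => by simpa using hij, h ht, fun _ j => le_rfl⟩
  · refine ⟨fun j => j + ∑ i ∈ Finset.range (j + 1), n i, strictMono_nat_of_lt_succ fun j => ?_,
      fun j => ?_, fun h => absurd h ht⟩
    · simp only [Finset.sum_range_succ _ (j + 1)]
      omega
    · simp only [Finset.sum_range_succ _ j]
      omega

namespace ScStructure

variable {𝕜 : Type*} [RCLike 𝕜] {E : Type u} [AddCommGroup E] [Module 𝕜 E] [TopologicalSpace E]
  {E' : Type v} [AddCommGroup E'] [Module 𝕜 E'] [TopologicalSpace E']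

/-- Open sets `U j` in the levels `N j` that contain a ball of level `m` can be shrunk to an
envelope of that ball. -/
theorem exists_setEnvelope (S : ScStructure 𝕜 E) {N : ℕ → ℕ} (hN : StrictMono N) {m : ℕ}
    (hm : ∀ j, m ≤ N j) (x₀ : E) (ε : ℝ) (U : ∀ j, Set (S.tower.level (N j)))
    (hU : ∀ j, IsOpen (U j)) (h : ∀ j y, ‖S.tower.π m (y - x₀)‖ < ε → S.tower.π (N j) y ∈ U j) :
    ∃ W : ∀ j, Set ((S.rescale N hN).chain.level j),
      (S.rescale N hN).chain.IsSetEnvelope W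
        ((S.rescale N hN).φ ⁻¹' {y | ‖S.tower.π m (y - x₀)‖ < ε}) ∧
      (∀ j, W j ⊆ U j) ∧
      ∀ j y, (S.rescale N hN).tower.π j y ∈ W j → ‖S.tower.π m (y - x₀)‖ < ε := by
  -- Intersecting the preimages of all `U i` with `i ≤ j` makes the sets compatible with the
  -- inclusions, and the intersection is finite, hence open. The pulled-back ball ensures that `W j`
  -- contains no points of `E` outside the ball.
  let W : ∀ j, Set (S.tower.level (N j)) := fun j =>
    {z | ‖S.tower.incl (hm j) z - S.tower.π m x₀‖ < ε} ∩
      ⋂ i : Fin (j + 1), S.tower.incl (hN.monotone (Nat.lt_succ_iff.1 i.2)) ⁻¹' U i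
  have hball : ∀ j y, S.tower.π (N j) y ∈ W j → ‖S.tower.π m (y - x₀)‖ < ε := by
    intro j y hy
    have h1 : ‖S.tower.incl (hm j) (S.tower.π (N j) y) - S.tower.π m x₀‖ < ε := hy.1
    have h2 : S.tower.incl (hm j) (S.tower.π (N j) y) = S.tower.π m y := S.tower.incl_π _ _
    rw [map_sub, ← h2]
    exact h1
  have hmem : ∀ y, ‖S.tower.π m (y - x₀)‖ < ε → ∀ j, S.tower.π (N j) y ∈ W j := by
    intro y hy j
    constructor
    · change ‖S.tower.incl (hm j) (S.tower.π (N j) y) - S.tower.π m x₀‖ < ε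
      have h2 : S.tower.incl (hm j) (S.tower.π (N j) y) = S.tower.π m y := S.tower.incl_π _ _
      rw [h2, ← map_sub]
      exact hy
    · refine mem_iInter.2 fun i => ?_
      have h2 : S.tower.incl (hN.monotone (Nat.lt_succ_iff.1 i.2)) (S.tower.π (N j) y) =
        S.tower.π (N i) y := S.tower.incl_π _ _
      exact (congrArg (· ∈ U i) h2).mpr (h i y hy)
  refine ⟨W, ⟨fun j => ?_, fun j z hz => ⟨?_, ?_⟩, fun x => ⟨fun hx j => ?_, fun hx => ?_⟩⟩,
    fun j z hz => ?_, hball⟩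
  · refine IsOpen.inter ?_ (isOpen_iInter_of_finite fun i =>
      (hU i).preimage (S.tower.incl _).continuous)
    exact isOpen_lt (((S.tower.incl (hm j)).continuous).sub continuous_const).norm
      continuous_const
  · have h1 : ‖S.tower.incl (hm (j + 1)) z - S.tower.π m x₀‖ < ε := hz.1
    have h2 : S.tower.incl (hm j) (S.tower.incl (hN.monotone j.le_succ) z) =
      S.tower.incl (hm (j + 1)) z := S.chain.incl_incl _ _ _
    rw [← h2] at h1
    exact h1
  · refine mem_iInter.2 fun i => ?_
    have h1 := mem_iInter.1 hz.2 ⟨i.1, by omega⟩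
    have h2 : S.tower.incl (hN.monotone (Nat.lt_succ_iff.1 i.2))
      (S.tower.incl (hN.monotone j.le_succ) z) = S.tower.incl (hN.monotone (by omega)) z :=
      S.chain.incl_incl _ _ _
    exact (congrArg (· ∈ U i) h2).mpr h1
  · have h1 := hmem _ hx j
    exact (congrArg (· ∈ W j) ((S.rescale N hN).tower_π_φ j x)).mp h1
  · have h1 := hball 0 ((S.rescale N hN).φ x)
    exact h1 ((congrArg (· ∈ W 0) ((S.rescale N hN).tower_π_φ 0 x)).mpr (hx 0))
  · have h1 := mem_iInter.1 hz.2 ⟨j, by omega⟩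
    have h2 : S.tower.incl (hN.monotone le_rfl) z = z := S.chain.incl_self _ z
    exact (congrArg (· ∈ U j) h2).mp h1

/-- Continuous maps that agree with `f` on the dense subspace `E` form an envelope of `f`. -/
theorem isMapEnvelope_of_dense (S : ScStructure 𝕜 E) (S' : ScStructure 𝕜 E') {f : E → E'}
    {V : Set E} {W : ∀ j, Set (S.chain.level j)} {g : ∀ j, S.chain.level j → S'.chain.level j}
    (hW : S.chain.IsSetEnvelope W (S.φ ⁻¹' V)) (hg : ∀ j, ContinuousOn (g j) (W j))
    (hgf : ∀ j y, S.tower.π j y ∈ W j → g j (S.tower.π j y) = S'.tower.π j (f y)) :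
    S.chain.IsMapEnvelope S'.chain W (S.φ ⁻¹' V) g (fun x => S'.φ.symm (f (S.φ x))) := by
  refine ⟨hW, hg, fun j z hz => ?_, fun x hx j => ?_⟩
  · refine eqOn_of_denseRange (S.tower.denseRange_π (j + 1)) (hW.1 (j + 1))
      (f := fun z => g j (S.chain.ι j z)) (g := fun z => S'.chain.ι j (g (j + 1) z))
      ((hg j).comp (S.chain.ι j).continuous.continuousOn (hW.2.1 j))
      ((S'.chain.ι j).continuous.comp_continuousOn (hg (j + 1))) (fun y hy => ?_) hz
    have h1 : S.chain.ι j (S.tower.π (j + 1) y) = S.tower.π j y := (S.φ.symm y).2 j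
    have h2 : S'.chain.ι j (S'.tower.π (j + 1) (f y)) = S'.tower.π j (f y) := (S'.φ.symm (f y)).2 j
    have h3 : S.tower.π j y ∈ W j := h1 ▸ hW.2.1 j hy
    have h4 := (hgf j y h3).trans (h2.symm.trans (congrArg (S'.chain.ι j) (hgf _ y hy)).symm)
    exact (congrArg (g j) h1).trans h4
  · have h1 := hgf j (S.φ x)
    rw [tower_π_φ] at h1
    exact h1 ((hW.2.2 x).1 hx j)

end ScStructure

/-! ### Envelopes of maps correspond to the germ condition `Sc0At` -/

section Maps

variable {𝕜 : Type*} [RCLike 𝕜]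
variable {E : Type u} [AddCommGroup E] [Module 𝕜 E] [TopologicalSpace E] [ScFrechet 𝕜 E]
variable {E' : Type v} [AddCommGroup E'] [Module 𝕜 E'] [TopologicalSpace E'] [ScFrechet 𝕜 E']

variable (𝕜 E) in
/-- The tower of the distinguished sc-structure of an sc-Fréchet space. -/
def ScFrechet.tower : Tower 𝕜 E := (ScFrechet.str (𝕜 := 𝕜) (E := E)).tower

namespace ScStructure

variable {t : Prop} {S : ScStructure 𝕜 E}

theorem compatibleOf_true : S.CompatibleOf True ↔ S.TamelyCompatible :=
  ⟨fun h => h.2 trivial, fun h => ⟨h.1, fun _ => h⟩⟩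

theorem CompatibleOf.exists_clm_to (h : S.CompatibleOf t) :
    ∃ c, ∀ j, ∃ n, (t → n ≤ j + c) ∧ ∃ A : (ScFrechet.tower 𝕜 E).level n →L[𝕜] S.tower.level j,
      ∀ y, A ((ScFrechet.tower 𝕜 E).π n y) = S.tower.π j y :=
  sc0At_id h.1.1 fun ht => (h.2 ht).2.1

theorem CompatibleOf.exists_clm_from (h : S.CompatibleOf t) :
    ∃ c, ∀ j, ∃ n, (t → n ≤ j + c) ∧ ∃ A : S.tower.level n →L[𝕜] (ScFrechet.tower 𝕜 E).level j,
      ∀ y, A (S.tower.π n y) = (ScFrechet.tower 𝕜 E).π j y :=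
  sc0At_id h.1.2 fun ht => (h.2 ht).2.2

theorem CompatibleOf.sc0At_to (h : S.CompatibleOf t) {x : E} :
    Sc0At t (ScFrechet.tower 𝕜 E) S.tower id x :=
  h.exists_clm_to.elim fun c hc => Sc0At.of_clm c hc

theorem CompatibleOf.sc0At_from (h : S.CompatibleOf t) {x : E} :
    Sc0At t S.tower (ScFrechet.tower 𝕜 E) id x :=
  h.exists_clm_from.elim fun c hc => Sc0At.of_clm c hc

theorem compatibleOf_rescale {N : ℕ → ℕ} (hN : StrictMono N) (hN' : t → ∃ c, ∀ j, N j ≤ j + c) :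
    ((ScFrechet.str (𝕜 := 𝕜) (E := E)).rescale N hN).CompatibleOf t :=
  ⟨equivalent_rescale _ N hN, fun ht => tameEquivalent_rescale _ N ⟨hN, hN' ht⟩⟩

end ScStructure

variable (𝕜) in
/-- `f` restricted to `A` has an envelope, which is tame if `t` holds. -/
def HasEnvelopeOf (t : Prop) (f : E → E') (A : Set E) : Prop :=
  ∃ (S : ScStructure 𝕜 E) (S' : ScStructure 𝕜 E'), S.CompatibleOf t ∧ S'.CompatibleOf t ∧
    ∃ U g, S.chain.IsMapEnvelope S'.chain U (S.φ ⁻¹' A) g (fun x => S'.φ.symm (f (S.φ x))) ∧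
      (t → ∀ k, ∃ c : ℝ, ∀ x ∈ U k, ‖g k x‖ ≤ c * (1 + ‖x‖))

theorem hasEnvelopeOf_false {f : E → E'} {A : Set E} :
    HasEnvelopeOf 𝕜 False f A ↔ HasEnvelope 𝕜 f A := by
  simp [HasEnvelopeOf, HasEnvelope, ScStructure.CompatibleOf]

theorem hasEnvelopeOf_true {f : E → E'} {A : Set E} :
    HasEnvelopeOf 𝕜 True f A ↔ HasTameEnvelope 𝕜 f A := by
  simp [HasEnvelopeOf, HasTameEnvelope, ScStructure.compatibleOf_true]

/-- Restricting the envelope to a ball inside `V` gives the germ condition for its own structures.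
Composing with the identity maps to and from the distinguished structures, which are of class sc⁰,
removes the dependence on the choice. -/
theorem HasEnvelopeOf.sc0At {t : Prop} {f : E → E'} {V : Set E} (h : HasEnvelopeOf 𝕜 t f V)
    (hV : IsOpen V) {x : E} (hx : x ∈ V) :
    Sc0At t (ScFrechet.tower 𝕜 E) (ScFrechet.tower 𝕜 E') f x := by
  obtain ⟨S, S', hS, hS', U, g, ⟨hU, hg, -, hgf⟩, hB⟩ := h
  obtain ⟨m, ε, hε, hball⟩ := S.mem_nhds_iff.1 (hV.mem_nhds hx)
  have key : ∀ j y, ‖S.tower.π m (y - x)‖ < ε →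
      S.tower.π j y ∈ U j ∧ g j (S.tower.π j y) = S'.tower.π j (f y) := by
    intro j y hy
    have hy' : S.φ.symm y ∈ S.φ ⁻¹' V := by
      rw [mem_preimage, S.φ.apply_symm_apply]
      exact hball y hy
    refine ⟨(hU.2.2 _).1 hy' j, (hgf _ hy' j).trans ?_⟩
    exact congrArg (fun z => S'.tower.π j (f z)) (S.φ.apply_symm_apply y)
  have h1 : Sc0At t S.tower S'.tower f x := by
    refine Sc0At.of_hasExt (m := m) hε 0 fun j => ⟨j, fun _ => le_rfl,
      ⟨U j, g j, hU.1 j, hg j, key j⟩, fun ht => ?_⟩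
    obtain ⟨c, hc⟩ := hB ht j
    refine ⟨c, fun y hy => ?_⟩
    rw [← (key j y hy).2]
    exact hc _ (key j y hy).1
  exact Sc0At.comp (g := id) hS'.sc0At_from (Sc0At.comp (f := id) h1 hS.sc0At_to)

/-- Rescaling the source by increasing levels `N j` on which the components extend, and leaving the
target alone, puts the `j`-th extension between the `j`-th levels. Shrunken domains form an envelope
of a ball; compatibility and estimates follow by density. -/
theorem Tower.Sc0At.exists_hasEnvelopeOf {t : Prop} {f : E → E'} {x : E}
    (h : Sc0At t (ScFrechet.tower 𝕜 E) (ScFrechet.tower 𝕜 E') f x) {U : Set E} (hU : U ∈ 𝓝 x) :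
    ∃ V, IsOpen V ∧ x ∈ V ∧ V ⊆ U ∧ HasEnvelopeOf 𝕜 t f V := by
  set S₀ : ScStructure 𝕜 E := ScFrechet.str
  set S₀' : ScStructure 𝕜 E' := ScFrechet.str
  obtain ⟨m₁, ε₁, hε₁, hball₁⟩ := S₀.mem_nhds_iff.1 hU
  obtain ⟨m, ε, hε, hm, hle, c, h⟩ := h.shrink m₁ hε₁
  choose n hmn hn he using h
  obtain ⟨N, hN, hnN, hNc⟩ := exists_strictMono_ge n c fun ht j => hn j ht
  have hext := fun j => (he j).mono le_rfl (hnN j) le_rfl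
  choose O hO using fun j => (hext j).1
  choose g hOo hg hgf using hO
  obtain ⟨W, hW, hWO, hWb⟩ := S₀.exists_setEnvelope hN (fun j => (hmn j).trans (hnN j)) x ε O hOo
    fun j y hy => (hgf j y hy).1
  refine ⟨{y | ‖S₀.tower.π m (y - x)‖ < ε}, S₀.isOpen_ball _ _ _, by simpa using hε,
    fun y hy => hball₁ y ((S₀.tower.norm_π_mono hm _).trans_lt (lt_of_lt_of_le hy hle)),
    S₀.rescale N hN, S₀'.rescale id strictMono_id,
    ScStructure.compatibleOf_rescale hN fun ht => ⟨c, hNc ht⟩,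
    ScStructure.compatibleOf_rescale strictMono_id fun _ => ⟨0, fun _ => le_rfl⟩, W, g, ?_, ?_⟩
  · exact ScStructure.isMapEnvelope_of_dense _ _ hW (fun j => (hg j).mono (hWO j))
      fun j y hy => (hgf j y (hWb j y hy)).2
  · intro ht j
    obtain ⟨B, hB⟩ := (hext j).2 ht
    refine ⟨B, le_of_denseRange ((S₀.rescale N hN).tower.denseRange_π j) (hW.1 j)
      ((hg j).mono (hWO j)).norm (by fun_prop) fun y hy => ?_⟩
    have h1 := hB y (hWb j y hy)
    rw [← (hgf j y (hWb j y hy)).2] at h1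
    exact h1

variable (𝕜) in
/-- `f` is of class sc⁰ on `U`, and tame if `t` holds. -/
def Sc0OnOf (t : Prop) (f : E → E') (U : Set E) : Prop :=
  ∀ x ∈ U, Sc0At t (ScFrechet.tower 𝕜 E) (ScFrechet.tower 𝕜 E') f x

theorem sc0On_iff {f : E → E'} {U : Set E} (hU : IsOpen U) :
    Sc0On 𝕜 f U ↔ Sc0OnOf 𝕜 False f U := by
  refine forall₂_congr fun x hx => ?_
  simp only [← hasEnvelopeOf_false]
  exact ⟨fun ⟨V, hV, hxV, _, h⟩ => h.sc0At hV hxV,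
    fun h => h.exists_hasEnvelopeOf (hU.mem_nhds hx)⟩

theorem tameOn_iff {f : E → E'} {U : Set E} (hU : IsOpen U) :
    TameOn 𝕜 f U ↔ Sc0OnOf 𝕜 True f U := by
  refine forall₂_congr fun x hx => ?_
  simp only [← hasEnvelopeOf_true]
  exact ⟨fun ⟨V, hV, hxV, _, h⟩ => h.sc0At hV hxV,
    fun h => h.exists_hasEnvelopeOf (hU.mem_nhds hx)⟩

theorem sc0At_prod_iff {t : Prop} {Z : Type*} [AddCommGroup Z] [Module 𝕜 Z] {T : Tower 𝕜 Z}
    {f : E × E' → Z} {p : E × E'} :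
    Sc0At t (ScFrechet.tower 𝕜 (E × E')) T f p ↔
      Sc0At t ((ScFrechet.tower 𝕜 E).prod (ScFrechet.tower 𝕜 E')) T f p := by
  constructor
  · exact fun h => Sc0At.comp (f := id) h (Sc0At.of_clm 0 fun j => ⟨j, fun _ => le_rfl,
      ContinuousLinearMap.id 𝕜 _, fun _ => rfl⟩)
  · exact fun h => Sc0At.comp (f := id) h (Sc0At.of_clm 0 fun j => ⟨j, fun _ => le_rfl,
      ContinuousLinearMap.id 𝕜 _, fun _ => rfl⟩)

theorem Tower.Sc0At.continuousAt {t : Prop} {f : E → E'} {x : E}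
    (h : Sc0At t (ScFrechet.tower 𝕜 E) (ScFrechet.tower 𝕜 E') f x) : ContinuousAt f x := by
  intro V hV
  obtain ⟨j, η, hη, hV⟩ := (ScFrechet.str (𝕜 := 𝕜) (E := E')).mem_nhds_iff.1 hV
  obtain ⟨m, δ, hδ, hb⟩ := h.exists_ball j hη
  exact (ScFrechet.str (𝕜 := 𝕜) (E := E)).mem_nhds_iff.2 ⟨m, δ, hδ, fun y hy => hV _ (hb y hy)⟩

end Maps

/-! ### Extending fibrewise linear maps from a small ball to the whole fibre -/

namespace Tower

variable {𝕜 : Type*} [RCLike 𝕜] {X : Type*} [AddCommGroup X] [Module 𝕜 X]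
  {Y : Type*} [AddCommGroup Y] [Module 𝕜 Y] {Z : Type*} [AddCommGroup Z] [Module 𝕜 Z]
  {t : Prop} {T : Tower 𝕜 X} {T₁ : Tower 𝕜 Y} {T₂ : Tower 𝕜 Z}

/-- A continuous map on an open set that is homogeneous in the second variable extends to all
second arguments. -/
theorem exists_homogeneous_ext {L M N : Type*} [NormedAddCommGroup L] [NormedAddCommGroup M]
    [NormedSpace 𝕜 M] [NormedAddCommGroup N] [NormedSpace 𝕜 N]
    {O : Set (L × M)} (hO : IsOpen O) {g : L × M → N} (hg : ContinuousOn g O)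
    (hom : ∀ (s : 𝕜) a b, (a, b) ∈ O → (a, s • b) ∈ O → g (a, s • b) = s • g (a, b)) :
    ∃ G : L × M → N, ContinuousOn G ({a | (a, (0 : M)) ∈ O} ×ˢ univ) ∧
      (∀ (s : 𝕜) a b, s ≠ 0 → (a, s • b) ∈ O → G (a, b) = s⁻¹ • g (a, s • b)) ∧
      ∀ a b, (a, (0 : M)) ∈ O → ∃ s : 𝕜, s ≠ 0 ∧ (a, s • b) ∈ O := by
  classical
  -- Scale the second argument into `O`, apply `g`, and scale back. Homogeneity makes the value
  -- independent of the scalar, so near each point one fixed scalar may be used, which gives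
  -- continuity.
  let G : L × M → N := fun p =>
    if h : ∃ s : 𝕜, s ≠ 0 ∧ (p.1, s • p.2) ∈ O then h.choose⁻¹ • g (p.1, h.choose • p.2) else 0
  have hG : ∀ (s : 𝕜) a b, s ≠ 0 → (a, s • b) ∈ O → G (a, b) = s⁻¹ • g (a, s • b) := by
    intro s a b hs h
    have hex : ∃ s : 𝕜, s ≠ 0 ∧ (a, s • b) ∈ O := ⟨s, hs, h⟩
    have h1 : G (a, b) = hex.choose⁻¹ • g (a, hex.choose • b) := dif_pos hex
    obtain ⟨h2, h3⟩ := hex.choose_spec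
    generalize hex.choose = r at h1 h2 h3
    have h4 : r • b = (r * s⁻¹) • (s • b) := by rw [smul_smul, inv_mul_cancel_right₀ hs]
    rw [h1, h4, hom _ _ _ h (h4 ▸ h3), smul_smul, inv_mul_cancel_left₀ h2]
  have hex : ∀ a b, (a, (0 : M)) ∈ O → ∃ s : 𝕜, s ≠ 0 ∧ (a, s • b) ∈ O := by
    intro a b h
    have hc : Continuous fun s : 𝕜 => (a, s • b) := by fun_prop
    have h1 : ∀ᶠ s in 𝓝 (0 : 𝕜), (a, s • b) ∈ O :=
      hc.continuousAt.eventually_mem (hO.mem_nhds (by simpa using h))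
    have h2 : ∀ᶠ s in 𝓝[≠] (0 : 𝕜), (a, s • b) ∈ O := h1.filter_mono nhdsWithin_le_nhds
    obtain ⟨s, hs, hs'⟩ := (h2.and self_mem_nhdsWithin).exists
    exact ⟨s, hs', hs⟩
  refine ⟨G, ?_, hG, hex⟩
  rintro ⟨a, b⟩ ⟨ha, -⟩
  obtain ⟨s, hs, h⟩ := hex a b ha
  refine ContinuousAt.continuousWithinAt ?_
  have hc : Continuous fun p : L × M => (p.1, s • p.2) := by fun_prop
  have h1 : ∀ᶠ p : L × M in 𝓝 (a, b), (p.1, s • p.2) ∈ O :=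
    hc.continuousAt.eventually_mem (hO.mem_nhds h)
  have h2 : ContinuousAt (fun p : L × M => s⁻¹ • g (p.1, s • p.2)) (a, b) :=
    ContinuousAt.const_smul (ContinuousAt.comp (f := fun p : L × M => (p.1, s • p.2))
      (hg.continuousAt (hO.mem_nhds h)) hc.continuousAt) _
  exact h2.congr (h1.mono fun p hp => (hG s p.1 p.2 hs hp).symm)

/-- The extension of a family of linear maps to a constant tower may be taken in product form. -/
theorem HasExt.exists_product {κ : X → Y →ₗ[𝕜] Z} {x₀ : X} {k m n j : ℕ} {ε : ℝ} (hε : 0 < ε)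
    (hmn : m ≤ n)
    (h : HasExt t (T.prod (T₁.const k)) T₂ (fun p : X × Y => κ p.1 p.2) (x₀, 0) m ε j n) :
    (∃ (W : Set (T.level n)) (G : T.level n × T₁.level k → T₂.level j), IsOpen W ∧
      ContinuousOn G (W ×ˢ univ) ∧ ∀ y, ‖T.π m (y - x₀)‖ < ε → T.π n y ∈ W ∧
        ∀ u, G (T.π n y, T₁.π k u) = T₂.π j (κ y u)) ∧
    (t → ∀ R : ℝ, ∃ B, ∀ y, ‖T.π m (y - x₀)‖ < ε → ∀ u, ‖T₁.π k u‖ ≤ R →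
      ‖T₂.π j (κ y u)‖ ≤ B * (1 + ‖T.π n y‖)) := by
  obtain ⟨⟨U, g, hU, hg, hgf⟩, hB⟩ := h
  have hnorm : ∀ y u, ‖T.π m (y - x₀)‖ < ε → ‖T₁.π k u‖ < ε →
      ‖(T.prod (T₁.const k)).π m ((y, u) - (x₀, 0))‖ < ε := fun y u h1 h2 => by
    refine max_lt h1 ?_
    change ‖T₁.π k (u - 0)‖ < ε
    rwa [sub_zero]
  have hgf' : ∀ y u, ‖T.π m (y - x₀)‖ < ε → ‖T₁.π k u‖ < ε →
      (T.π n y, T₁.π k u) ∈ U ∧ g (T.π n y, T₁.π k u) = T₂.π j (κ y u) := fun y u h1 h2 =>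
    hgf (y, u) (hnorm y u h1 h2)
  constructor
  · let g' : T.level n × T₁.level k → T₂.level j := g
    -- `U` is cut down so that a point of `X × Y` lying in `O` also lies in the balls where `g` is
    -- known to represent `κ`. Only then does density yield homogeneity of `g` on `O`.
    let O : Set (T.level n × T₁.level k) :=
      U ∩ ({p | ‖T.incl hmn p.1 - T.π m x₀‖ < ε} ∩ {p | ‖p.2‖ < ε})
    have hO : IsOpen O := by
      refine IsOpen.inter hU (IsOpen.inter ?_ ?_)
      · exact isOpen_lt (by fun_prop) continuous_const
      · exact isOpen_lt (by fun_prop) continuous_const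
    have hgO : ContinuousOn g' O := hg.mono inter_subset_left
    have hOb : ∀ y u, (T.π n y, T₁.π k u) ∈ O → ‖T.π m (y - x₀)‖ < ε ∧ ‖T₁.π k u‖ < ε := by
      rintro y u ⟨-, h1, h2⟩
      rw [mem_ofPred_eq, T.incl_π, ← map_sub] at h1
      exact ⟨h1, h2⟩
    have hOmem : ∀ y u, ‖T.π m (y - x₀)‖ < ε → ‖T₁.π k u‖ < ε → (T.π n y, T₁.π k u) ∈ O := by
      intro y u h1 h2
      refine ⟨(hgf' y u h1 h2).1, ?_, h2⟩
      rwa [mem_ofPred_eq, T.incl_π, ← map_sub]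
    have hOval : ∀ y u, (T.π n y, T₁.π k u) ∈ O → g' (T.π n y, T₁.π k u) = T₂.π j (κ y u) :=
      fun y u h => (hgf' y u (hOb y u h).1 (hOb y u h).2).2
    have hdense : DenseRange fun p : X × Y => (T.π n p.1, T₁.π k p.2) :=
      (T.denseRange_π n).prodMap (T₁.denseRange_π k)
    have hom : ∀ (s : 𝕜) a b, (a, b) ∈ O → (a, s • b) ∈ O → g' (a, s • b) = s • g' (a, b) := by
      intro s a b h1 h2
      have hc : Continuous fun p : T.level n × T₁.level k => (p.1, s • p.2) := by fun_prop
      refine eqOn_of_denseRange hdense (hO.inter (hO.preimage hc))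
        (f := fun p => g' (p.1, s • p.2)) (g := fun p => s • g' p)
        (hgO.comp hc.continuousOn fun p hp => hp.2)
        ((hgO.mono inter_subset_left).const_smul s) ?_ (x := (a, b)) ⟨h1, h2⟩
      rintro ⟨y, u⟩ ⟨h3, h4⟩
      have h5 : (T.π n y, s • T₁.π k u) ∈ O := h4
      change g' (T.π n y, s • T₁.π k u) = s • g' (T.π n y, T₁.π k u)
      rw [hOval y u h3]
      rw [← map_smul] at h5 ⊢
      rw [hOval y _ h5, map_smul, map_smul]
    obtain ⟨G, hGc, hG, hex⟩ := exists_homogeneous_ext hO hgO hom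
    refine ⟨{a | (a, (0 : T₁.level k)) ∈ O}, G, hO.preimage (by fun_prop), hGc, fun y hy => ?_⟩
    have h0 : (T.π n y, (0 : T₁.level k)) ∈ O := by
      have := hOmem y 0 hy (by simpa using hε)
      rwa [map_zero] at this
    refine ⟨h0, fun u => ?_⟩
    obtain ⟨s, hs, h1⟩ := hex (T.π n y) (T₁.π k u) h0
    rw [hG s _ _ hs h1]
    rw [← map_smul] at h1 ⊢
    rw [hOval _ _ h1, map_smul, map_smul, inv_smul_smul₀ hs]
  · intro ht R
    obtain ⟨B, hB⟩ := hB ht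
    have hB' : ∀ y u, ‖T.π m (y - x₀)‖ < ε → ‖T₁.π k u‖ < ε →
        ‖T₂.π j (κ y u)‖ ≤ |B| * (1 + ε) * (1 + ‖T.π n y‖) := by
      intro y u h1 h2
      have h3 : ‖T₂.π j (κ y u)‖ ≤ B * (1 + max ‖T.π n y‖ ‖T₁.π k u‖) :=
        hB (y, u) (hnorm y u h1 h2)
      have h4 : max ‖T.π n y‖ ‖T₁.π k u‖ ≤ ‖T.π n y‖ + ε :=
        max_le (by linarith) (by linarith [norm_nonneg (T.π n y)])
      have h5 : 1 + max ‖T.π n y‖ ‖T₁.π k u‖ ≤ (1 + ε) * (1 + ‖T.π n y‖) := by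
        nlinarith [norm_nonneg (T.π n y)]
      have h6 : 0 ≤ 1 + max ‖T.π n y‖ ‖T₁.π k u‖ := by positivity
      calc _ ≤ _ := h3
        _ ≤ |B| * ((1 + ε) * (1 + ‖T.π n y‖)) :=
          mul_le_mul (le_abs_self B) h5 h6 (abs_nonneg B)
        _ = _ := by ring
    -- This factor scales fibre vectors of norm at most `R` into the `ε`-ball where the estimate is
    -- available; linearity undoes the scaling.
    set s : ℝ := ε / (2 * (|R| + 1)) with hs
    have hs0 : 0 < s := by positivity
    have hsn : ‖(s : 𝕜)‖ = s := by simp [abs_of_pos hs0]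
    refine ⟨s⁻¹ * (|B| * (1 + ε)), fun y hy u hu => ?_⟩
    have h1 : ‖T₁.π k ((s : 𝕜) • u)‖ < ε := by
      rw [map_smul, norm_smul, hsn]
      have h2 : ‖T₁.π k u‖ < 2 * (|R| + 1) := by
        linarith [le_abs_self R, abs_nonneg R]
      calc s * ‖T₁.π k u‖ < s * (2 * (|R| + 1)) := mul_lt_mul_of_pos_left h2 hs0
        _ = ε := by rw [hs]; field_simp
    have h2 := hB' y _ hy h1
    rw [map_smul, map_smul, norm_smul, hsn] at h2
    rw [mul_assoc, ← div_eq_inv_mul, le_div_iff₀ hs0, mul_comm]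
    exact h2

end Tower

/-! ### Strongly smoothing families correspond to the germ condition `SmoothingAt` -/

section Families

variable {𝕜 : Type*} [RCLike 𝕜]
variable {E : Type u} [AddCommGroup E] [Module 𝕜 E] [TopologicalSpace E]
variable {E₁ : Type v} [AddCommGroup E₁] [Module 𝕜 E₁] [TopologicalSpace E₁]
variable {E₂ : Type w} [AddCommGroup E₂] [Module 𝕜 E₂] [TopologicalSpace E₂]

namespace ScStructure

variable {S : ScStructure 𝕜 E} {S₁ : ScStructure 𝕜 E₁} {S₂ : ScStructure 𝕜 E₂}
  {κ : E → E₁ →ₗ[𝕜] E₂} {V : Set E} {W : ∀ j, Set (S.chain.level j)}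
  {G : ∀ j, S.chain.level j × S₁.chain.level 0 → S₂.chain.level j}

theorem eqOn_prod_of_dense {i l : ℕ} {N : Type*} [TopologicalSpace N] [T2Space N]
    (hW : IsOpen (W i)) {f g : S.chain.level i × S₁.chain.level l → N}
    (hf : ContinuousOn f (W i ×ˢ univ)) (hg : ContinuousOn g (W i ×ˢ univ))
    (h : ∀ y u, S.tower.π i y ∈ W i →
      f (S.tower.π i y, S₁.tower.π l u) = g (S.tower.π i y, S₁.tower.π l u)) :
    EqOn f g (W i ×ˢ univ) :=
  eqOn_of_denseRange ((S.tower.denseRange_π i).prodMap (S₁.tower.denseRange_π l))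
    (hW.prod isOpen_univ) hf hg fun y hy => h y.1 y.2 hy.1

theorem setEnvelope_incl_mem (hW : S.chain.IsSetEnvelope W (S.φ ⁻¹' V)) {m n : ℕ} (h : m ≤ n)
    {z : S.chain.level n} (hz : z ∈ W n) : S.chain.incl h z ∈ W m := by
  induction n, h using Nat.le_induction with
  | base => rwa [S.chain.incl_self]
  | succ n hn ih =>
    rw [S.chain.incl_succ hn]
    exact ih (hW.2.1 n hz)

theorem continuousOn_comp_incl (hG : ∀ j, ContinuousOn (G j) (W j ×ˢ univ)) (i l : ℕ) :
    ContinuousOn (fun p : S.chain.level i × S₁.chain.level l =>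
      G i (p.1, S₁.chain.incl (Nat.zero_le l) p.2)) (W i ×ˢ univ) :=
  (hG i).comp (continuous_fst.prodMk
    ((S₁.chain.incl (Nat.zero_le l)).continuous.comp continuous_snd)).continuousOn
    fun _ hp => ⟨hp.1, mem_univ _⟩

/-- Both sides agree on the dense subspace. With both indices raised this is the compatibility of an
envelope; with only the first raised it is the relation between `K` and its lift `g`. -/
theorem apply_incl_eq (hW : S.chain.IsSetEnvelope W (S.φ ⁻¹' V))
    (hG : ∀ j, ContinuousOn (G j) (W j ×ˢ univ))
    (hGκ : ∀ j y, S.tower.π j y ∈ W j →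
      ∀ u, G j (S.tower.π j y, S₁.tower.π 0 u) = S₂.tower.π j (κ y u))
    {i i' l l' : ℕ} (hi : i ≤ i') (hl : l ≤ l') {x : S.chain.level i'} (hx : x ∈ W i')
    (u : S₁.chain.level l') :
    G i (S.chain.incl hi x, S₁.chain.incl (Nat.zero_le l) (S₁.chain.incl hl u)) =
      S₂.chain.incl hi (G i' (x, S₁.chain.incl (Nat.zero_le l') u)) := by
  refine eqOn_prod_of_dense (S₁ := S₁) (l := l') (hW.1 i')
    (f := fun p => G i (S.chain.incl hi p.1,
      S₁.chain.incl (Nat.zero_le l) (S₁.chain.incl hl p.2)))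
    (g := fun p => S₂.chain.incl hi (G i' (p.1, S₁.chain.incl (Nat.zero_le l') p.2)))
    ?_ ((S₂.chain.incl hi).continuous.comp_continuousOn (continuousOn_comp_incl hG i' l'))
    (fun y u hy => ?_) (x := (x, u)) ⟨hx, mem_univ _⟩
  · refine (continuousOn_comp_incl hG i l).comp (((S.chain.incl hi).continuous.comp
      continuous_fst).prodMk ((S₁.chain.incl hl).continuous.comp continuous_snd)).continuousOn ?_
    exact fun p hp => ⟨setEnvelope_incl_mem hW hi hp.1, mem_univ _⟩
  · have h1 : S.chain.incl hi (S.tower.π i' y) = S.tower.π i y := S.tower.incl_π hi y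
    have h2 : S₁.chain.incl (Nat.zero_le l) (S₁.chain.incl hl (S₁.tower.π l' u)) =
        S₁.tower.π 0 u :=
      (S₁.chain.incl_incl _ _ _).trans (S₁.tower.incl_π _ _)
    have h3 : S₁.chain.incl (Nat.zero_le l') (S₁.tower.π l' u) = S₁.tower.π 0 u :=
      S₁.tower.incl_π _ _
    have h4 : S.tower.π i y ∈ W i := h1 ▸ setEnvelope_incl_mem hW hi hy
    have h5 : S₂.chain.incl hi (S₂.tower.π i' (κ y u)) = S₂.tower.π i (κ y u) :=
      S₂.tower.incl_π _ _
    refine (congrArg (G i) (Prod.ext h1 h2)).trans ((hGκ i y h4 u).trans (h5.symm.trans ?_))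
    exact congrArg (S₂.chain.incl hi)
      ((hGκ i' y hy u).symm.trans (congrArg (G i') (Prod.ext rfl h3.symm)))

/-- Since `G` needs only level zero of the fibre, precomposing `G (k j)` with the inclusion from
fibre level `j` yields the lift for every rescaling `k` at once. -/
theorem isFamilyEnvelope_of_dense (hW : S.chain.IsSetEnvelope W (S.φ ⁻¹' V))
    (hG : ∀ j, ContinuousOn (G j) (W j ×ˢ univ))
    (hGκ : ∀ j y, S.tower.π j y ∈ W j →
      ∀ u, G j (S.tower.π j y, S₁.tower.π 0 u) = S₂.tower.π j (κ y u))
    (k : ℕ → ℕ) (hk : StrictMono k) :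
    S.chain.IsFamilyEnvelope S₁.chain S₂.chain W (S.φ ⁻¹' V) k hk
      (fun j x u => G (k j) (x, S₁.chain.incl (Nat.zero_le j) u))
      (fun y u => S₂.φ.symm (κ (S.φ y) (S₁.φ u))) := by
  refine ⟨hW, fun j => continuousOn_comp_incl hG (k j) j, fun j x hx u => ?_, fun x hx u j => ?_⟩
  · rw [← S₁.chain.incl_le_succ]
    exact apply_incl_eq hW hG hGκ _ j.le_succ hx u
  · have h1 := hGκ (k j) (S.φ x)
    rw [tower_π_φ] at h1
    have h2 := h1 ((hW.2.2 x).1 hx (k j)) (S₁.φ u)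
    rw [tower_π_φ] at h2
    exact (congrArg (fun z => G (k j) (x.1 (k j), z)) (S₁.chain.incl_infty _ u)).trans h2

theorem familyTameEstimate_of_dense (hW : S.chain.IsSetEnvelope W (S.φ ⁻¹' V))
    (hG : ∀ j, ContinuousOn (G j) (W j ×ˢ univ))
    (hGκ : ∀ j y, S.tower.π j y ∈ W j →
      ∀ u, G j (S.tower.π j y, S₁.tower.π 0 u) = S₂.tower.π j (κ y u))
    (hB : ∀ (j : ℕ) (R : ℝ), ∃ B, ∀ y, S.tower.π j y ∈ W j → ∀ u, ‖S₁.tower.π 0 u‖ ≤ R →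
      ‖S₂.tower.π j (κ y u)‖ ≤ B * (1 + ‖S.tower.π j y‖)) (k : ℕ → ℕ) :
    S.chain.FamilyTameEstimate S₁.chain S₂.chain W k
      (fun j x u => G (k j) (x, S₁.chain.incl (Nat.zero_le j) u)) := by
  intro j R
  -- The open ball of radius `R + 1` contains the closed one of radius `R`; the density argument
  -- needs an open set.
  obtain ⟨B, hB⟩ := hB (k j) (R + 1)
  refine ⟨|B|, fun x hx u hu => ?_⟩
  have hd : DenseRange (Prod.map (S.tower.π (k j)) (S₁.tower.π 0)) :=
    (S.tower.denseRange_π (k j)).prodMap (S₁.tower.denseRange_π 0)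
  have hO : IsOpen (W (k j) ×ˢ {w : S₁.chain.level 0 | ‖w‖ < R + 1}) :=
    (hW.1 (k j)).prod (isOpen_lt continuous_norm continuous_const)
  have h1 := le_of_denseRange hd hO (f := fun p => ‖G (k j) p‖) (g := fun p => B * (1 + ‖p.1‖))
    ((hG (k j)).mono (prod_mono_right (subset_univ _))).norm
    (Continuous.continuousOn (continuous_const.mul (continuous_const.add continuous_fst.norm)))
    (fun p hp => by
      refine le_trans (le_of_eq ?_) (hB p.1 hp.1 p.2 (le_of_lt hp.2))
      exact congrArg norm (hGκ (k j) p.1 hp.1 p.2))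
    (x, S₁.chain.incl (Nat.zero_le j) u) ⟨hx, lt_of_le_of_lt hu (by linarith)⟩
  refine h1.trans (mul_le_mul (le_abs_self B) ?_ (by positivity) (abs_nonneg B))
  change 1 + ‖x‖ ≤ 1 + ‖x‖ + ‖u‖
  linarith [norm_nonneg u]

end ScStructure

variable [ScFrechet 𝕜 E] [ScFrechet 𝕜 E₁] [ScFrechet 𝕜 E₂]

/-- The family `κ` has a (tame, if `t` holds) strongly smoothing envelope over `V`. -/
def HasSmoothingEnvelope (t : Prop) (κ : E → E₁ →ₗ[𝕜] E₂) (V : Set E) : Prop :=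
  ∃ (S : ScStructure 𝕜 E) (S₁ : ScStructure 𝕜 E₁) (S₂ : ScStructure 𝕜 E₂),
    S.CompatibleOf t ∧ S₁.CompatibleOf t ∧ S₂.CompatibleOf t ∧ ∃ W K,
      (S.chain.IsFamilyEnvelope S₁.chain S₂.chain W (S.φ ⁻¹' V) id strictMono_id K
        (fun y u => S₂.φ.symm (κ (S.φ y) (S₁.φ u))) ∧
      (t → S.chain.FamilyTameEstimate S₁.chain S₂.chain W id K)) ∧
      ∀ (k : ℕ → ℕ) (hk : StrictMono k), (t → IsTameSeq k) →
        ∃ g : ∀ j, S.chain.level (k j) → S₁.chain.level j → S₂.chain.level (k j),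
          S.chain.IsFamilyEnvelope S₁.chain S₂.chain W (S.φ ⁻¹' V) k hk g
            (fun y u => S₂.φ.symm (κ (S.φ y) (S₁.φ u))) ∧
          (t → S.chain.FamilyTameEstimate S₁.chain S₂.chain W k g) ∧
          ∀ j, ∀ x ∈ W (k j), ∀ u : S₁.chain.level j,
            K j (S.chain.incl (hk.le_apply) x) u = S₂.chain.incl (hk.le_apply) (g j x u)

/-- The family `κ` extends near `x₀` to a family of maps on a fixed level of the fibre. -/
def SmoothingAt (t : Prop) (κ : E → E₁ →ₗ[𝕜] E₂) (x₀ : E) : Prop :=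
  ∃ m, Sc0At t ((ScFrechet.tower 𝕜 E).prod ((ScFrechet.tower 𝕜 E₁).const m))
    (ScFrechet.tower 𝕜 E₂) (fun p : E × E₁ => κ p.1 p.2) (x₀, 0)

/-- For a target level `j` use the rescaling `i ↦ j + i`, which is tame. Its lift at index `0` maps
`E_j × E¹_0` to `E²_j`, so fibre level zero suffices for every `j`. In the distinguished structure
it becomes some other fixed fibre level. -/
theorem HasSmoothingEnvelope.smoothingAt {t : Prop} {κ : E → E₁ →ₗ[𝕜] E₂} {V : Set E}
    (h : HasSmoothingEnvelope t κ V) (hV : IsOpen V) {x : E} (hx : x ∈ V) : SmoothingAt t κ x := by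
  obtain ⟨S, S₁, S₂, hS, hS₁, hS₂, W, K, -, h⟩ := h
  obtain ⟨m, ε, hε, hball⟩ := S.mem_nhds_iff.1 (hV.mem_nhds hx)
  have h1 : Sc0At t (S.tower.prod (S₁.tower.const 0)) S₂.tower
      (fun p : E × E₁ => κ p.1 p.2) (x, 0) := by
    refine Sc0At.of_hasExt (m := m) hε 0 fun j => ⟨j, fun _ => le_rfl, ?_⟩
    have hk : StrictMono fun i => j + i := fun a b hab => by simpa using hab
    obtain ⟨g, ⟨hW, hgc, -, hgκ⟩, hB, -⟩ := h (fun i => j + i) hk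
      fun _ => ⟨hk, j, fun i => (add_comm j i).le⟩
    have key : ∀ p : E × E₁, ‖(S.tower.prod (S₁.tower.const 0)).π m (p - (x, 0))‖ < ε →
        S.tower.π j p.1 ∈ W j ∧
          g 0 (S.tower.π j p.1) (S₁.tower.π 0 p.2) = S₂.tower.π j (κ p.1 p.2) := by
      intro p hp
      have hp1 : p.1 ∈ V := hball p.1 ((le_max_left _ _).trans_lt hp)
      have hp' : S.φ.symm p.1 ∈ S.φ ⁻¹' V := by
        rw [mem_preimage, S.φ.apply_symm_apply]
        exact hp1
      refine ⟨(hW.2.2 _).1 hp' j, (hgκ _ hp' (S₁.φ.symm p.2) 0).trans ?_⟩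
      have h1 := S.φ.apply_symm_apply p.1
      have h2 := S₁.φ.apply_symm_apply p.2
      have h3 : κ (S.φ (S.φ.symm p.1)) (S₁.φ (S₁.φ.symm p.2)) = κ p.1 p.2 := by rw [h1, h2]
      exact congrArg (S₂.tower.π j) h3
    refine ⟨⟨W j ×ˢ univ, fun p => g 0 p.1 p.2, (hW.1 j).prod isOpen_univ, hgc 0,
      fun p hp => ⟨⟨(key p hp).1, mem_univ _⟩, (key p hp).2⟩⟩, fun ht => ?_⟩
    obtain ⟨c, hc⟩ := hB ht 0 ε
    -- The factor `2` bounds the sum of the two norms by their maximum, the norm of the product.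
    refine ⟨|c| * 2, fun p hp => ?_⟩
    have hp2 : ‖S₁.tower.π 0 p.2‖ ≤ ε := by
      have h1 : ‖S₁.tower.π 0 (p.2 - 0)‖ ≤
          ‖(S.tower.prod (S₁.tower.const 0)).π m (p - (x, 0))‖ := le_max_right _ _
      rw [sub_zero] at h1
      exact h1.trans hp.le
    have h1 := hc (S.tower.π j p.1) (key p hp).1 (S₁.tower.π 0 p.2)
      ((congrArg norm (S₁.chain.incl_self 0 _)).le.trans hp2)
    rw [← (key p hp).2]
    refine h1.trans ?_
    have h2 : ‖S.tower.π j p.1‖ ≤ ‖(S.tower.prod (S₁.tower.const 0)).π j p‖ := le_max_left _ _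
    have h3 : ‖S₁.tower.π 0 p.2‖ ≤ ‖(S.tower.prod (S₁.tower.const 0)).π j p‖ := le_max_right _ _
    have h4 : 0 ≤ ‖S.tower.π j p.1‖ + ‖S₁.tower.π 0 p.2‖ := by positivity
    rw [mul_assoc]
    refine mul_le_mul (le_abs_self c) ?_ ?_ (abs_nonneg c)
    · change 1 + ‖S.tower.π j p.1‖ + ‖S₁.tower.π 0 p.2‖ ≤ _
      linarith
    · change 0 ≤ 1 + ‖S.tower.π j p.1‖ + ‖S₁.tower.π 0 p.2‖
      linarith
  obtain ⟨c₁, hc₁⟩ := hS₁.exists_clm_to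
  obtain ⟨m', -, A', hA'⟩ := hc₁ 0
  obtain ⟨c, hc⟩ := hS.exists_clm_to
  refine ⟨m', Sc0At.comp (g := id) hS₂.sc0At_from (Sc0At.comp (f := id) h1 (Sc0At.of_clm c ?_))⟩
  intro j
  obtain ⟨n, hn, A, hA⟩ := hc j
  exact ⟨n, hn, A.prodMap A', fun p => Prod.ext (hA p.1) (hA' p.2)⟩

/-- Shifting the fibre structure by `l` turns the fixed level `l` into level zero. The product form
of the extensions, restricted to an envelope of a ball, then supplies `K` and all its lifts. -/
theorem SmoothingAt.exists_hasSmoothingEnvelope {t : Prop} {κ : E → E₁ →ₗ[𝕜] E₂} {x : E}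
    (h : SmoothingAt t κ x) {U : Set E} (hU : U ∈ 𝓝 x) :
    ∃ V, IsOpen V ∧ x ∈ V ∧ V ⊆ U ∧ HasSmoothingEnvelope t κ V := by
  set S₀ : ScStructure 𝕜 E := ScFrechet.str
  set S₁ : ScStructure 𝕜 E₁ := ScFrechet.str
  set S₂ : ScStructure 𝕜 E₂ := ScFrechet.str
  obtain ⟨l, h⟩ := h
  obtain ⟨m₁, ε₁, hε₁, hball₁⟩ := S₀.mem_nhds_iff.1 hU
  obtain ⟨m, ε, hε, hm, hle, c, h⟩ := h.shrink m₁ hε₁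
  choose n hmn hn he using h
  obtain ⟨N, hN, hnN, hNc⟩ := exists_strictMono_ge n c fun ht j => hn j ht
  have hmN : ∀ j, m ≤ N j := fun j => (hmn j).trans (hnN j)
  have hext := fun j => ((he j).mono le_rfl (hnN j) le_rfl).exists_product hε (hmN j)
  choose O hO using fun j => (hext j).1
  choose G hOo hG hGκ using hO
  obtain ⟨W, hW, hWO, hWb⟩ := S₀.exists_setEnvelope hN hmN x ε O hOo
    fun j y hy => (hGκ j y hy).1
  have hl : StrictMono fun i => l + i := fun a b hab => by simpa using hab
  have hG' : ∀ j, ContinuousOn (G j) (W j ×ˢ univ) := fun j => (hG j).mono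
    (prod_mono_left (hWO j))
  have hGκ' : ∀ j y, (S₀.rescale N hN).tower.π j y ∈ W j → ∀ u,
      G j ((S₀.rescale N hN).tower.π j y, (S₁.rescale _ hl).tower.π 0 u) =
        (S₂.rescale id strictMono_id).tower.π j (κ y u) := fun j y hy u =>
    (hGκ j y (hWb j y hy)).2 u
  have hB : t → ∀ (j : ℕ) (R : ℝ), ∃ B, ∀ y, (S₀.rescale N hN).tower.π j y ∈ W j →
      ∀ u, ‖(S₁.rescale _ hl).tower.π 0 u‖ ≤ R →
      ‖(S₂.rescale id strictMono_id).tower.π j (κ y u)‖ ≤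
        B * (1 + ‖(S₀.rescale N hN).tower.π j y‖) := by
    intro ht j R
    obtain ⟨B, hB⟩ := (hext j).2 ht R
    exact ⟨B, fun y hy => hB y (hWb j y hy)⟩
  refine ⟨{y | ‖S₀.tower.π m (y - x)‖ < ε}, S₀.isOpen_ball _ _ _, by simpa using hε,
    fun y hy => hball₁ y ((S₀.tower.norm_π_mono hm _).trans_lt (lt_of_lt_of_le hy hle)),
    S₀.rescale N hN, S₁.rescale _ hl, S₂.rescale id strictMono_id,
    ScStructure.compatibleOf_rescale hN fun ht => ⟨c, hNc ht⟩,
    ScStructure.compatibleOf_rescale hl fun _ => ⟨l, fun i => (add_comm l i).le⟩,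
    ScStructure.compatibleOf_rescale strictMono_id fun _ => ⟨0, fun _ => le_rfl⟩, W, _,
    ⟨ScStructure.isFamilyEnvelope_of_dense (S₂ := S₂.rescale id strictMono_id) hW hG' hGκ' id strictMono_id,
      fun ht => ScStructure.familyTameEstimate_of_dense (S₂ := S₂.rescale id strictMono_id) hW hG' hGκ' (hB ht) id⟩,
    fun k hk _ => ⟨_, ScStructure.isFamilyEnvelope_of_dense (S₂ := S₂.rescale id strictMono_id) hW hG' hGκ' k hk,
      fun ht => ScStructure.familyTameEstimate_of_dense (S₂ := S₂.rescale id strictMono_id) hW hG' hGκ' (hB ht) k, ?_⟩⟩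
  intro j z hz u
  have h1 := ScStructure.apply_incl_eq (S₂ := S₂.rescale id strictMono_id) hW hG' hGκ' (hk.le_apply (x := j)) (le_refl j) hz u
  rw [ScChain.incl_self] at h1
  exact h1

/-- Strongly smoothing families are families of morphisms. -/
theorem SmoothingAt.sc0At {t : Prop} {κ : E → E₁ →ₗ[𝕜] E₂} {x : E} (h : SmoothingAt t κ x)
    (u : E₁) : Sc0At t ((ScFrechet.tower 𝕜 E).prod (ScFrechet.tower 𝕜 E₁))
      (ScFrechet.tower 𝕜 E₂) (fun p : E × E₁ => κ p.1 p.2) (x, u) := by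
  obtain ⟨l, m, ε, hε, c, h⟩ := h
  refine Sc0At.of_hasExt (m := m + l) hε (c + l) fun j => ?_
  obtain ⟨n, hmn, hn, he⟩ := h j
  obtain ⟨⟨W, G, hW, hG, hGκ⟩, hB⟩ := he.exists_product hε hmn
  have key : ∀ p : E × E₁,
      ‖((ScFrechet.tower 𝕜 E).prod (ScFrechet.tower 𝕜 E₁)).π (m + l) (p - (x, u))‖ < ε →
      ‖(ScFrechet.tower 𝕜 E).π m (p.1 - x)‖ < ε ∧ ‖(ScFrechet.tower 𝕜 E₁).π l (p.2 - u)‖ < ε := by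
    intro p hp
    have h1 := (le_max_left _ _).trans_lt hp
    have h2 := (le_max_right _ _).trans_lt hp
    exact ⟨(norm_π_mono _ (by omega) _).trans_lt h1, (norm_π_mono _ (by omega) _).trans_lt h2⟩
  let A : (ScFrechet.tower 𝕜 E).level (n + l) × (ScFrechet.tower 𝕜 E₁).level (n + l) →L[𝕜]
      (ScFrechet.tower 𝕜 E).level n × (ScFrechet.tower 𝕜 E₁).level l :=
    ((ScFrechet.tower 𝕜 E).incl (by omega)).prodMap ((ScFrechet.tower 𝕜 E₁).incl (by omega))
  have hA : ∀ p : E × E₁, A ((ScFrechet.tower 𝕜 E).π (n + l) p.1,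
      (ScFrechet.tower 𝕜 E₁).π (n + l) p.2) =
      ((ScFrechet.tower 𝕜 E).π n p.1, (ScFrechet.tower 𝕜 E₁).π l p.2) := fun p =>
    Prod.ext (incl_π _ _ _) (incl_π _ _ _)
  refine ⟨n + l, fun ht => by have := hn ht; omega, ⟨A ⁻¹' (W ×ˢ univ), fun p => G (A p),
    (hW.prod isOpen_univ).preimage A.continuous,
    hG.comp A.continuous.continuousOn (mapsTo_preimage _ _), fun p hp => ?_⟩, fun ht => ?_⟩
  · obtain ⟨h1, h2⟩ := hGκ p.1 (key p hp).1
    refine ⟨?_, (congrArg G (hA p)).trans (h2 p.2)⟩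
    exact (congrArg (· ∈ W ×ˢ (univ : Set ((ScFrechet.tower 𝕜 E₁).level l))) (hA p)).mpr
      ⟨h1, mem_univ _⟩
  -- The triangle inequality bounds the level-`l` norm of all fibre vectors in the ball around `u`
  -- by this radius.
  · obtain ⟨B, hB⟩ := hB ht (‖(ScFrechet.tower 𝕜 E₁).π l u‖ + ε)
    refine ⟨|B|, fun p hp => ?_⟩
    obtain ⟨h1, h2⟩ := key p hp
    have h3 : ‖(ScFrechet.tower 𝕜 E₁).π l p.2‖ ≤ ‖(ScFrechet.tower 𝕜 E₁).π l u‖ + ε := by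
      rw [map_sub] at h2
      have := norm_le_norm_add_norm_sub ((ScFrechet.tower 𝕜 E₁).π l u)
        ((ScFrechet.tower 𝕜 E₁).π l p.2)
      rw [norm_sub_rev] at this
      linarith
    refine (hB p.1 h1 p.2 h3).trans ?_
    have h4 : ‖(ScFrechet.tower 𝕜 E).π n p.1‖ ≤
        ‖((ScFrechet.tower 𝕜 E).prod (ScFrechet.tower 𝕜 E₁)).π (n + l) p‖ :=
      (norm_π_mono _ (by omega) _).trans (le_max_left _ _)
    exact mul_le_mul (le_abs_self B) (by linarith) (by positivity) (abs_nonneg B)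

theorem isFamily_iff {φ : E → E₁ →ₗ[𝕜] E₂} {U : Set E} (hU : IsOpen U) :
    IsFamily φ U ↔ Sc0OnOf 𝕜 False (fun p : E × E₁ => φ p.1 p.2) (U ×ˢ univ) :=
  sc0On_iff (hU.prod isOpen_univ)

theorem isTameFamily_iff {φ : E → E₁ →ₗ[𝕜] E₂} {U : Set E} (hU : IsOpen U) :
    IsTameFamily φ U ↔ Sc0OnOf 𝕜 True (fun p : E × E₁ => φ p.1 p.2) (U ×ˢ univ) :=
  tameOn_iff (hU.prod isOpen_univ)

theorem sc0OnOf_of_smoothingAt {t : Prop} {κ : E → E₁ →ₗ[𝕜] E₂} {U : Set E}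
    (h : ∀ x ∈ U, SmoothingAt t κ x) :
    Sc0OnOf 𝕜 t (fun p : E × E₁ => κ p.1 p.2) (U ×ˢ univ) := fun p hp =>
  sc0At_prod_iff.2 ((h p.1 hp.1).sc0At p.2)

theorem isStronglySmoothing_iff {κ : E → E₁ →ₗ[𝕜] E₂} {U : Set E} (hU : IsOpen U) :
    IsStronglySmoothing κ U ↔ ∀ x ∈ U, SmoothingAt False κ x := by
  constructor
  · rintro ⟨-, h⟩ x hx
    obtain ⟨V, hV, hxV, -, S, S₁, S₂, hS, hS₁, hS₂, W, K, hK, h⟩ := h x hx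
    refine HasSmoothingEnvelope.smoothingAt (V := V) ⟨S, S₁, S₂, ⟨hS, False.elim⟩,
      ⟨hS₁, False.elim⟩, ⟨hS₂, False.elim⟩, W, K, ⟨hK, False.elim⟩, fun k hk _ => ?_⟩ hV hxV
    obtain ⟨g, hg, hgK⟩ := h k hk
    exact ⟨g, hg, False.elim, hgK⟩
  · refine fun h => ⟨(isFamily_iff hU).2 (sc0OnOf_of_smoothingAt h), fun x hx => ?_⟩
    obtain ⟨V, hV, hxV, hVU, S, S₁, S₂, hS, hS₁, hS₂, W, K, hK, h⟩ :=
      (h x hx).exists_hasSmoothingEnvelope (hU.mem_nhds hx)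
    refine ⟨V, hV, hxV, hVU, S, S₁, S₂, hS.1, hS₁.1, hS₂.1, W, K, hK.1, fun k hk => ?_⟩
    obtain ⟨g, hg, -, hgK⟩ := h k hk False.elim
    exact ⟨g, hg, hgK⟩

theorem isTameStronglySmoothing_iff {κ : E → E₁ →ₗ[𝕜] E₂} {U : Set E} (hU : IsOpen U) :
    IsTameStronglySmoothing κ U ↔ ∀ x ∈ U, SmoothingAt True κ x := by
  constructor
  · rintro ⟨-, h⟩ x hx
    obtain ⟨V, hV, hxV, -, S, S₁, S₂, hS, hS₁, hS₂, W, K, hK, hK', h⟩ := h x hx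
    refine HasSmoothingEnvelope.smoothingAt (V := V) ⟨S, S₁, S₂,
      ScStructure.compatibleOf_true.2 hS, ScStructure.compatibleOf_true.2 hS₁,
      ScStructure.compatibleOf_true.2 hS₂, W, K, ⟨hK, fun _ => hK'⟩, fun k hk hk' => ?_⟩ hV hxV
    obtain ⟨g, hg, hg', hgK⟩ := h k (hk' trivial)
    exact ⟨g, hg, fun _ => hg', hgK⟩
  · refine fun h => ⟨(isTameFamily_iff hU).2 (sc0OnOf_of_smoothingAt h), fun x hx => ?_⟩
    obtain ⟨V, hV, hxV, hVU, S, S₁, S₂, hS, hS₁, hS₂, W, K, hK, h⟩ :=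
      (h x hx).exists_hasSmoothingEnvelope (hU.mem_nhds hx)
    refine ⟨V, hV, hxV, hVU, S, S₁, S₂, hS.2 trivial, hS₁.2 trivial, hS₂.2 trivial, W, K, hK.1,
      hK.2 trivial, fun k hk => ?_⟩
    obtain ⟨g, hg, hg', hgK⟩ := h k hk.1 fun _ => hk
    exact ⟨g, hg, hg' trivial, hgK⟩

end Families

/-! ### Weak Fréchet derivatives -/

section WeakDerivative

variable {𝕜 : Type*} [RCLike 𝕜]
variable {E : Type u} [AddCommGroup E] [Module 𝕜 E] [TopologicalSpace E]
variable {E' : Type v} [AddCommGroup E'] [Module 𝕜 E'] [TopologicalSpace E']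
variable {E'' : Type w} [AddCommGroup E''] [Module 𝕜 E''] [TopologicalSpace E'']

theorem weakRemainder_zero_left (f : E → E') (L : E →L[𝕜] E') (x : E) (s : ℝ) :
    weakRemainder 𝕜 f L x (0, s) = 0 := by
  simp [weakRemainder]

theorem apply_add_smul_eq (f : E → E') (L : E →L[𝕜] E') (x u : E) {s : ℝ} (hs : s ≠ 0) :
    f (x + (s : 𝕜) • u) = f x + (s : 𝕜) • (L u + weakRemainder 𝕜 f L x (u, s)) := by
  have hs' : (s : 𝕜) ≠ 0 := by exact_mod_cast hs
  simp [weakRemainder, hs, smul_inv_smul₀ hs']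

/-- For `s ≠ 0` the point `f (x + s u)` is `f x + s (L u + r)` with `r` the remainder of `f`. Thus
the remainder of `f'` is evaluated in the direction `L u + r`, and the chain rule is an exact
identity of remainders. -/
theorem weakRemainder_comp (f : E → E') (f' : E' → E'') (L : E →L[𝕜] E') (L' : E' →L[𝕜] E'')
    (x : E) (p : E × ℝ) :
    weakRemainder 𝕜 (f' ∘ f) (L'.comp L) x p = L' (weakRemainder 𝕜 f L x p) +
      weakRemainder 𝕜 f' L' (f x) (L p.1 + weakRemainder 𝕜 f L x p, p.2) := by
  obtain ⟨u, s⟩ := p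
  by_cases hs : s = 0
  · simp [weakRemainder, hs]
  · have h1 := apply_add_smul_eq f L x u hs
    set r := weakRemainder 𝕜 f L x (u, s)
    simp only [weakRemainder, hs, if_false, Function.comp_apply, h1,
      ContinuousLinearMap.comp_apply, map_add]
    abel

variable [ScFrechet 𝕜 E'] [ScFrechet 𝕜 E'']

theorem HasWeakFDerivAt.comp {f : E → E'} {f' : E' → E''} {L : E →L[𝕜] E'} {L' : E' →L[𝕜] E''}
    {x : E} (hf' : HasWeakFDerivAt 𝕜 f' L' (f x)) (hf : HasWeakFDerivAt 𝕜 f L x) :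
    HasWeakFDerivAt 𝕜 (f' ∘ f) (L'.comp L) x := by
  have := (ScFrechet.str (𝕜 := 𝕜) (E := E')).isTopologicalAddGroup
  have := (ScFrechet.str (𝕜 := 𝕜) (E := E'')).isTopologicalAddGroup
  obtain ⟨V, hV, hr⟩ := hf
  obtain ⟨V', hV', hr'⟩ := hf'
  have hh : ContinuousOn (fun p : E × ℝ => L p.1 + weakRemainder 𝕜 f L x p)
      (V ×ˢ Icc (0 : ℝ) 1) :=
    (L.continuous.comp continuous_fst).continuousOn.add hr
  -- The direction `L u + r (u, s)` vanishes at `u = 0` for all `s`. By compactness of `[0, 1]` one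
  -- neighbourhood of `0` maps into `V'` for all `s` simultaneously.
  have hev : ∀ᶠ u in 𝓝 (0 : E), ∀ s ∈ Icc (0 : ℝ) 1,
      (u, s) ∈ V ×ˢ Icc (0 : ℝ) 1 → L u + weakRemainder 𝕜 f L x (u, s) ∈ V' := by
    refine isCompact_Icc.eventually_forall_of_forall_eventually fun s hs => ?_
    have h1 := hh (0, s) ⟨mem_of_mem_nhds hV, hs⟩
    have h2 : V' ∈ 𝓝 (L (0 : E) + weakRemainder 𝕜 f L x ((0 : E), s)) := by
      rwa [weakRemainder_zero_left, map_zero, add_zero]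
    exact eventually_nhdsWithin_iff.1 (h1.eventually_mem h2)
  refine ⟨_, inter_mem hV hev, ?_⟩
  rw [funext (weakRemainder_comp f f' L L' x)]
  refine ContinuousOn.add ?_ ?_
  · exact L'.continuous.comp_continuousOn (hr.mono (prod_mono_left inter_subset_left))
  · refine ContinuousOn.comp (g := weakRemainder 𝕜 f' L' (f x)) hr'
      ((hh.mono (prod_mono_left inter_subset_left)).prodMk continuous_snd.continuousOn) ?_
    rintro ⟨u, s⟩ ⟨⟨huV, hu⟩, hs⟩
    exact ⟨hu s hs ⟨huV, hs⟩, hs⟩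

variable [ScFrechet 𝕜 E]

/-- For fixed small `u` the difference of the two remainders is `L₂ u - L₁ u` for `s > 0` and `0` at
`s = 0`; continuity at `0` forces equality. Scaling extends this from a neighbourhood of `0` to all
`u`. -/
theorem HasWeakFDerivAt.unique {f : E → E'} {L₁ L₂ : E →L[𝕜] E'} {x : E}
    (h₁ : HasWeakFDerivAt 𝕜 f L₁ x) (h₂ : HasWeakFDerivAt 𝕜 f L₂ x) : L₁ = L₂ := by
  have := (ScFrechet.str (𝕜 := 𝕜) (E := E')).isTopologicalAddGroup
  have := (ScFrechet.str (𝕜 := 𝕜) (E := E')).t2Space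
  have := (ScFrechet.str (𝕜 := 𝕜) (E := E)).continuousSMul
  obtain ⟨V₁, hV₁, hr₁⟩ := h₁
  obtain ⟨V₂, hV₂, hr₂⟩ := h₂
  have key : ∀ u ∈ V₁ ∩ V₂, L₁ u = L₂ u := by
    intro u hu
    have hc : ContinuousOn (fun s : ℝ => weakRemainder 𝕜 f L₁ x (u, s) -
        weakRemainder 𝕜 f L₂ x (u, s)) (Icc (0 : ℝ) 1) := by
      refine ContinuousOn.sub (hr₁.comp (by fun_prop) fun s hs => ⟨hu.1, hs⟩)
        (hr₂.comp (by fun_prop) fun s hs => ⟨hu.2, hs⟩)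
    have h0 := (hc 0 (by simp)).mono (Ioc_subset_Icc_self)
    have h1 : Tendsto (fun s : ℝ => weakRemainder 𝕜 f L₁ x (u, s) -
        weakRemainder 𝕜 f L₂ x (u, s)) (𝓝[Ioc 0 1] 0) (𝓝 (L₂ u - L₁ u)) := by
      refine tendsto_const_nhds.congr' ?_
      filter_upwards [self_mem_nhdsWithin] with s hs
      simp [weakRemainder, hs.1.ne']
    have h2 : (𝓝[Ioc (0 : ℝ) 1] 0).NeBot := by
      rw [nhdsWithin_Ioc_eq_nhdsGT one_pos]
      infer_instance
    have h3 := tendsto_nhds_unique h0 h1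
    simp only [weakRemainder, if_true, sub_zero] at h3
    exact (sub_eq_zero.1 h3.symm).symm
  ext u
  have hc : Continuous fun s : 𝕜 => s • u := by fun_prop
  have h1 : ∀ᶠ s in 𝓝 (0 : 𝕜), s • u ∈ V₁ ∩ V₂ :=
    hc.continuousAt.eventually_mem (by simpa using inter_mem hV₁ hV₂)
  have h2 : ∀ᶠ s in 𝓝[≠] (0 : 𝕜), s • u ∈ V₁ ∩ V₂ := h1.filter_mono nhdsWithin_le_nhds
  obtain ⟨s, hs, hs'⟩ := (h2.and self_mem_nhdsWithin).exists
  have h3 := key _ hs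
  rw [map_smul, map_smul] at h3
  exact smul_right_injective E' hs' h3

theorem HasWeakFDerivAt.weakDeriv_eq {f : E → E'} {L : E →L[𝕜] E'} {x : E}
    (h : HasWeakFDerivAt 𝕜 f L x) : weakDeriv 𝕜 f x = L := by
  have hex : ∃ L : E →L[𝕜] E', HasWeakFDerivAt 𝕜 f L x := ⟨L, h⟩
  rw [weakDeriv, dif_pos hex]
  exact hex.choose_spec.unique h

theorem hasWeakFDerivAt_weakDeriv {f : E → E'} {x : E}
    (h : ∃ L : E →L[𝕜] E', HasWeakFDerivAt 𝕜 f L x) :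
    HasWeakFDerivAt 𝕜 f (weakDeriv 𝕜 f x) x := by
  obtain ⟨L, hL⟩ := h
  rwa [hL.weakDeriv_eq]

theorem hasWeakFDerivAt_comp {f : E → E'} {f' : E' → E''} {x : E}
    (hf : ∃ L : E →L[𝕜] E', HasWeakFDerivAt 𝕜 f L x)
    (hf' : ∃ L : E' →L[𝕜] E'', HasWeakFDerivAt 𝕜 f' L (f x)) :
    HasWeakFDerivAt 𝕜 (f' ∘ f) ((weakDeriv 𝕜 f' (f x)).comp (weakDeriv 𝕜 f x)) x :=
  (hasWeakFDerivAt_weakDeriv hf').comp (hasWeakFDerivAt_weakDeriv hf)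

end WeakDerivative

/-! ### Compositions of families -/

section Families

universe u' v' w'

variable {𝕜 : Type*} [RCLike 𝕜] {t : Prop}
variable {E : Type u} [AddCommGroup E] [Module 𝕜 E] [TopologicalSpace E] [ScFrechet 𝕜 E]
variable {E' : Type u'} [AddCommGroup E'] [Module 𝕜 E'] [TopologicalSpace E'] [ScFrechet 𝕜 E']
variable {E₁ : Type v} [AddCommGroup E₁] [Module 𝕜 E₁] [TopologicalSpace E₁] [ScFrechet 𝕜 E₁]
variable {E₂ : Type w} [AddCommGroup E₂] [Module 𝕜 E₂] [TopologicalSpace E₂] [ScFrechet 𝕜 E₂]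
variable {E₃ : Type v'} [AddCommGroup E₃] [Module 𝕜 E₃] [TopologicalSpace E₃] [ScFrechet 𝕜 E₃]
variable {E₄ : Type w'} [AddCommGroup E₄] [Module 𝕜 E₄] [TopologicalSpace E₄] [ScFrechet 𝕜 E₄]

theorem Sc0OnOf.congr {f g : E → E'} {U : Set E} (h : Sc0OnOf 𝕜 t f U) (hU : IsOpen U)
    (hfg : EqOn f g U) : Sc0OnOf 𝕜 t g U := by
  intro x hx
  obtain ⟨m, ε, hε, hb⟩ :=
    (ScFrechet.str (𝕜 := 𝕜) (E := E)).mem_nhds_iff.1 (hU.mem_nhds hx)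
  exact (h x hx).congr hε fun y hy => hfg (hb y hy)

theorem Sc0OnOf.continuousOn {f : E → E'} {U : Set E} (h : Sc0OnOf 𝕜 t f U) : ContinuousOn f U :=
  fun x hx => (h x hx).continuousAt.continuousWithinAt

theorem Sc0OnOf.comp {f : E → E'} {g : E' → E₁} {U : Set E} {U' : Set E'}
    (hg : Sc0OnOf 𝕜 t g U') (hf : Sc0OnOf 𝕜 t f U) (h : MapsTo f U U') :
    Sc0OnOf 𝕜 t (g ∘ f) U := fun x hx => Sc0At.comp (f := f) (hg _ (h hx)) (hf x hx)

variable (t) in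
/-- The family `φ` is of class sc⁰ (and tame, if `t` holds) over `U`. -/
def IsFamilyOf (φ : E → E₁ →ₗ[𝕜] E₂) (U : Set E) : Prop :=
  ∀ x ∈ U, ∀ u, Sc0At t ((ScFrechet.tower 𝕜 E).prod (ScFrechet.tower 𝕜 E₁))
    (ScFrechet.tower 𝕜 E₂) (fun p : E × E₁ => φ p.1 p.2) (x, u)

theorem sc0OnOf_prod_iff {φ : E → E₁ →ₗ[𝕜] E₂} {U : Set E} :
    Sc0OnOf 𝕜 t (fun p : E × E₁ => φ p.1 p.2) (U ×ˢ univ) ↔ IsFamilyOf t φ U :=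
  ⟨fun h x hx u => sc0At_prod_iff.1 (h (x, u) ⟨hx, mem_univ _⟩),
    fun h p hp => sc0At_prod_iff.2 (h p.1 hp.1 p.2)⟩

/-- A (tame, if `t` holds) Fredholm family. -/
def IsFredholmFamilyOf (t : Prop) (φ : E → E₁ →ₗ[𝕜] E₂) (U : Set E) : Prop :=
  IsFamilyOf t φ U ∧ ∀ x₀ ∈ U, ∃ V, IsOpen V ∧ x₀ ∈ V ∧ V ⊆ U ∧
    ∃ (ψ : E → E₂ →ₗ[𝕜] E₁) (κ : E → E₁ →ₗ[𝕜] E₁) (κ' : E → E₂ →ₗ[𝕜] E₂),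
      IsFamilyOf t ψ V ∧ (∀ x ∈ V, SmoothingAt t κ x) ∧ (∀ x ∈ V, SmoothingAt t κ' x) ∧
      (∀ x ∈ V, ∀ u, ψ x (φ x u) = u + κ x u) ∧ ∀ x ∈ V, ∀ u, φ x (ψ x u) = u + κ' x u

theorem isFredholmFamily_iff {φ : E → E₁ →ₗ[𝕜] E₂} {U : Set E} (hU : IsOpen U) :
    IsFredholmFamily φ U ↔ IsFredholmFamilyOf False φ U := by
  rw [IsFredholmFamily, IsFredholmFamilyOf, isFamily_iff hU, sc0OnOf_prod_iff]
  refine and_congr_right fun _ => forall₂_congr fun x hx => exists_congr fun V =>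
    and_congr_right fun hV => and_congr_right fun _ => and_congr_right fun _ =>
    exists₃_congr fun ψ κ κ' => ?_
  rw [isFamily_iff hV, sc0OnOf_prod_iff, isStronglySmoothing_iff hV, isStronglySmoothing_iff hV]

theorem isTameFredholmFamily_iff {φ : E → E₁ →ₗ[𝕜] E₂} {U : Set E} (hU : IsOpen U) :
    IsTameFredholmFamily φ U ↔ IsFredholmFamilyOf True φ U := by
  rw [IsTameFredholmFamily, IsFredholmFamilyOf, isTameFamily_iff hU, sc0OnOf_prod_iff]
  refine and_congr_right fun _ => forall₂_congr fun x hx => exists_congr fun V =>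
    and_congr_right fun hV => and_congr_right fun _ => and_congr_right fun _ =>
    exists₃_congr fun ψ κ κ' => ?_
  rw [isTameFamily_iff hV, sc0OnOf_prod_iff, isTameStronglySmoothing_iff hV,
    isTameStronglySmoothing_iff hV]

theorem SmoothingAt.mono {t' : Prop} {κ : E → E₁ →ₗ[𝕜] E₂} {x : E} (h : SmoothingAt t κ x)
    (ht : t' → t) : SmoothingAt t' κ x :=
  h.imp fun _ h => h.mono ht

theorem IsFredholmFamilyOf.mono {t' : Prop} {φ : E → E₁ →ₗ[𝕜] E₂} {U : Set E}
    (h : IsFredholmFamilyOf t φ U) (ht : t' → t) : IsFredholmFamilyOf t' φ U := by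
  refine ⟨fun x hx u => (h.1 x hx u).mono ht, fun x hx => ?_⟩
  obtain ⟨V, hV, hxV, hVU, ψ, κ, κ', hψ, hκ, hκ', h1, h2⟩ := h.2 x hx
  exact ⟨V, hV, hxV, hVU, ψ, κ, κ', fun x hx u => (hψ x hx u).mono ht,
    fun x hx => (hκ x hx).mono ht, fun x hx => (hκ' x hx).mono ht, h1, h2⟩

theorem IsFamilyOf.comp {f : E → E'} {φ : E → E₁ →ₗ[𝕜] E₂} {φ' : E' → E₂ →ₗ[𝕜] E₃} {U : Set E}
    {U' : Set E'} (hφ' : IsFamilyOf t φ' U') (hφ : IsFamilyOf t φ U) (hf : Sc0OnOf 𝕜 t f U)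
    (h : MapsTo f U U') : IsFamilyOf t (fun x => φ' (f x) ∘ₗ φ x) U := fun x hx u =>
  Sc0At.comp (g := fun p : E' × E₂ => φ' p.1 p.2) (f := fun p : E × E₁ => (f p.1, φ p.1 p.2))
    (hφ' (f x) (h hx) (φ x u))
    ((Sc0At.comp (f := Prod.fst) (hf x hx) Sc0At.fst).prodMk (hφ x hx u))

/-- This is the ideal property of smoothing families. To reach the fixed fibre level used by `κ`,
the map `φ` needs only one fibre level of its own; `ψ` is applied afterwards and keeps the class
sc⁰. -/
theorem SmoothingAt.comp {f : E → E'} {φ : E → E₁ →ₗ[𝕜] E₂} {κ : E' → E₂ →ₗ[𝕜] E₃}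
    {ψ : E → E₃ →ₗ[𝕜] E₄} {x : E} (hκ : SmoothingAt t κ (f x))
    (hf : Sc0At t (ScFrechet.tower 𝕜 E) (ScFrechet.tower 𝕜 E') f x)
    (hφ : Sc0At t ((ScFrechet.tower 𝕜 E).prod (ScFrechet.tower 𝕜 E₁))
      (ScFrechet.tower 𝕜 E₂) (fun p : E × E₁ => φ p.1 p.2) (x, 0))
    (hψ : Sc0At t ((ScFrechet.tower 𝕜 E).prod (ScFrechet.tower 𝕜 E₃))
      (ScFrechet.tower 𝕜 E₄) (fun p : E × E₃ => ψ p.1 p.2) (x, 0)) :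
    SmoothingAt t (fun x => ψ x ∘ₗ κ (f x) ∘ₗ φ x) x := by
  obtain ⟨l, hκ⟩ := hκ
  obtain ⟨l', hl'⟩ := hφ.toConst l
  refine ⟨l', ?_⟩
  have h1 := (Sc0At.comp (f := Prod.fst) (x₀ := (x, (0 : E₁))) hf
    (Sc0At.fst (T' := (ScFrechet.tower 𝕜 E₁).const l'))).prodMk (hl' l' le_rfl)
  have h2 : Sc0At t ((ScFrechet.tower 𝕜 E).prod ((ScFrechet.tower 𝕜 E₁).const l'))
      (ScFrechet.tower 𝕜 E₃) (fun p : E × E₁ => κ (f p.1) (φ p.1 p.2)) (x, 0) := by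
    refine Sc0At.comp (g := fun p : E' × E₂ => κ p.1 p.2) ?_ h1
    simpa using hκ
  refine Sc0At.comp (g := fun p : E × E₃ => ψ p.1 p.2)
    (f := fun p : E × E₁ => (p.1, κ (f p.1) (φ p.1 p.2))) ?_ (Sc0At.fst.prodMk h2)
  simpa using hψ

theorem SmoothingAt.add {κ κ' : E → E₁ →ₗ[𝕜] E₂} {x : E} (h : SmoothingAt t κ x)
    (h' : SmoothingAt t κ' x) : SmoothingAt t (fun x => κ x + κ' x) x := by
  obtain ⟨l, h⟩ := h
  obtain ⟨l', h'⟩ := h'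
  exact ⟨max l l', Sc0At.add
    (Sc0At.comp (f := id) h (Sc0At.prodConst_mono (le_max_left l l')))
    (Sc0At.comp (f := id) h' (Sc0At.prodConst_mono (le_max_right l l')))⟩

theorem IsFredholmFamilyOf.congr {φ φ' : E → E₁ →ₗ[𝕜] E₂} {U : Set E}
    (h : IsFredholmFamilyOf t φ U) (hU : IsOpen U) (hφ : EqOn φ φ' U) :
    IsFredholmFamilyOf t φ' U := by
  refine ⟨?_, fun x hx => ?_⟩
  · have h1 := sc0OnOf_prod_iff.2 h.1
    exact sc0OnOf_prod_iff.1 (h1.congr (hU.prod isOpen_univ) fun p hp => by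
      change φ p.1 p.2 = φ' p.1 p.2
      rw [hφ hp.1])
  · obtain ⟨V, hV, hxV, hVU, ψ, κ, κ', hψ, hκ, hκ', h1, h2⟩ := h.2 x hx
    refine ⟨V, hV, hxV, hVU, ψ, κ, κ', hψ, hκ, hκ', fun x hx u => ?_, fun x hx u => ?_⟩
    · rw [← hφ (hVU hx), h1 x hx]
    · rw [← hφ (hVU hx), h2 x hx]

/-- Compositions of Fredholm families are Fredholm families. -/
theorem IsFredholmFamilyOf.comp {f : E → E'} {φ : E → E₁ →ₗ[𝕜] E₂} {φ' : E' → E₂ →ₗ[𝕜] E₃}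
    {U : Set E} {U' : Set E'} (hφ' : IsFredholmFamilyOf t φ' U') (hφ : IsFredholmFamilyOf t φ U)
    (hf : Sc0OnOf 𝕜 t f U) (h : MapsTo f U U') :
    IsFredholmFamilyOf t (fun x => φ' (f x) ∘ₗ φ x) U := by
  refine ⟨hφ'.1.comp hφ.1 hf h, fun x hx => ?_⟩
  obtain ⟨V, hV, hxV, hVU, ψ, κ, κ', hψ, hκ, hκ', h1, h2⟩ := hφ.2 x hx
  obtain ⟨V', hV', hxV', hVU', ψ', μ, μ', hψ', hμ, hμ', h1', h2'⟩ := hφ'.2 (f x) (h hx)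
  have hfV : Sc0OnOf 𝕜 t f (V ∩ f ⁻¹' V') := fun y hy => hf y (hVU hy.1)
  -- The composite parametrix is `ψ ψ'`. From `ψ ψ' φ' φ = ψ (1 + μ) φ = 1 + κ + ψ μ φ`, and
  -- symmetrically on the other side, come the error terms.
  refine ⟨V ∩ f ⁻¹' V', (hf.continuousOn.mono hVU).isOpen_inter_preimage hV hV', ⟨hxV, hxV'⟩,
    inter_subset_left.trans hVU, fun x => ψ x ∘ₗ ψ' (f x),
    fun x => κ x + ψ x ∘ₗ μ (f x) ∘ₗ φ x, fun x => μ' (f x) + φ' (f x) ∘ₗ κ' x ∘ₗ ψ' (f x),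
    ?_, ?_, ?_, ?_, ?_⟩
  · intro y hy u
    exact Sc0At.comp (g := fun p : E × E₂ => ψ p.1 p.2)
      (f := fun p : E × E₃ => (p.1, ψ' (f p.1) p.2)) (hψ y hy.1 _)
      (Sc0At.fst.prodMk (Sc0At.comp (g := fun p : E' × E₃ => ψ' p.1 p.2)
        (f := fun p : E × E₃ => (f p.1, p.2)) (hψ' (f y) hy.2 u)
        ((Sc0At.comp (f := Prod.fst) (hfV y hy) Sc0At.fst).prodMk Sc0At.snd)))
  · intro y hy
    exact (hκ y hy.1).add (SmoothingAt.comp (hμ _ hy.2) (hfV y hy) (hφ.1 y (hVU hy.1) 0)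
      (hψ y hy.1 0))
  · intro y hy
    have h3 : ∀ u, Sc0At t ((ScFrechet.tower 𝕜 E).prod (ScFrechet.tower 𝕜 E₃))
        ((ScFrechet.tower 𝕜 E').prod (ScFrechet.tower 𝕜 E₃)) (fun p : E × E₃ => (f p.1, p.2))
        (y, u) := fun u =>
      (Sc0At.comp (f := Prod.fst) (hfV y hy) Sc0At.fst).prodMk Sc0At.snd
    have h4 : ∀ u, Sc0At t ((ScFrechet.tower 𝕜 E).prod (ScFrechet.tower 𝕜 E₂))
        ((ScFrechet.tower 𝕜 E').prod (ScFrechet.tower 𝕜 E₂)) (fun p : E × E₂ => (f p.1, p.2))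
        (y, u) := fun u =>
      (Sc0At.comp (f := Prod.fst) (hfV y hy) Sc0At.fst).prodMk Sc0At.snd
    refine SmoothingAt.add ?_ ?_
    · obtain ⟨l, hl⟩ := hμ' (f y) hy.2
      refine ⟨l, Sc0At.comp (g := fun p : E' × E₃ => μ' p.1 p.2)
        (f := fun p : E × E₃ => (f p.1, p.2)) hl ?_⟩
      exact (Sc0At.comp (f := Prod.fst) (hfV y hy) Sc0At.fst).prodMk Sc0At.snd
    · refine SmoothingAt.comp (f := id) (φ := fun x => ψ' (f x)) (ψ := fun x => φ' (f x))
        (hκ' y hy.1) (Sc0At.of_clm 0 fun j => ⟨j, fun _ => le_rfl,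
          ContinuousLinearMap.id 𝕜 _, fun _ => rfl⟩) ?_ ?_
      · exact Sc0At.comp (g := fun p : E' × E₃ => ψ' p.1 p.2)
          (f := fun p : E × E₃ => (f p.1, p.2)) (x₀ := (y, 0)) (hψ' (f y) hy.2 0) (h3 0)
      · exact Sc0At.comp (g := fun p : E' × E₂ => φ' p.1 p.2)
          (f := fun p : E × E₂ => (f p.1, p.2)) (x₀ := (y, 0)) (hφ'.1 (f y) (h (hVU hy.1)) 0) (h4 0)
  · intro y hy u
    simp only [LinearMap.comp_apply, LinearMap.add_apply]
    rw [h1' (f y) hy.2, map_add, h1 y hy.1, add_assoc]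
  · intro y hy u
    simp only [LinearMap.comp_apply, LinearMap.add_apply]
    rw [h2 y hy.1, map_add, h2' (f y) hy.2, add_assoc]

end Families

/-! ### Compositions of Fredholm maps -/

section FredholmMaps

variable {𝕜 : Type*} [RCLike 𝕜]
variable {E : Type u} [AddCommGroup E] [Module 𝕜 E] [TopologicalSpace E] [ScFrechet 𝕜 E]
variable {E' : Type v} [AddCommGroup E'] [Module 𝕜 E'] [TopologicalSpace E'] [ScFrechet 𝕜 E']
variable {E'' : Type w} [AddCommGroup E''] [Module 𝕜 E''] [TopologicalSpace E''] [ScFrechet 𝕜 E'']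
variable {U : Set E} {U' : Set E'} {f : E → E'} {f' : E' → E''}

theorem Sc1On.sc0OnOf (hf : Sc1On 𝕜 f U) (hU : IsOpen U) : Sc0OnOf 𝕜 False f U :=
  (sc0On_iff hU).1 hf.2.2.1

theorem Sc1On.diffFamily_comp (hf' : Sc1On 𝕜 f' U') (hf : Sc1On 𝕜 f U) (h : MapsTo f U U') :
    EqOn (fun x => diffFamily 𝕜 f' (f x) ∘ₗ diffFamily 𝕜 f x) (diffFamily 𝕜 (f' ∘ f)) U := by
  intro x hx
  have h1 := hasWeakFDerivAt_comp (hf.2.1 x hx) (hf'.2.1 (f x) (h hx))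
  simp only [diffFamily]
  rw [h1.weakDeriv_eq]
  rfl

theorem Sc1On.comp (hf' : Sc1On 𝕜 f' U') (hf : Sc1On 𝕜 f U) (hU : IsOpen U) (hU' : IsOpen U')
    (h : MapsTo f U U') : Sc1On 𝕜 (f' ∘ f) U := by
  refine ⟨hf'.1.comp hf.1 h,
    fun x hx => ⟨_, hasWeakFDerivAt_comp (hf.2.1 x hx) (hf'.2.1 (f x) (h hx))⟩,
    (sc0On_iff hU).2 ((hf'.sc0OnOf hU').comp (hf.sc0OnOf hU) h), ?_⟩
  have h1 : IsFamilyOf False (diffFamily 𝕜 f) U :=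
    sc0OnOf_prod_iff.1 ((sc0On_iff (hU.prod isOpen_univ)).1 hf.2.2.2)
  have h2 : IsFamilyOf False (diffFamily 𝕜 f') U' :=
    sc0OnOf_prod_iff.1 ((sc0On_iff (hU'.prod isOpen_univ)).1 hf'.2.2.2)
  refine (sc0On_iff (hU.prod isOpen_univ)).2
    ((sc0OnOf_prod_iff.2 (h2.comp h1 (hf.sc0OnOf hU) h)).congr (hU.prod isOpen_univ) ?_)
  intro p hp
  exact LinearMap.congr_fun (hf'.diffFamily_comp hf h hp.1) p.2

theorem IsFredholmMap.comp (hf' : IsFredholmMap 𝕜 f' U') (hf : IsFredholmMap 𝕜 f U)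
    (hU : IsOpen U) (hU' : IsOpen U') (h : MapsTo f U U') : IsFredholmMap 𝕜 (f' ∘ f) U := by
  refine ⟨hf'.1.comp hf.1 hU hU' h, (isFredholmFamily_iff hU).2 ?_⟩
  exact (((isFredholmFamily_iff hU').1 hf'.2).comp ((isFredholmFamily_iff hU).1 hf.2)
    (hf.1.sc0OnOf hU) h).congr hU (hf'.1.diffFamily_comp hf.1 h)

theorem IsTameFredholmMap.comp (hf' : IsTameFredholmMap 𝕜 f' U') (hf : IsTameFredholmMap 𝕜 f U)
    (hU : IsOpen U) (hU' : IsOpen U') (h : MapsTo f U U') :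
    IsTameFredholmMap 𝕜 (f' ∘ f) U := by
  have h1 := (tameOn_iff hU).1 hf.2.1
  refine ⟨hf'.1.comp hf.1 hU hU' h, (tameOn_iff hU).2 (((tameOn_iff hU').1 hf'.2.1).comp h1 h),
    (isTameFredholmFamily_iff hU).2 ?_⟩
  exact (((isTameFredholmFamily_iff hU').1 hf'.2.2).comp ((isTameFredholmFamily_iff hU).1 hf.2.2)
    h1 h).congr hU (hf'.1.diffFamily_comp hf.1 h)

theorem IsTameFredholmMap.isFredholmMap (hf : IsTameFredholmMap 𝕜 f U) (hU : IsOpen U) :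
    IsFredholmMap 𝕜 f U :=
  ⟨hf.1, (isFredholmFamily_iff hU).2 (((isTameFredholmFamily_iff hU).1 hf.2.2).mono False.elim)⟩

end FredholmMaps

/-! ### Semicontinuity of kernels and local constancy of the index -/

section Index

variable {𝕜 : Type*} [RCLike 𝕜]
variable {E : Type u} [AddCommGroup E] [Module 𝕜 E] [TopologicalSpace E]
variable {E₁ : Type v} [AddCommGroup E₁] [Module 𝕜 E₁] [TopologicalSpace E₁]
variable {E₂ : Type w} [AddCommGroup E₂] [Module 𝕜 E₂] [TopologicalSpace E₂]

/-- Additivity and homogeneity hold on the dense image of `X` and persist by continuity. -/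
theorem Tower.exists_clm_of_continuous {X Y : Type*} [AddCommGroup X] [Module 𝕜 X]
    [AddCommGroup Y] [Module 𝕜 Y] {T : Tower 𝕜 X} {T' : Tower 𝕜 Y} (f : X →ₗ[𝕜] Y) {l j : ℕ}
    (a : T.level l → T'.level j) (ha : Continuous a) (haf : ∀ u, a (T.π l u) = T'.π j (f u)) :
    ∃ A : T.level l →L[𝕜] T'.level j, ∀ w, A w = a w := by
  refine ⟨⟨⟨⟨a, fun v w => ?_⟩, fun c w => ?_⟩, ha⟩, fun _ => rfl⟩
  · refine eqOn_of_denseRange ((T.denseRange_π l).prodMap (T.denseRange_π l)) isOpen_univ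
      (f := fun p => a (p.1 + p.2)) (g := fun p => a p.1 + a p.2)
      (Continuous.continuousOn (by fun_prop)) (Continuous.continuousOn (by fun_prop))
      (fun y _ => ?_) (mem_univ (v, w))
    simp only [Prod.map_fst, Prod.map_snd]
    rw [haf, haf, ← map_add, haf, map_add, map_add]
  · refine eqOn_of_denseRange (T.denseRange_π l) isOpen_univ
      (f := fun p => a (c • p)) (g := fun p => c • a p)
      (Continuous.continuousOn (by fun_prop)) (Continuous.continuousOn (by fun_prop))
      (fun y _ => ?_) (mem_univ w)
    rw [haf, ← map_smul, haf, map_smul, map_smul]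

namespace ScStructure

/-- The inclusions between levels are injective, so one component determines all higher ones, and
these determine the lower ones. -/
theorem π_injective (S : ScStructure 𝕜 E) (n : ℕ) : Function.Injective (S.tower.π n) := by
  intro x y h
  apply S.φ.symm.injective
  apply Subtype.ext
  funext k
  have h1 : S.tower.π (n + k) x = S.tower.π (n + k) y := by
    apply S.chain.incl_injective (Nat.le_add_right n k)
    have h2 := S.tower.incl_π (Nat.le_add_right n k) x
    have h3 := S.tower.incl_π (Nat.le_add_right n k) y
    exact h2.trans (h.trans h3.symm)
  have h2 := S.tower.incl_π (Nat.le_add_left k n) x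
  have h3 := S.tower.incl_π (Nat.le_add_left k n) y
  rw [h1] at h2
  exact h2.symm.trans h3

/-- If `f` extends to continuous linear maps from a fixed level to all levels, then `1 + f` has
finite dimensional kernel and cokernel, and index zero. -/
theorem finiteKerCoker_id_add (S : ScStructure 𝕜 E) (f : E →ₗ[𝕜] E) (l : ℕ)
    (A : ∀ j, S.tower.level l →L[𝕜] S.tower.level j)
    (hA : ∀ j u, A j (S.tower.π l u) = S.tower.π j (f u)) :
    FiniteKerCoker (LinearMap.id + f) ∧ fredholmIndex (LinearMap.id + f) = 0 := by
  have hincl : ∀ {i j : ℕ} (h : i ≤ j) w, S.tower.incl h (A j w) = A i w := by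
    intro i j h w
    refine eqOn_of_denseRange (S.tower.denseRange_π l) isOpen_univ
      (f := fun w => S.tower.incl h (A j w)) (g := fun w => A i w)
      (Continuous.continuousOn (by fun_prop)) (Continuous.continuousOn (by fun_prop))
      (fun y _ => ?_) (mem_univ w)
    rw [hA, hA, S.tower.incl_π]
  -- The compatible maps `A j` assemble to `B` from level `l` to `E` with `f = B ∘ π_l` and `π_l ∘ B
  -- = A l`. The latter is compact since it factors through `A (l + 1)` and a compact inclusion.
  let A' : S.tower.level l →ₗ[𝕜] S.chain.infty :=
    { toFun := fun w => ⟨fun j => A j w, fun j =>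
        (S.chain.incl_le_succ j _).symm.trans (hincl j.le_succ w)⟩
      map_add' := fun v w => Subtype.ext (funext fun j => map_add (A j) v w)
      map_smul' := fun c w => Subtype.ext (funext fun j => map_smul (A j) c w) }
  let B : S.tower.level l →ₗ[𝕜] E := (S.φ : S.chain.infty →ₗ[𝕜] E) ∘ₗ A'
  have hB : ∀ j w, S.tower.π j (B w) = A j w := fun j w => S.tower_π_φ j (A' w)
  have hf : f = B ∘ₗ S.tower.π l := by
    ext u
    apply S.π_injective 0
    rw [LinearMap.comp_apply, hB, hA]
  have hBA : S.tower.π l ∘ₗ B = (A l : S.tower.level l →ₗ[𝕜] S.tower.level l) := by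
    ext w
    exact hB l w
  have hcomp : IsCompactOperator (A l) := by
    have h1 : ⇑(A l) = S.tower.incl l.le_succ ∘ A (l + 1) :=
      funext fun w => (hincl l.le_succ w).symm
    rw [h1]
    have h2 : IsCompactOperator (S.tower.incl l.le_succ) :=
      S.chain.isCompactOperator_incl l.lt_succ_self
    exact h2.comp_clm (A (l + 1))
  have : CompleteSpace (S.tower.level l) := S.chain.complete l
  obtain ⟨h1, h2⟩ := hcomp.finiteKerCoker_one_add
  rw [← hBA] at h1 h2
  rw [hf]
  exact ⟨h1.one_add_comp_comm, (fredholmIndex_one_add_comp_comm _ _).trans h2⟩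

end ScStructure

variable [ScFrechet 𝕜 E] [ScFrechet 𝕜 E₁] [ScFrechet 𝕜 E₂]

/-- A strongly smoothing family extends continuously to a fixed level of the fibre. -/
theorem SmoothingAt.exists_ext {κ : E → E₁ →ₗ[𝕜] E₂} {x₀ : E} (h : SmoothingAt False κ x₀) :
    ∃ l, ∀ j, ∃ (n : ℕ)
      (G : (ScFrechet.tower 𝕜 E).level n × (ScFrechet.tower 𝕜 E₁).level l →
        (ScFrechet.tower 𝕜 E₂).level j),
      (∀ w, ContinuousAt G ((ScFrechet.tower 𝕜 E).π n x₀, w)) ∧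
      ∀ᶠ y in 𝓝 x₀, ∀ u, G ((ScFrechet.tower 𝕜 E).π n y, (ScFrechet.tower 𝕜 E₁).π l u) =
        (ScFrechet.tower 𝕜 E₂).π j (κ y u) := by
  obtain ⟨l, m, ε, hε, c, h⟩ := h
  refine ⟨l, fun j => ?_⟩
  obtain ⟨n, hmn, -, he⟩ := h j
  obtain ⟨⟨W, G, hW, hG, hGκ⟩, -⟩ := he.exists_product hε hmn
  have hx₀ := (hGκ x₀ (by simpa using hε)).1
  refine ⟨n, G, fun w => hG.continuousAt ((hW.prod isOpen_univ).mem_nhds ⟨hx₀, mem_univ _⟩), ?_⟩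
  exact (ScFrechet.str (𝕜 := 𝕜) (E := E)).mem_nhds_iff.2 ⟨m, ε, hε, fun y hy => (hGκ y hy).2⟩

theorem SmoothingAt.finiteKerCoker {κ : E → E₁ →ₗ[𝕜] E₁} {x : E} (h : SmoothingAt False κ x) :
    FiniteKerCoker (LinearMap.id + κ x) ∧ fredholmIndex (LinearMap.id + κ x) = 0 := by
  obtain ⟨l, h⟩ := h.exists_ext
  have hA : ∀ j, ∃ A : (ScFrechet.tower 𝕜 E₁).level l →L[𝕜] (ScFrechet.tower 𝕜 E₁).level j,
      ∀ u, A ((ScFrechet.tower 𝕜 E₁).π l u) = (ScFrechet.tower 𝕜 E₁).π j (κ x u) := by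
    intro j
    obtain ⟨n, G, hG, hGκ⟩ := h j
    have hx := hGκ.self_of_nhds
    obtain ⟨A, hA⟩ := Tower.exists_clm_of_continuous (κ x)
      (fun w => G ((ScFrechet.tower 𝕜 E).π n x, w)) (continuous_iff_continuousAt.2 fun w =>
        ContinuousAt.comp (f := fun w => ((ScFrechet.tower 𝕜 E).π n x, w)) (hG w)
          (by fun_prop)) hx
    exact ⟨A, fun u => (hA _).trans (hx u)⟩
  choose A hA using hA
  exact (ScFrechet.str (𝕜 := 𝕜) (E := E₁)).finiteKerCoker_id_add (κ x) l A hA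

/-- Both composites of `φ x` and `ψ x` have the form identity plus smoothing, hence have finite
kernel and cokernel and index zero. This bounds kernel and cokernel of each factor, and additivity
relates the indices. -/
theorem finiteKerCoker_of_parametrix {φ : E → E₁ →ₗ[𝕜] E₂} {ψ : E → E₂ →ₗ[𝕜] E₁}
    {κ : E → E₁ →ₗ[𝕜] E₁} {κ' : E → E₂ →ₗ[𝕜] E₂} {x : E} (hκ : SmoothingAt False κ x)
    (hκ' : SmoothingAt False κ' x) (h : ∀ u, ψ x (φ x u) = u + κ x u)
    (h' : ∀ u, φ x (ψ x u) = u + κ' x u) :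
    FiniteKerCoker (φ x) ∧ fredholmIndex (φ x) + fredholmIndex (ψ x) = 0 := by
  have h1 : ψ x ∘ₗ φ x = LinearMap.id + κ x := LinearMap.ext h
  have h2 : φ x ∘ₗ ψ x = LinearMap.id + κ' x := LinearMap.ext h'
  have h3 := hκ.finiteKerCoker
  have h4 := hκ'.finiteKerCoker
  rw [← h1] at h3
  rw [← h2] at h4
  have hφ : FiniteKerCoker (φ x) := h3.1.of_comp h4.1
  have hψ : FiniteKerCoker (ψ x) := h4.1.of_comp h3.1
  exact ⟨hφ, (finiteKerCoker_comp_and_index hφ hψ).2.symm.trans h3.2⟩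

theorem IsFamilyOf.continuousAt {t : Prop} {φ : E → E₁ →ₗ[𝕜] E₂} {U : Set E}
    (h : IsFamilyOf t φ U) {x : E} (hx : x ∈ U) (u : E₁) :
    ContinuousAt (fun p : E × E₁ => φ p.1 p.2) (x, u) :=
  (sc0At_prod_iff.2 (h x hx u)).continuousAt

/-- Injectivity of `(u, a) ↦ φ x u + J a` on `ker ℓ × L` is an open condition on `x`. -/
theorem eventually_injective {φ : E → E₁ →ₗ[𝕜] E₂} {ψ : E → E₂ →ₗ[𝕜] E₁} {κ : E → E₁ →ₗ[𝕜] E₁}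
    {V : Set E} (hV : IsOpen V) {x₀ : E} (hx₀ : x₀ ∈ V) (hφ : IsFamilyOf False φ V)
    (hψ : IsFamilyOf False ψ V) (hκ : SmoothingAt False κ x₀)
    (h : ∀ x ∈ V, ∀ u, ψ x (φ x u) = u + κ x u) {N : Type*} [AddCommGroup N] [Module 𝕜 N]
    [TopologicalSpace N] [T2Space N] (ℓ : E₁ →L[𝕜] N) {L : Type*} [NormedAddCommGroup L]
    [NormedSpace 𝕜 L] [FiniteDimensional 𝕜 L] (J : L →ₗ[𝕜] E₂)
    (hinj : ∀ u a, ℓ u = 0 → φ x₀ u + J a = 0 → u = 0 ∧ a = 0) :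
    ∀ᶠ x in 𝓝 x₀, ∀ u a, ℓ u = 0 → φ x u + J a = 0 → u = 0 ∧ a = 0 := by
  set S : ScStructure 𝕜 E := ScFrechet.str
  set S₁ : ScStructure 𝕜 E₁ := ScFrechet.str
  set S₂ : ScStructure 𝕜 E₂ := ScFrechet.str
  have := S.firstCountableTopology
  have := S₁.isTopologicalAddGroup
  have := S₂.isTopologicalAddGroup
  have := S₂.continuousSMul
  have := S₂.t2Space
  have : ProperSpace L := FiniteDimensional.proper 𝕜 L
  have hJ : Continuous J := J.continuous_of_finiteDimensional
  by_contra hcon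
  obtain ⟨l, hext⟩ := hκ.exists_ext
  obtain ⟨x, hx, hxp⟩ := exists_seq_forall_of_frequently
    ((not_eventually.1 hcon).and_eventually (hV.mem_nhds hx₀))
  -- Counterexamples are normalised in level `l + 1`, so that the compact inclusion into level `l`
  -- gives a convergent subsequence there; `l` is the fibre level through which `κ` factors.
  have hnorm : ∀ i, ∃ u a, ℓ u = 0 ∧ φ (x i) u + J a = 0 ∧
      ‖S₁.tower.π (l + 1) u‖ + ‖a‖ = 1 := by
    intro i
    have h1 := (hxp i).1
    push Not at h1
    obtain ⟨u, a, hu, hua, hne⟩ := h1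
    set r : ℝ := ‖S₁.tower.π (l + 1) u‖ + ‖a‖ with hr
    have hr0 : r ≠ 0 := by
      intro h0
      have h1 : ‖S₁.tower.π (l + 1) u‖ = 0 := by
        linarith [norm_nonneg a, norm_nonneg (S₁.tower.π (l + 1) u)]
      have h2 : ‖a‖ = 0 := by linarith
      refine hne ?_ (norm_eq_zero.1 h2)
      apply S₁.π_injective (l + 1)
      rw [norm_eq_zero.1 h1, map_zero]
    have hrpos : 0 ≤ r := by positivity
    refine ⟨(r : 𝕜)⁻¹ • u, (r : 𝕜)⁻¹ • a, by rw [map_smul, hu, smul_zero], ?_, ?_⟩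
    · rw [map_smul, map_smul, ← smul_add, hua, smul_zero]
    · have h1 : ‖(r : 𝕜)⁻¹‖ = r⁻¹ := by simp [abs_of_nonneg hrpos]
      rw [map_smul, norm_smul, norm_smul, h1, ← mul_add, ← hr, inv_mul_cancel₀ hr0]
  choose u a hu hua hua1 using hnorm
  have hcpt : IsCompactOperator (S₁.tower.incl l.le_succ) :=
    S₁.chain.isCompactOperator_incl l.lt_succ_self
  obtain ⟨K, hK, hK'⟩ := hcpt.image_closedBall_subset_compact 1
  have hmem : ∀ i, (S₁.tower.π l (u i), a i) ∈ K ×ˢ Metric.closedBall (0 : L) 1 := by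
    intro i
    constructor
    · refine hK' ⟨S₁.tower.π (l + 1) (u i), ?_, S₁.tower.incl_π _ _⟩
      rw [mem_closedBall_zero_iff]
      linarith [hua1 i, norm_nonneg (a i)]
    · rw [mem_closedBall_zero_iff]
      linarith [hua1 i, norm_nonneg (S₁.tower.π (l + 1) (u i))]
  obtain ⟨⟨w, b⟩, -, σ, hσ, hlim⟩ :=
    (hK.prod (isCompact_closedBall (0 : L) 1)).tendsto_subseq hmem
  have hw : Tendsto (fun i => S₁.tower.π l (u (σ i))) atTop (𝓝 w) :=
    (continuous_fst.tendsto _).comp hlim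
  have hb : Tendsto (fun i => a (σ i)) atTop (𝓝 b) := (continuous_snd.tendsto _).comp hlim
  have hxσ : Tendsto (fun i => x (σ i)) atTop (𝓝 x₀) := hx.comp hσ.tendsto_atTop
  have hψlim : Tendsto (fun i => ψ (x (σ i)) (J (a (σ i)))) atTop (𝓝 (ψ x₀ (J b))) :=
    (hψ.continuousAt hx₀ (J b)).tendsto.comp (hxσ.prodMk_nhds ((hJ.tendsto b).comp hb))
  -- Bootstrapping: `φ u = -J a` and the parametrix give `u = -ψ (J a) - κ u`. The first term
  -- converges in `E₁`, and `κ u` converges in every level because it depends continuously on the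
  -- component of `u` in level `l`.
  have hlevel : ∀ j, ∃ z, Tendsto (fun i => S₁.tower.π j (u (σ i))) atTop (𝓝 z) := by
    intro j
    obtain ⟨n, (G : S.tower.level n × S₁.tower.level l → S₁.tower.level j), hG, hGκ⟩ := hext j
    refine ⟨-S₁.tower.π j (ψ x₀ (J b)) - G (S.tower.π n x₀, w), ?_⟩
    have h1 : Tendsto (fun i => S₁.tower.π j (ψ (x (σ i)) (J (a (σ i))))) atTop
        (𝓝 (S₁.tower.π j (ψ x₀ (J b)))) := ((S₁.continuous_π j).tendsto _).comp hψlim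
    have h2 : Tendsto (fun i => G (S.tower.π n (x (σ i)), S₁.tower.π l (u (σ i)))) atTop
        (𝓝 (G (S.tower.π n x₀, w))) :=
      (hG w).tendsto.comp ((((S.continuous_π n).tendsto _).comp hxσ).prodMk_nhds hw)
    refine (h1.neg.sub h2).congr' ?_
    filter_upwards [hxσ.eventually hGκ] with i hi
    have h3 := h _ (hxp (σ i)).2 (u (σ i))
    rw [eq_neg_of_add_eq_zero_left (hua (σ i)), map_neg] at h3
    have h4 : u (σ i) = -ψ (x (σ i)) (J (a (σ i))) - κ (x (σ i)) (u (σ i)) := by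
      rw [h3]; abel
    have h5 := congrArg (S₁.tower.π j) h4
    rw [map_sub, map_neg] at h5
    exact (congrArg (fun q => -S₁.tower.π j (ψ (x (σ i)) (J (a (σ i)))) - q) (hi (u (σ i)))).trans
      h5.symm
  choose z hz using hlevel
  have hz' : ∀ j, S₁.chain.ι j (z (j + 1)) = z j := by
    intro j
    refine tendsto_nhds_unique (((S₁.chain.ι j).continuous.tendsto _).comp (hz (j + 1))) ?_
    exact (hz j).congr fun i => ((S₁.φ.symm (u (σ i))).2 j).symm
  have hulim : Tendsto (fun i => u (σ i)) atTop (𝓝 (S₁.φ ⟨z, hz'⟩)) := by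
    rw [S₁.tendsto_iff]
    intro j
    rw [S₁.tower_π_φ]
    exact hz j
  have hℓ : ℓ (S₁.φ ⟨z, hz'⟩) = 0 := by
    refine tendsto_nhds_unique ((ℓ.continuous.tendsto _).comp hulim) ?_
    exact tendsto_const_nhds.congr fun i => (hu (σ i)).symm
  have hφz : φ x₀ (S₁.φ ⟨z, hz'⟩) + J b = 0 := by
    have h1 : Tendsto (fun i => φ (x (σ i)) (u (σ i)) + J (a (σ i))) atTop
        (𝓝 (φ x₀ (S₁.φ ⟨z, hz'⟩) + J b)) :=
      ((hφ.continuousAt hx₀ _).tendsto.comp (hxσ.prodMk_nhds hulim)).add ((hJ.tendsto b).comp hb)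
    exact tendsto_nhds_unique h1 (tendsto_const_nhds.congr fun i => (hua (σ i)).symm)
  -- The limit is a null vector at `x₀`, hence zero, although the normalised quantity equals `1`
  -- along the sequence.
  obtain ⟨h1, h2⟩ := hinj _ _ hℓ hφz
  have h3 : Tendsto (fun i => ‖S₁.tower.π (l + 1) (u (σ i))‖ + ‖a (σ i)‖) atTop
      (𝓝 (‖S₁.tower.π (l + 1) (S₁.φ ⟨z, hz'⟩)‖ + ‖b‖)) :=
    (((S₁.continuous_π (l + 1)).tendsto _).comp hulim).norm.add hb.norm
  rw [h1, h2, map_zero, norm_zero, norm_zero, add_zero] at h3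
  exact zero_ne_one (tendsto_nhds_unique h3 (tendsto_const_nhds.congr fun i => (hua1 (σ i)).symm))

theorem eventually_dimKer_le_and_index_le {φ : E → E₁ →ₗ[𝕜] E₂} {ψ : E → E₂ →ₗ[𝕜] E₁}
    {κ : E → E₁ →ₗ[𝕜] E₁} {V : Set E} (hV : IsOpen V) {x₀ : E} (hx₀ : x₀ ∈ V)
    (hφ : IsFamilyOf False φ V) (hψ : IsFamilyOf False ψ V) (hκ : SmoothingAt False κ x₀)
    (h : ∀ x ∈ V, ∀ u, ψ x (φ x u) = u + κ x u) (hfin : ∀ x ∈ V, FiniteKerCoker (φ x)) :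
    ∀ᶠ x in 𝓝 x₀, dimKer (φ x) ≤ dimKer (φ x₀) ∧
      fredholmIndex (φ x) ≤ fredholmIndex (φ x₀) := by
  set S₁ : ScStructure 𝕜 E₁ := ScFrechet.str
  obtain ⟨hker, hcoker⟩ := hfin x₀ hx₀
  -- The kernel is viewed in the Banach space of level zero, where a finite dimensional subspace has
  -- a continuous projection. This makes `ℓ` continuous on `E₁` and injective on the kernel.
  let N := (LinearMap.ker (φ x₀)).map (S₁.tower.π 0)
  obtain ⟨P, hP⟩ := Submodule.ClosedComplemented.of_finiteDimensional N
  let ℓ : E₁ →L[𝕜] N := P.comp ⟨S₁.tower.π 0, S₁.continuous_π 0⟩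
  set R := LinearMap.range (φ x₀) with hR
  obtain ⟨s, hs⟩ := R.mkQ.exists_rightInverse_of_surjective R.range_mkQ
  let e : (Fin (corank (φ x₀)) → 𝕜) ≃ₗ[𝕜] E₂ ⧸ R := (Module.finBasis 𝕜 (E₂ ⧸ R)).equivFun.symm
  -- `J` parametrises an algebraic complement of the range, so its domain has dimension the corank
  -- at `x₀`.
  let J : (Fin (corank (φ x₀)) → 𝕜) →ₗ[𝕜] E₂ := s ∘ₗ (e : (Fin (corank (φ x₀)) → 𝕜) →ₗ[𝕜] E₂ ⧸ R)
  have hinj : ∀ u a, ℓ u = 0 → φ x₀ u + J a = 0 → u = 0 ∧ a = 0 := by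
    intro u a hu hua
    have h1 := congrArg R.mkQ hua
    have h2 : R.mkQ (φ x₀ u) = 0 := (Submodule.Quotient.mk_eq_zero R).2 ⟨u, rfl⟩
    have h3 : R.mkQ (J a) = e a := LinearMap.congr_fun hs (e a)
    rw [map_add, h2, h3, zero_add, map_zero] at h1
    have ha : a = 0 := e.map_eq_zero_iff.1 h1
    rw [ha, map_zero, add_zero] at hua
    refine ⟨?_, ha⟩
    have h4 : P (S₁.tower.π 0 u) = 0 := hu
    have h5 := hP ⟨S₁.tower.π 0 u, Submodule.mem_map_of_mem hua⟩
    rw [h4] at h5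
    apply S₁.π_injective 0
    rw [map_zero]
    exact (congrArg (Subtype.val : N → _) h5).symm
  have hN : Module.finrank 𝕜 N ≤ dimKer (φ x₀) := Submodule.finrank_map_le _ _
  filter_upwards [eventually_injective hV hx₀ hφ hψ hκ h ℓ J hinj, hV.mem_nhds hx₀] with x hx hxV
  obtain ⟨h1, h2⟩ := dimKer_le_and_index_le (hfin x hxV) (ℓ : E₁ →ₗ[𝕜] N) J hx
  refine ⟨h1.trans hN, h2.trans ?_⟩
  rw [Module.finrank_fin_fun, fredholmIndex]
  omega

theorem IsFredholmFamilyOf.finiteKerCoker {φ : E → E₁ →ₗ[𝕜] E₂} {U : Set E}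
    (h : IsFredholmFamilyOf False φ U) {x : E} (hx : x ∈ U) : FiniteKerCoker (φ x) := by
  obtain ⟨V, hV, hxV, hVU, ψ, κ, κ', hψ, hκ, hκ', h1, h2⟩ := h.2 x hx
  exact (finiteKerCoker_of_parametrix (hκ x hxV) (hκ' x hxV) (h1 x hxV) (h2 x hxV)).1

/-- The roles of `φ` and `ψ` are symmetric, so near `x₀` neither index exceeds its value at `x₀`.
The two indices are opposite, so both are constant there, and corank equals kernel dimension minus
index. -/
theorem IsFredholmFamilyOf.eventually {φ : E → E₁ →ₗ[𝕜] E₂} {U : Set E}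
    (h : IsFredholmFamilyOf False φ U) {x₀ : E} (hx₀ : x₀ ∈ U) :
    ∀ᶠ x in 𝓝 x₀, dimKer (φ x) ≤ dimKer (φ x₀) ∧ corank (φ x) ≤ corank (φ x₀) ∧
      fredholmIndex (φ x) = fredholmIndex (φ x₀) := by
  obtain ⟨V, hV, hxV, hVU, ψ, κ, κ', hψ, hκ, hκ', h1, h2⟩ := h.2 x₀ hx₀
  have hφ : IsFamilyOf False φ V := fun x hx => h.1 x (hVU hx)
  have hp := fun x hx => finiteKerCoker_of_parametrix (hκ x hx) (hκ' x hx) (h1 x hx) (h2 x hx)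
  have hp' := fun x hx => finiteKerCoker_of_parametrix (hκ' x hx) (hκ x hx) (h2 x hx) (h1 x hx)
  filter_upwards [hV.mem_nhds hxV, eventually_dimKer_le_and_index_le hV hxV hφ hψ (hκ x₀ hxV) h1
    fun x hx => (hp x hx).1, eventually_dimKer_le_and_index_le hV hxV hψ hφ (hκ' x₀ hxV) h2
    fun x hx => (hp' x hx).1] with x hx h3 h4
  have h5 := (hp x hx).2
  have h6 := (hp x₀ hxV).2
  have h7 : fredholmIndex (φ x) = fredholmIndex (φ x₀) := by omega
  refine ⟨h3.1, ?_, h7⟩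
  simp only [fredholmIndex] at h7
  omega

theorem IsFredholmFamily.finiteKerCoker_and_semicontinuous {φ : E → E₁ →ₗ[𝕜] E₂} {U : Set E}
    (hU : IsOpen U) (h : IsFredholmFamily φ U) :
    (∀ x ∈ U, FiniteKerCoker (φ x)) ∧
      UpperSemicontinuousOn (fun x => dimKer (φ x)) U ∧
      UpperSemicontinuousOn (fun x => corank (φ x)) U ∧
      ContinuousOn (fun x => fredholmIndex (φ x)) U := by
  have h' := (isFredholmFamily_iff hU).1 h
  refine ⟨fun x hx => h'.finiteKerCoker hx, fun x hx y hy => ?_, fun x hx y hy => ?_,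
    fun x hx => ?_⟩
  · exact ((h'.eventually hx).filter_mono nhdsWithin_le_nhds).mono fun z hz => hz.1.trans_lt hy
  · exact ((h'.eventually hx).filter_mono nhdsWithin_le_nhds).mono fun z hz => hz.2.1.trans_lt hy
  · refine ContinuousAt.continuousWithinAt ((continuousAt_const (y := fredholmIndex (φ x))).congr ?_)
    exact (h'.eventually hx).mono fun z hz => hz.2.2.symm

end Index

/-! ### The index of a composition, and the main theorem -/

section Composition

variable {𝕜 : Type*} [RCLike 𝕜]
variable {E : Type u} [AddCommGroup E] [Module 𝕜 E] [TopologicalSpace E] [ScFrechet 𝕜 E]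
variable {E' : Type v} [AddCommGroup E'] [Module 𝕜 E'] [TopologicalSpace E'] [ScFrechet 𝕜 E']
variable {E'' : Type w} [AddCommGroup E''] [Module 𝕜 E''] [TopologicalSpace E''] [ScFrechet 𝕜 E'']

theorem IsFredholmMap.fredholmIndex_comp {U : Set E} {U' : Set E'} {f : E → E'} {f' : E' → E''}
    (hf' : IsFredholmMap 𝕜 f' U') (hf : IsFredholmMap 𝕜 f U) (hU : IsOpen U) (hU' : IsOpen U')
    (h : MapsTo f U U') {x : E} (hx : x ∈ U) :
    fredholmIndex (diffFamily 𝕜 (f' ∘ f) x) =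
      fredholmIndex (diffFamily 𝕜 f x) + fredholmIndex (diffFamily 𝕜 f' (f x)) := by
  rw [← hf'.1.diffFamily_comp hf.1 h hx]
  exact (finiteKerCoker_comp_and_index (((isFredholmFamily_iff hU).1 hf.2).finiteKerCoker hx)
    (((isFredholmFamily_iff hU').1 hf'.2).finiteKerCoker (h hx))).2

end Composition

theorem corollary4p1 {𝕜 : Type*} [RCLike 𝕜]
    {E : Type u} [AddCommGroup E] [Module 𝕜 E] [TopologicalSpace E] [ScFrechet 𝕜 E]
    {E' : Type v} [AddCommGroup E'] [Module 𝕜 E'] [TopologicalSpace E'] [ScFrechet 𝕜 E']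
    {E'' : Type w} [AddCommGroup E''] [Module 𝕜 E''] [TopologicalSpace E''] [ScFrechet 𝕜 E'']
    (U : Set E) (hU : IsOpen U) (U' : Set E') (hU' : IsOpen U') :
    -- Fredholm families
    (∀ φ : E → E' →ₗ[𝕜] E'', IsFredholmFamily φ U →
      (∀ x ∈ U, FiniteKerCoker (φ x)) ∧
      UpperSemicontinuousOn (fun x => dimKer (φ x)) U ∧
      UpperSemicontinuousOn (fun x => corank (φ x)) U ∧
      ContinuousOn (fun x => fredholmIndex (φ x)) U) ∧
    -- Fredholm maps
    (∀ f : E → E', IsFredholmMap 𝕜 f U →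
      (∀ x ∈ U, FiniteKerCoker (diffFamily 𝕜 f x)) ∧
      ContinuousOn (fun x => fredholmIndex (diffFamily 𝕜 f x)) U ∧
      UpperSemicontinuousOn (fun x => corank (diffFamily 𝕜 f x)) U) ∧
    -- compositions of Fredholm maps
    (∀ (f : E → E') (f' : E' → E''), MapsTo f U U' →
      IsFredholmMap 𝕜 f U → IsFredholmMap 𝕜 f' U' →
      IsFredholmMap 𝕜 (f' ∘ f) U ∧
      ∀ x ∈ U, fredholmIndex (diffFamily 𝕜 (f' ∘ f) x) =
        fredholmIndex (diffFamily 𝕜 f x) + fredholmIndex (diffFamily 𝕜 f' (f x))) ∧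
    -- tame Fredholm maps
    (∀ f : E → E', IsTameFredholmMap 𝕜 f U →
      (∀ x ∈ U, FiniteKerCoker (diffFamily 𝕜 f x)) ∧
      ContinuousOn (fun x => fredholmIndex (diffFamily 𝕜 f x)) U ∧
      UpperSemicontinuousOn (fun x => corank (diffFamily 𝕜 f x)) U) ∧
    -- compositions of tame Fredholm maps
    (∀ (f : E → E') (f' : E' → E''), MapsTo f U U' →
      IsTameFredholmMap 𝕜 f U → IsTameFredholmMap 𝕜 f' U' →
      IsTameFredholmMap 𝕜 (f' ∘ f) U ∧
      ∀ x ∈ U, fredholmIndex (diffFamily 𝕜 (f' ∘ f) x) =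
        fredholmIndex (diffFamily 𝕜 f x) + fredholmIndex (diffFamily 𝕜 f' (f x))) := by
  have key : ∀ f : E → E', IsFredholmMap 𝕜 f U →
      (∀ x ∈ U, FiniteKerCoker (diffFamily 𝕜 f x)) ∧
      ContinuousOn (fun x => fredholmIndex (diffFamily 𝕜 f x)) U ∧
      UpperSemicontinuousOn (fun x => corank (diffFamily 𝕜 f x)) U := fun f hf =>
    have h := hf.2.finiteKerCoker_and_semicontinuous hU
    ⟨h.1, h.2.2.2, h.2.2.1⟩
  refine ⟨fun φ hφ => hφ.finiteKerCoker_and_semicontinuous hU, key, ?_,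
    fun f hf => key f (hf.isFredholmMap hU), ?_⟩
  · exact fun f f' h hf hf' =>
      ⟨hf'.comp hf hU hU' h, fun x hx => hf'.fredholmIndex_comp hf hU hU' h hx⟩
  · exact fun f f' h hf hf' => ⟨hf'.comp hf hU hU' h, fun x hx =>
      (hf'.isFredholmMap hU').fredholmIndex_comp (hf.isFredholmMap hU) hU hU' h hx⟩
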